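/- Let $(\overline M,\langle\cdot,\cdot\rangle)$ be a smooth Riemannian $7$-manifold with a $G_2$-structure, i.e. a smooth $3$-form $\varphi$ that at each point is $\sum_{i\in\mathbb Z_7}e_i\wedge e_{i+1}\wedge e_{i+3}$ in some orthonormal basis (a Cayley frame). Let $*\varphi$ be its Hodge dual for $\mathrm{Vol}=e_0\wedge\dots\wedge e_6$, let $P$ be given by $\langle P(x,y),z\rangle=\varphi(x,y,z)$, and put $pd^*\varphi=*(*d\varphi\wedge\varphi)=\langle p_\varphi,\cdot\rangle$. Assume that the structure is of type $\mathcal X_4$ (locally conformally parallel): writing $\overline\nabla\varphi=\sum a_{ij}\,e_i\otimes(e_j\lrcorner *\varphi)$ in a Cayley frame, the form $\sum a_{ij}e_i\otimes e_j$ is at each point of the shape $x\lrcorner\varphi$ for some tangent vector $x$. Let $\iota:M\to\overline M$ be an oriented (immersed) hypersurface with smooth unit normal field $n$, let $B(x,y)=\langle II(x,y),n\rangle$ be its second fundamental form, and let $h=\tfrac16\mathrm{Tr}\,B$. Let $\theta:M\to\mathbb R$ be smooth, and give $M$ the induced $SU(3)$-structure: the induced metric, $Ix=P(n,x)$, $\omega(x,y)=\langle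 x,Iy\rangle$, and $\psi_++i\psi_-=e^{i\theta}\bigl(\iota^*\varphi+i\,\iota^*(n\lrcorner *\varphi)\bigr)$. Write $I\mu=-\mu\circ I$ for one-forms $\mu$ and $(IB)(x,y)=B(Ix,Iy)$. Let $d^*\omega=-\sum_i(\nabla_{e_i}\omega)(e_i,\cdot)$ (orthonormal basis $e_i$ of $TM$), and let $\eta$ be the one-form for which $-3\,I\eta\otimes\psi_-$ is the component of $\nabla\psi_+$ in $T^*M\otimes\mathbb R\psi_-$. Let $\mathcal W_1,\dots,\mathcal W_4$ be the Gray–Hervella modules of the values of $\nabla\omega$, and for $i=1,2$ let $\mathcal W_i^{+}$ (resp. $\mathcal W_i^-$) be the set of $\alpha\in\mathcal W_i$ for which $r(\alpha)(x,y)=\tfrac12\langle x\lrcorner\alpha,\,y\lrcorner\psi_+\rangle$ is symmetric (resp. skew). The structure is of type $\sum_{j\in A}\mathcal W_j$, for a set $A$ of labels among $1^\pm,2^\pm,3,4,5$, if everywhere $\nabla\omega$ lies in the sum of the $\mathcal W_j$ with $j\in A$, $j\ne 5$, and, when $5\notin A$, also $\eta=0$. Then $$3\,I d^*\omega=\iota^*pd^*\varphi=12\,I\,d\theta+36\,\eta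 ,$$ and $M$ is of the type on the left if and only if the condition on the right holds everywhere on $M$: 1. $\mathcal W_1^++\mathcal W_1^-+\mathcal W_2^++\mathcal W_2^-+\mathcal W_3+\mathcal W_4$: $\ \iota^*pd^*\varphi=12\,I\,d\theta$; 2. $\mathcal W_1^++\mathcal W_1^-+\mathcal W_2^++\mathcal W_2^-+\mathcal W_3+\mathcal W_5$: $\ p_\varphi$ is normal to $M$; 3. $\mathcal W_1^++\mathcal W_1^-+\mathcal W_2^++\mathcal W_2^-+\mathcal W_4+\mathcal W_5$: $\ IB=B$; 4. $\mathcal W_1^++\mathcal W_1^-+\mathcal W_2^++\mathcal W_3+\mathcal W_4+\mathcal W_5$: $\ 2h\sin\theta\,\langle\cdot,\cdot\rangle=\sin\theta\,(1+I)B$; 5. $\mathcal W_1^++\mathcal W_1^-+\mathcal W_2^-+\mathcal W_3+\mathcal W_4+\mathcal W_5$: $\ 2h\cos\theta\,\langle\cdot,\cdot\rangle=\cos\theta\,(1+I)B$; 6. $\mathcal W_1^++\mathcal W_2^++\mathcal W_2^-+\mathcal W_3+\mathcal W_4+\mathcal W_5$: $\ \sin\theta\,(pd^*\varphi(n)-12h)=0$;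 7. $\mathcal W_1^-+\mathcal W_2^++\mathcal W_2^-+\mathcal W_3+\mathcal W_4+\mathcal W_5$: $\ \cos\theta\,(pd^*\varphi(n)-12h)=0$; 8. $\mathcal W_1^++\mathcal W_1^-+\mathcal W_3+\mathcal W_4+\mathcal W_5$: $\ (1+I)B=2h\,\langle\cdot,\cdot\rangle$; 9. $\mathcal W_2^++\mathcal W_2^-+\mathcal W_3+\mathcal W_4+\mathcal W_5$: $\ pd^*\varphi(n)=12h$; 10. $\mathcal W_1^++\mathcal W_1^-+\mathcal W_4+\mathcal W_5$: $\ M$ is totally umbilic ($B=h\,\langle\cdot,\cdot\rangle$). -/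

import Mathlib

open scoped Manifold ContDiff

noncomputable section

namespace G2Hyp

/-! ### Multilinear algebra on a real vector space

Forms of degree `k` are written as functions `(Fin k → V) → ℝ`; the inner product is written as a
function `g : V → V → ℝ`. -/

section Algebra

variable {V : Type*} [AddCommGroup V] [Module ℝ V]

/-- `e` is orthonormal for the inner product `g`. For `n = dim V` it is an orthonormal basis. -/
def IsOrthonormalFrame {n : ℕ} (g : V → V → ℝ) (e : Fin n → V) : Prop :=
  ∀ i j, g (e i) (e j) = if i = j then 1 else 0

/-- A chosen orthonormal basis of the inner product space `(V, g)` of dimension `n`. Every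
expression below that uses it is independent of the choice. -/
def onFrame (n : ℕ) (g : V → V → ℝ) : Fin n → V :=
  Classical.epsilon (IsOrthonormalFrame g)

/-- Inner product of `k`-forms, `⟨a, b⟩ = (1 / k!) ∑ a (e_{i₁}, …, e_{i_k}) b (e_{i₁}, …, e_{i_k})`,
on an inner product space of dimension `n`. -/
def formInner (n : ℕ) {k : ℕ} (g : V → V → ℝ) (a b : (Fin k → V) → ℝ) : ℝ :=
  (Nat.factorial k : ℝ)⁻¹ *
    ∑ i : Fin k → Fin n, a (fun s => onFrame n g (i s)) * b (fun s => onFrame n g (i s))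

/-- Interior product `x ⌟ a`. -/
def interior {k : ℕ} (x : V) (a : (Fin (k + 1) → V) → ℝ) : (Fin k → V) → ℝ :=
  fun v => a (Fin.cons x v)

/-- Wedge product of alternating forms, normalised by
`(α ∧ β) (x, y) = α x * β y - α y * β x` for one-forms. -/
def wedge {p q : ℕ} (a : (Fin p → V) → ℝ) (b : (Fin q → V) → ℝ) : (Fin (p + q) → V) → ℝ :=
  fun v => ((Nat.factorial p : ℝ) * (Nat.factorial q : ℝ))⁻¹ *
    ∑ σ : Equiv.Perm (Fin (p + q)), ((Equiv.Perm.sign σ : ℤ) : ℝ) *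
      (a (fun i => v (σ (Fin.castAdd q i))) * b (fun j => v (σ (Fin.natAdd p j))))

/-- The volume form `e_0 ∧ … ∧ e_{n-1}` of an orthonormal basis `e`. -/
def volForm {n : ℕ} (g : V → V → ℝ) (e : Fin n → V) : (Fin n → V) → ℝ :=
  fun v => Matrix.det (Matrix.of fun i j => g (e i) (v j))

open scoped Classical in
/-- Hodge star of a `k`-form for the orientation given by the orthonormal basis `e`, determined by
`α ∧ *β = ⟨α, β⟩ Vol`; the sum is over strictly increasing multi-indices. -/
def hodge {n k m : ℕ} (g : V → V → ℝ) (e : Fin n → V) (h : k + m = n)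
    (b : (Fin k → V) → ℝ) : (Fin m → V) → ℝ :=
  fun v => ∑ i : Fin k → Fin n with StrictMono i,
    b (fun s => e (i s)) *
      volForm g e (fun j => Fin.append (fun s => e (i s)) v (Fin.cast h.symm j))

/-- `e` is a Cayley frame for `(g, φ)`: it is orthonormal and
`φ = ∑_{i ∈ ℤ/7} e_i ∧ e_{i+1} ∧ e_{i+3}`. -/
def IsCayleyFrame (g : V → V → ℝ) (φ : (Fin 3 → V) → ℝ) (e : Fin 7 → V) : Prop :=
  IsOrthonormalFrame g e ∧
    ∀ v : Fin 3 → V, φ v = ∑ i : Fin 7,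
      Matrix.det (Matrix.of fun a b : Fin 3 => g (e ((![i, i + 1, i + 3] : Fin 3 → Fin 7) a)) (v b))

/-- A chosen Cayley frame; any two are related by an element of `G₂ ⊂ SO(7)`, and the expressions
below that use it are independent of the choice. -/
def cayleyFrame (g : V → V → ℝ) (φ : (Fin 3 → V) → ℝ) : Fin 7 → V :=
  Classical.epsilon (IsCayleyFrame g φ)

/-- The two-fold vector cross product, `⟨P (x, y), z⟩ = φ (x, y, z)`. -/
def cross (g : V → V → ℝ) (φ : (Fin 3 → V) → ℝ) (x y : V) : V :=
  ∑ k : Fin 7, φ ![x, y, cayleyFrame g φ k] • cayleyFrame g φ k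

/-- The four-form `*φ`, for the volume form with `φ ∧ *φ = 7 Vol`. -/
def starPhi (g : V → V → ℝ) (φ : (Fin 3 → V) → ℝ) : (Fin 4 → V) → ℝ :=
  hodge g (cayleyFrame g φ) (by norm_num : 3 + 4 = 7) φ

/-- The one-form `*(*δ ∧ φ)` attached to a four-form `δ`. -/
def starStarWedge (g : V → V → ℝ) (φ : (Fin 3 → V) → ℝ) (δ : (Fin 4 → V) → ℝ) (x : V) : ℝ :=
  hodge g (cayleyFrame g φ) (by norm_num : (3 + 3) + 1 = 7)
    (wedge (hodge g (cayleyFrame g φ) (by norm_num : 4 + 3 = 7) δ) φ) (fun _ : Fin 1 => x)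

/-- The map `r (α) (x, y) = ½ ⟨x ⌟ α, y ⌟ ψ₊⟩` on a six-dimensional space. -/
def rMap (g : V → V → ℝ) (ψ : (Fin 3 → V) → ℝ) (α : V →ₗ[ℝ] V →ₗ[ℝ] V →ₗ[ℝ] ℝ) (x y : V) : ℝ :=
  (1 / 2) * formInner 6 g (fun v : Fin 2 → V => α x (v 0) (v 1)) (interior y ψ)

lemma rMap_add (g : V → V → ℝ) (ψ : (Fin 3 → V) → ℝ) (α β : V →ₗ[ℝ] V →ₗ[ℝ] V →ₗ[ℝ] ℝ) (x y : V) :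
    rMap g ψ (α + β) x y = rMap g ψ α x y + rMap g ψ β x y := by
  simp only [rMap, formInner, LinearMap.add_apply, add_mul, Finset.sum_add_distrib]
  ring

lemma rMap_smul (g : V → V → ℝ) (ψ : (Fin 3 → V) → ℝ) (c : ℝ)
    (α : V →ₗ[ℝ] V →ₗ[ℝ] V →ₗ[ℝ] ℝ) (x y : V) :
    rMap g ψ (c • α) x y = c * rMap g ψ α x y := by
  simp only [rMap, formInner, LinearMap.smul_apply, smul_eq_mul, mul_assoc, ← Finset.mul_sum]
  ring

lemma rMap_zero (g : V → V → ℝ) (ψ : (Fin 3 → V) → ℝ) (x y : V) :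
    rMap g ψ 0 x y = 0 := by
  simp [rMap, formInner]

/-- The space `T* ⊗ u(3)^⊥` of tensors with the algebraic symmetries of `∇ω`. -/
def hermTensors (J : V → V) : Submodule ℝ (V →ₗ[ℝ] V →ₗ[ℝ] V →ₗ[ℝ] ℝ) where
  carrier := {α | (∀ x y z, α x y z = -α x z y) ∧ ∀ x y z, α x (J y) (J z) = -α x y z}
  add_mem' := by
    rintro a b ⟨h1, h2⟩ ⟨k1, k2⟩
    refine ⟨fun x y z => ?_, fun x y z => ?_⟩
    · simp only [LinearMap.add_apply]; rw [h1 x y z, k1 x y z]; ring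
    · simp only [LinearMap.add_apply]; rw [h2 x y z, k2 x y z]; ring
  zero_mem' := by simp
  smul_mem' := by
    rintro c a ⟨h1, h2⟩
    refine ⟨fun x y z => ?_, fun x y z => ?_⟩
    · simp only [LinearMap.smul_apply, smul_eq_mul]; rw [h1 x y z]; ring
    · simp only [LinearMap.smul_apply, smul_eq_mul]; rw [h2 x y z]; ring

/-- The trace `z ↦ ∑ α (e_i, e_i, z)` over an orthonormal basis in dimension six. -/
def tr12 (g : V → V → ℝ) (α : V →ₗ[ℝ] V →ₗ[ℝ] V →ₗ[ℝ] ℝ) (z : V) : ℝ :=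
  ∑ i : Fin 6, α (onFrame 6 g i) (onFrame 6 g i) z

/-- Gray-Hervella module `W₁`: the totally skew tensors. -/
def W1 (J : V → V) : Submodule ℝ (V →ₗ[ℝ] V →ₗ[ℝ] V →ₗ[ℝ] ℝ) where
  carrier := {α | α ∈ hermTensors J ∧ ∀ x z, α x x z = 0}
  add_mem' := by
    rintro a b ⟨h1, h2⟩ ⟨k1, k2⟩
    exact ⟨add_mem h1 k1, fun x z => by simp [h2, k2]⟩
  zero_mem' := ⟨zero_mem _, by simp⟩
  smul_mem' := by
    rintro c a ⟨h1, h2⟩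
    exact ⟨Submodule.smul_mem _ c h1, fun x z => by simp [h2]⟩

/-- Gray-Hervella module `W₂`: vanishing cyclic sum. -/
def W2 (J : V → V) : Submodule ℝ (V →ₗ[ℝ] V →ₗ[ℝ] V →ₗ[ℝ] ℝ) where
  carrier := {α | α ∈ hermTensors J ∧ ∀ x y z, α x y z + α y z x + α z x y = 0}
  add_mem' := by
    rintro a b ⟨h1, h2⟩ ⟨k1, k2⟩
    refine ⟨add_mem h1 k1, fun x y z => ?_⟩
    simp only [LinearMap.add_apply]
    linear_combination h2 x y z + k2 x y z
  zero_mem' := ⟨zero_mem _, by simp⟩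
  smul_mem' := by
    rintro c a ⟨h1, h2⟩
    refine ⟨Submodule.smul_mem _ c h1, fun x y z => ?_⟩
    simp only [LinearMap.smul_apply, smul_eq_mul]
    linear_combination c * h2 x y z

/-- Gray-Hervella module `W₃`: `α (x, y, z) = α (Ix, Iy, z)` and zero trace. -/
def W3 (g : V → V → ℝ) (J : V → V) : Submodule ℝ (V →ₗ[ℝ] V →ₗ[ℝ] V →ₗ[ℝ] ℝ) where
  carrier := {α | α ∈ hermTensors J ∧ (∀ x y z, α x y z - α (J x) (J y) z = 0) ∧
    ∀ z, tr12 g α z = 0}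
  add_mem' := by
    rintro a b ⟨h1, h2, h3⟩ ⟨k1, k2, k3⟩
    refine ⟨add_mem h1 k1, fun x y z => ?_, fun z => ?_⟩
    · simp only [LinearMap.add_apply]
      linear_combination h2 x y z + k2 x y z
    · have hh := h3 z
      have kk := k3 z
      simp only [tr12] at hh kk ⊢
      simp only [LinearMap.add_apply, Finset.sum_add_distrib, hh, kk, add_zero]
  zero_mem' := ⟨zero_mem _, by simp, by simp [tr12]⟩
  smul_mem' := by
    rintro c a ⟨h1, h2, h3⟩
    refine ⟨Submodule.smul_mem _ c h1, fun x y z => ?_, fun z => ?_⟩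
    · simp only [LinearMap.smul_apply, smul_eq_mul]
      linear_combination c * h2 x y z
    · have hh := h3 z
      simp only [tr12] at hh ⊢
      simp only [LinearMap.smul_apply, smul_eq_mul, ← Finset.mul_sum, hh, mul_zero]

/-- Gray-Hervella module `W₄` in dimension `2n = 6`, where `1 / (2 (n - 1)) = 1 / 4`: tensors
determined by their trace `θ = tr12 α` as
`α (x, y, z) = ¼ (⟨x, y⟩ θ z - ⟨x, z⟩ θ y - ⟨x, Iy⟩ θ (I z) + ⟨x, Iz⟩ θ (I y))`. -/
def W4 (g : V → V → ℝ) (J : V → V) : Submodule ℝ (V →ₗ[ℝ] V →ₗ[ℝ] V →ₗ[ℝ] ℝ) where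
  carrier := {α | α ∈ hermTensors J ∧ ∀ x y z, α x y z =
    (1 / 4) * (g x y * tr12 g α z - g x z * tr12 g α y
      - g x (J y) * tr12 g α (J z) + g x (J z) * tr12 g α (J y))}
  add_mem' := by
    rintro a b ⟨h1, h2⟩ ⟨k1, k2⟩
    refine ⟨add_mem h1 k1, fun x y z => ?_⟩
    have ht : ∀ z, tr12 g (a + b) z = tr12 g a z + tr12 g b z := by
      intro z
      simp only [tr12, LinearMap.add_apply, Finset.sum_add_distrib]
    simp only [ht, LinearMap.add_apply]
    linear_combination h2 x y z + k2 x y z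
  zero_mem' := ⟨zero_mem _, by simp [tr12]⟩
  smul_mem' := by
    rintro c a ⟨h1, h2⟩
    refine ⟨Submodule.smul_mem _ c h1, fun x y z => ?_⟩
    have ht : ∀ z, tr12 g (c • a) z = c * tr12 g a z := by
      intro z
      simp only [tr12, LinearMap.smul_apply, smul_eq_mul, Finset.mul_sum]
    simp only [ht, LinearMap.smul_apply, smul_eq_mul]
    linear_combination c * h2 x y z

/-- The elements of a submodule whose image under `r` is symmetric (`s = 1`) or skew (`s = -1`). -/
def rPart (g : V → V → ℝ) (ψ : (Fin 3 → V) → ℝ)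
    (W : Submodule ℝ (V →ₗ[ℝ] V →ₗ[ℝ] V →ₗ[ℝ] ℝ)) (s : ℝ) :
    Submodule ℝ (V →ₗ[ℝ] V →ₗ[ℝ] V →ₗ[ℝ] ℝ) where
  carrier := {α | α ∈ W ∧ ∀ x y, rMap g ψ α x y = s * rMap g ψ α y x}
  add_mem' := by
    rintro a b ⟨h1, h2⟩ ⟨k1, k2⟩
    refine ⟨add_mem h1 k1, fun x y => ?_⟩
    rw [rMap_add, rMap_add]
    linear_combination h2 x y + k2 x y
  zero_mem' := ⟨zero_mem _, by simp [rMap_zero]⟩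
  smul_mem' := by
    rintro c a ⟨h1, h2⟩
    refine ⟨Submodule.smul_mem _ c h1, fun x y => ?_⟩
    rw [rMap_smul, rMap_smul]
    linear_combination c * h2 x y

end Algebra

/-- The labels of the irreducible `SU(3)`-summands of the intrinsic torsion. -/
inductive TorsionClass : Type
  | W1p | W1m | W2p | W2m | W3 | W4 | W5

/-- The summand of `T* ⊗ u(3)^⊥` with a given label. `W₅` is the summand of the one-form `η`, and
contributes nothing to `∇ω`. -/
def torsionModule {V : Type*} [AddCommGroup V] [Module ℝ V] (g : V → V → ℝ) (J : V → V)
    (ψ : (Fin 3 → V) → ℝ) : TorsionClass → Submodule ℝ (V →ₗ[ℝ] V →ₗ[ℝ] V →ₗ[ℝ] ℝ)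
  | .W1p => rPart g ψ (W1 J) 1
  | .W1m => rPart g ψ (W1 J) (-1)
  | .W2p => rPart g ψ (W2 J) 1
  | .W2m => rPart g ψ (W2 J) (-1)
  | .W3 => W3 g J
  | .W4 => W4 g J
  | .W5 => ⊥

/-! ### Tensor fields and the Levi-Civita connection, in the preferred chart at a point -/

section Charts

variable {n : ℕ} {X : Type*} [TopologicalSpace X] [ChartedSpace (EuclideanSpace ℝ (Fin n)) X]

/-- The differential at `x` of the preferred chart around `x₀`. -/
def toChart (x₀ x : X) : TangentSpace (𝓡 n) x →L[ℝ] EuclideanSpace ℝ (Fin n) :=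
  mfderiv (𝓡 n) 𝓘(ℝ, EuclideanSpace ℝ (Fin n)) (extChartAt (𝓡 n) x₀) x

/-- The differential at `y` of the inverse of the preferred chart around `x₀`. -/
def fromChart (x₀ : X) (y : EuclideanSpace ℝ (Fin n)) :
    EuclideanSpace ℝ (Fin n) →L[ℝ] TangentSpace (𝓡 n) ((extChartAt (𝓡 n) x₀).symm y) :=
  mfderiv 𝓘(ℝ, EuclideanSpace ℝ (Fin n)) (𝓡 n) (extChartAt (𝓡 n) x₀).symm y

/-- Coordinate expression of a metric in the chart around `x₀`. -/
def chartMetric (g : ∀ x : X, TangentSpace (𝓡 n) x → TangentSpace (𝓡 n) x → ℝ) (x₀ : X)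
    (y u v : EuclideanSpace ℝ (Fin n)) : ℝ :=
  g ((extChartAt (𝓡 n) x₀).symm y) (fromChart x₀ y u) (fromChart x₀ y v)

/-- Coordinate expression of a covariant `k`-tensor field in the chart around `x₀`. -/
def chartTensor {k : ℕ} (α : ∀ x : X, (Fin k → TangentSpace (𝓡 n) x) → ℝ) (x₀ : X)
    (y : EuclideanSpace ℝ (Fin n)) (v : Fin k → EuclideanSpace ℝ (Fin n)) : ℝ :=
  α ((extChartAt (𝓡 n) x₀).symm y) (fun i => fromChart x₀ y (v i))

/-- Coordinate expression of a differential `k`-form in the chart around `x₀`. -/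
def chartForm {k : ℕ} (α : ∀ x : X, TangentSpace (𝓡 n) x [⋀^Fin k]→L[ℝ] ℝ) (x₀ : X)
    (y : EuclideanSpace ℝ (Fin n)) : EuclideanSpace ℝ (Fin n) [⋀^Fin k]→L[ℝ] ℝ :=
  (α ((extChartAt (𝓡 n) x₀).symm y)).compContinuousLinearMap (fromChart x₀ y)

/-- Exterior derivative of a differential form, at `x`. -/
def extD {k : ℕ} (α : ∀ x : X, TangentSpace (𝓡 n) x [⋀^Fin k]→L[ℝ] ℝ) (x : X) :
    TangentSpace (𝓡 n) x [⋀^Fin (k + 1)]→L[ℝ] ℝ :=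
  (extDeriv (chartForm α x) (extChartAt (𝓡 n) x x)).compContinuousLinearMap (toChart x x)

/-- The Christoffel symbol `Γ (u, v)` of a metric `G` on an open subset of `ℝⁿ`, from
`2 G (Γ (u, v), w) = ∂_u G (v, w) + ∂_v G (u, w) - ∂_w G (u, v)`. -/
def christoffel
    (G : EuclideanSpace ℝ (Fin n) → EuclideanSpace ℝ (Fin n) → EuclideanSpace ℝ (Fin n) → ℝ)
    (y u v : EuclideanSpace ℝ (Fin n)) : EuclideanSpace ℝ (Fin n) :=
  ∑ k : Fin n,
    ((1 / 2) * (fderiv ℝ (fun z => G z v (onFrame n (G y) k)) y u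
      + fderiv ℝ (fun z => G z u (onFrame n (G y) k)) y v
      - fderiv ℝ (fun z => G z u v) y (onFrame n (G y) k))) • onFrame n (G y) k

/-- `(∇_u α) (v₁, …, v_k)` at the point `x`, where `∇` is the Levi-Civita connection of `g`. -/
def nabla {k : ℕ} (g : ∀ x : X, TangentSpace (𝓡 n) x → TangentSpace (𝓡 n) x → ℝ)
    (α : ∀ x : X, (Fin k → TangentSpace (𝓡 n) x) → ℝ) (x : X)
    (u : TangentSpace (𝓡 n) x) (v : Fin k → TangentSpace (𝓡 n) x) : ℝ :=
  fderiv ℝ (fun z => chartTensor α x z (fun i => toChart x x (v i))) (extChartAt (𝓡 n) x x)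
      (toChart x x u)
    - ∑ i : Fin k, chartTensor α x (extChartAt (𝓡 n) x x)
        (Function.update (fun j => toChart x x (v j)) i
          (christoffel (chartMetric g x) (extChartAt (𝓡 n) x x) (toChart x x u)
            (toChart x x (v i))))

end Charts

/-! ### `SU(3)`-structures on six-manifolds -/

section SU3

/-- The tensors of a special almost Hermitian six-manifold: metric, almost complex structure, and
real and imaginary part of the complex volume form. (Only used below for the structure induced on
a hypersurface of a manifold with a `G₂`-structure.) -/
structure SU3Tensors (M : Type*) [TopologicalSpace M]
    [ChartedSpace (EuclideanSpace ℝ (Fin 6)) M] where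
  g : ∀ p : M, TangentSpace (𝓡 6) p → TangentSpace (𝓡 6) p → ℝ
  J : ∀ p : M, TangentSpace (𝓡 6) p → TangentSpace (𝓡 6) p
  psiP : ∀ p : M, (Fin 3 → TangentSpace (𝓡 6) p) → ℝ
  psiM : ∀ p : M, (Fin 3 → TangentSpace (𝓡 6) p) → ℝ

variable {M : Type*} [TopologicalSpace M] [ChartedSpace (EuclideanSpace ℝ (Fin 6)) M]

/-- The Kähler form `ω (x, y) = ⟨x, Iy⟩`. -/
def SU3Tensors.omega (S : SU3Tensors M) (p : M) (v : Fin 2 → TangentSpace (𝓡 6) p) : ℝ :=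
  S.g p (v 0) (S.J p (v 1))

/-- `(∇_x ω) (y, z)`. -/
def SU3Tensors.nablaOmega (S : SU3Tensors M) (p : M) (x y z : TangentSpace (𝓡 6) p) : ℝ :=
  nabla S.g S.omega p x ![y, z]

/-- The action of `I` on one-forms, `(I μ) x = -μ (I x)`. -/
def SU3Tensors.actJ (S : SU3Tensors M) (p : M) (μ : TangentSpace (𝓡 6) p → ℝ)
    (x : TangentSpace (𝓡 6) p) : ℝ :=
  -μ (S.J p x)

/-- The coderivative `(d*ω) (x) = -∑ (∇_{e_i} ω) (e_i, x)`. -/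
def SU3Tensors.codiffOmega (S : SU3Tensors M) (p : M) (x : TangentSpace (𝓡 6) p) : ℝ :=
  -∑ i : Fin 6, S.nablaOmega p (onFrame 6 (S.g p) i) (onFrame 6 (S.g p) i) x

/-- The one-form `η`, the `W₅`-part of the intrinsic torsion. Under `∇ψ₊ = -ηψ₊ - ξψ₊` the tensor
`-ξψ₊` lies in `T* ⊗ (T* ∧ ω)`, and `-ηψ₊ = -3 Iη ⊗ ψ₋` is the component of `∇ψ₊` in `T* ⊗ ℝψ₋`.
As `⟨ψ₋, ψ₋⟩ = 4` this reads `⟨∇_x ψ₊, ψ₋⟩ = -12 (Iη) (x)`, and `η (x) = (Iη) (Ix)`. -/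
def SU3Tensors.eta (S : SU3Tensors M) (p : M) (x : TangentSpace (𝓡 6) p) : ℝ :=
  -(1 / 12) * formInner 6 (S.g p) (nabla S.g S.psiP p (S.J p x)) (S.psiM p)

/-- The structure is of type `∑_{i ∈ A} W_i`: at every point the intrinsic torsion, i.e. the pair
`(∇ω, η)`, lies in the sum of the summands with labels in `A`. -/
def SU3Tensors.IsOfType (S : SU3Tensors M) (A : Set TorsionClass) : Prop :=
  ∀ p : M,
    (∃ α ∈ ⨆ i ∈ A, torsionModule (S.g p) (S.J p) (S.psiP p) i,
      ∀ x y z, S.nablaOmega p x y z = α x y z) ∧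
    (TorsionClass.W5 ∉ A → ∀ x, S.eta p x = 0)

end SU3

/-! ### `G₂`-structures on seven-manifolds -/

section G2

/-- A smooth Riemannian seven-manifold with a `G₂`-structure, given by its fundamental three-form:
at each point there is a Cayley frame. -/
structure G2Structure (N : Type*) [TopologicalSpace N]
    [ChartedSpace (EuclideanSpace ℝ (Fin 7)) N] [IsManifold (𝓡 7) ∞ N] where
  metric : Bundle.ContMDiffRiemannianMetric (𝓡 7) ∞ (EuclideanSpace ℝ (Fin 7))
    (fun x : N => TangentSpace (𝓡 7) x)
  form : ∀ x : N, TangentSpace (𝓡 7) x [⋀^Fin 3]→L[ℝ] ℝ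
  smooth : ∀ x₀ : N, ContDiffOn ℝ ∞ (chartForm form x₀) (extChartAt (𝓡 7) x₀).target
  cayley : ∀ x : N, ∃ e : Fin 7 → TangentSpace (𝓡 7) x,
    IsCayleyFrame (fun u v => metric.inner x u v) (form x) e

variable {N : Type*} [TopologicalSpace N] [ChartedSpace (EuclideanSpace ℝ (Fin 7)) N]
  [IsManifold (𝓡 7) ∞ N]

/-- The Riemannian metric of `N`. -/
def G2Structure.g (G : G2Structure N) (x : N) (u v : TangentSpace (𝓡 7) x) : ℝ :=
  G.metric.inner x u v

/-- The fundamental three-form `φ`. -/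
def G2Structure.phi (G : G2Structure N) (x : N) (v : Fin 3 → TangentSpace (𝓡 7) x) : ℝ :=
  G.form x v

/-- The four-form `*φ`. -/
def G2Structure.star (G : G2Structure N) (x : N) : (Fin 4 → TangentSpace (𝓡 7) x) → ℝ :=
  starPhi (G.g x) (G.phi x)

/-- The one-form `pd*φ = *(*dφ ∧ φ)`. -/
def G2Structure.pdStar (G : G2Structure N) (x : N) (u : TangentSpace (𝓡 7) x) : ℝ :=
  starStarWedge (G.g x) (G.phi x) (fun v => extD G.form x v) u

/-- The vector field `p_φ` with `⟨p_φ, ·⟩ = pd*φ`. -/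
def G2Structure.pVec (G : G2Structure N) (x : N) : TangentSpace (𝓡 7) x :=
  ∑ k : Fin 7, G.pdStar x (cayleyFrame (G.g x) (G.phi x) k) • cayleyFrame (G.g x) (G.phi x) k

/-- The `G₂`-structure is of type `𝒳₄` (locally conformally parallel). The covariant derivatives of
`φ` are the tensors `∑ a_{ij} e_i ⊗ (e_j ⌟ *φ)`, for a Cayley frame `e`, and the irreducible
summand `𝒳₄` consists of those with `a` in `g₂^⊥ = {x ⌟ φ}`. -/
def G2Structure.IsTypeX4 (G : G2Structure N) : Prop :=
  ∀ m : N, ∃ x : TangentSpace (𝓡 7) m, ∀ (w : TangentSpace (𝓡 7) m)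
    (v : Fin 3 → TangentSpace (𝓡 7) m),
    nabla G.g G.phi m w v = ∑ j : Fin 7,
      G.phi m ![x, w, cayleyFrame (G.g m) (G.phi m) j] *
        interior (cayleyFrame (G.g m) (G.phi m) j) (G.star m) v

/-- An oriented (immersed) hypersurface `ι : M → N` with unit normal vector field `n`. -/
structure OrientedHypersurface (G : G2Structure N) (M : Type*) [TopologicalSpace M]
    [ChartedSpace (EuclideanSpace ℝ (Fin 6)) M] [IsManifold (𝓡 6) ∞ M] where
  incl : M → N
  smooth : ContMDiff (𝓡 6) (𝓡 7) ∞ incl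
  immersion : ∀ p, Function.Injective (mfderiv (𝓡 6) (𝓡 7) incl p)
  normal : ∀ p : M, TangentSpace (𝓡 7) (incl p)
  normal_smooth : ContMDiff (𝓡 6) (𝓡 7).tangent ∞
    (fun p => (⟨incl p, normal p⟩ : TangentBundle (𝓡 7) N))
  normal_unit : ∀ p, G.g (incl p) (normal p) (normal p) = 1
  normal_orth : ∀ p x, G.g (incl p) (normal p) (mfderiv (𝓡 6) (𝓡 7) incl p x) = 0

namespace OrientedHypersurface

variable {G : G2Structure N} {M : Type*} [TopologicalSpace M]
  [ChartedSpace (EuclideanSpace ℝ (Fin 6)) M] [IsManifold (𝓡 6) ∞ M]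

/-- The differential `ι_*`. -/
def push (H : OrientedHypersurface G M) (p : M) (x : TangentSpace (𝓡 6) p) :
    TangentSpace (𝓡 7) (H.incl p) :=
  mfderiv (𝓡 6) (𝓡 7) H.incl p x

/-- The induced metric `ι^*⟨·,·⟩`. -/
def gM (H : OrientedHypersurface G M) (p : M) (x y : TangentSpace (𝓡 6) p) : ℝ :=
  G.g (H.incl p) (H.push p x) (H.push p y)

/-- The induced `SU(3)`-structure: the induced metric, `I` with `ι_* (I x) = P (n, ι_* x)`, and
`Ψ = cos θ ι^*φ - sin θ ι^*(n ⌟ *φ) + i (sin θ ι^*φ + cos θ ι^*(n ⌟ *φ))`. -/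
def induced (H : OrientedHypersurface G M) (θ : M → ℝ) : SU3Tensors M where
  g := H.gM
  J := fun p x => Function.invFun (H.push p)
    (cross (G.g (H.incl p)) (G.phi (H.incl p)) (H.normal p) (H.push p x))
  psiP := fun p v =>
    Real.cos (θ p) * G.phi (H.incl p) (fun i => H.push p (v i))
      - Real.sin (θ p) * interior (H.normal p) (G.star (H.incl p)) (fun i => H.push p (v i))
  psiM := fun p v =>
    Real.sin (θ p) * G.phi (H.incl p) (fun i => H.push p (v i))
      + Real.cos (θ p) * interior (H.normal p) (G.star (H.incl p)) (fun i => H.push p (v i))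

/-- The inclusion in the preferred charts around `p` and `ι p`. -/
def chartIncl (H : OrientedHypersurface G M) (p : M) :
    EuclideanSpace ℝ (Fin 6) → EuclideanSpace ℝ (Fin 7) :=
  fun y => extChartAt (𝓡 7) (H.incl p) (H.incl ((extChartAt (𝓡 6) p).symm y))

/-- The second fundamental form `B (x, y) = ⟨II (x, y), n⟩ = ⟨∇̄_x ι_*Y, n⟩`, where `∇̄` is the
Levi-Civita connection of the ambient manifold and `Y` extends `y` with constant coefficients in
the chart around `p`, so that in coordinates `∇̄_x ι_*Y = ∂_x ∂_y ι + Γ̄ (ι_*x, ι_*y)`. -/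
def secondFund (H : OrientedHypersurface G M) (p : M) (x y : TangentSpace (𝓡 6) p) : ℝ :=
  chartMetric G.g (H.incl p) (extChartAt (𝓡 7) (H.incl p) (H.incl p))
    (fderiv ℝ (fun z => fderiv ℝ (H.chartIncl p) z (toChart p p y)) (extChartAt (𝓡 6) p p)
        (toChart p p x)
      + christoffel (chartMetric G.g (H.incl p)) (extChartAt (𝓡 7) (H.incl p) (H.incl p))
          (toChart (H.incl p) (H.incl p) (H.push p x))
          (toChart (H.incl p) (H.incl p) (H.push p y)))
    (toChart (H.incl p) (H.incl p) (H.normal p))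

/-- `h = ⟨H, n⟩` for the mean curvature vector `H = (1/6) tr II`. -/
def meanCurv (H : OrientedHypersurface G M) (p : M) : ℝ :=
  (1 / 6) * ∑ i : Fin 6, H.secondFund p (onFrame 6 (H.gM p) i) (onFrame 6 (H.gM p) i)

/-- Totally umbilic: `II (x, y) = ⟨x, y⟩ H`. -/
def IsTotallyUmbilic (H : OrientedHypersurface G M) : Prop :=
  ∀ p x y, H.secondFund p x y = H.meanCurv p * H.gM p x y

end OrientedHypersurface

end G2

end G2Hyp

end

/-! The theorem is linear algebra at a point, fed by one covariant differentiation.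

Ambient side. Type `𝒳₄` says that at each point some vector `l` satisfies `∇̄_a φ = (l × a) ⌟ *φ`,
and `starL_cross` rewrites this as `a ∧ (l ⌟ φ) - l ∧ (a ⌟ φ)`. Skew-symmetrising gives `dφ = 3 l ∧
φ`, and two Hodge stars turn that into `pd*φ = -12 ⟨l, ·⟩` (`pdStar_eq`). Hence `p_φ = -12 l`, and
every condition on `p_φ` is one on `l`.

Hypersurface side. Since `ω (y, z) = -φ (n, y, z)`, the Gauss and Weingarten formulas give `(∇_x ω)
(y, z) = -(∇̄_x φ) (n, y, z) + φ (Ax, y, z)` with `A` the shape operator. Inserting the form of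
`∇̄φ` shows that `∇ω` is the contraction of `B + ⟨l, n⟩ g` with `ι^*φ`, plus the `W₄` tensor with
trace `τ = 4 φ (l, n, ·)` (`cov_chartKahler`, `nablaOmega_eq`). Because `d*ω = -τ` and `τ (Ix) = -4
⟨l, x⟩`, this yields `3 I d*ω = ι^* pd*φ`. In `⟨∇_u ψ₊, ψ₋⟩` only the normal component of `l × u`
and `dθ (u)` survive (`formInner_deriv`, `eta_eq`), which yields the second equality.

Types. Contraction with `ρ = ι^*φ` identifies `T* ⊗ u(3)^⊥` with bilinear forms (`rForm_ofForm`,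
`ofForm_rForm`). Under it `W₁` becomes the span of `g` and `g (·, J ·)`, `W₂` the `J`-invariant
forms orthogonal to both, `W₃` the symmetric and `W₄` the skew anti-invariant forms. Using `ψ₊`
instead of `ρ` composes the second argument with `cos θ + sin θ J` (`twist`), which preserves these
four spaces but mixes the halves with signs. So a tensor lies in a sum of modules exactly when its
other components vanish (`mem_iSup_iff`).

The components of `∇ω` are then read off (`part_torsion`): `cos θ` and `sin θ` times `h + ⟨l, n⟩`
for `W₁^±`; `cos θ` and `sin θ` times `½ (1 + I) B - h g` for `W₂^±`, up to moving `J`; a rotation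
of `½ (B - IB)` for `W₃`; and the part of `τ` for `W₄`. Both signs are absent at once only if the
angle drops out, by `cos² + sin² = 1`. -/

noncomputable section

namespace G2Hyp

/-! ### Hodge stars and wedge products as sums over all multi-indices. -/

section HodgeSums

open Finset

/-- A permutation-invariant sum over all multi-indices reduces to increasing multi-indices. -/
lemma sum_eq_factorial_mul_sum_strictMono {k n : ℕ} (f : (Fin k → Fin n) → ℝ)
    (h0 : ∀ i, ¬ Function.Injective i → f i = 0)
    (hσ : ∀ i (σ : Equiv.Perm (Fin k)), f (i ∘ σ) = f i)
    [DecidablePred fun i : Fin k → Fin n => StrictMono i] :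
    ∑ i, f i = (Nat.factorial k : ℝ) * ∑ i : Fin k → Fin n with StrictMono i, f i := by
  classical
  have h1 : ∑ i, f i = ∑ i : Fin k → Fin n with Function.Injective i, f i := by
    rw [Finset.sum_filter]
    refine Finset.sum_congr rfl fun i _ => ?_
    split_ifs with h
    · rfl
    · exact h0 i h
  have h2 : ∑ p ∈ (univ.filter fun i : Fin k → Fin n => StrictMono i) ×ˢ
      (univ : Finset (Equiv.Perm (Fin k))), f p.1 =
      ∑ i : Fin k → Fin n with Function.Injective i, f i := by
    refine Finset.sum_nbij (fun p => p.1 ∘ p.2) ?_ ?_ ?_ ?_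
    · rintro ⟨j, σ⟩ hp
      simp only [mem_product, mem_filter, mem_univ, true_and, and_true] at hp ⊢
      exact hp.injective.comp σ.injective
    · rintro ⟨j, σ⟩ hp ⟨j', σ'⟩ hp' heq
      simp only [coe_product, coe_filter, mem_univ, true_and, coe_univ, Set.mem_prod,
        Set.mem_ofPred_eq, Set.mem_univ, and_true] at hp hp'
      simp only at heq
      have hr : Set.range j = Set.range j' := by
        rw [← σ.surjective.range_comp j, heq, σ'.surjective.range_comp j']
      have hj : j = j' := (hp.range_inj hp').1 hr
      subst hj
      have : σ = σ' := by
        ext x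
        exact congrArg Fin.val (hp.injective (congrFun heq x))
      rw [this]
    · intro i hi
      simp only [coe_filter, mem_univ, true_and, Set.mem_ofPred_eq] at hi
      refine ⟨(i ∘ Tuple.sort i, (Tuple.sort i)⁻¹), ?_, ?_⟩
      · simp only [coe_product, coe_filter, mem_univ, true_and, coe_univ, Set.mem_prod,
          Set.mem_ofPred_eq, Set.mem_univ, and_true]
        exact (Tuple.monotone_sort i).strictMono_of_injective
          (hi.comp (Tuple.sort i).injective)
      · ext x
        simp
    · rintro ⟨j, σ⟩ _
      exact (hσ j σ).symm
  rw [h1, ← h2, Finset.sum_product]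
  simp only [sum_const, card_univ, Fintype.card_perm, Fintype.card_fin, nsmul_eq_mul]
  rw [Finset.mul_sum]

variable {V : Type*} [AddCommGroup V] [Module ℝ V]

/-- The volume form as an alternating map. -/
def volAlt {n : ℕ} (g : V →ₗ[ℝ] V →ₗ[ℝ] ℝ) (e : Fin n → V) : V [⋀^Fin n]→ₗ[ℝ] ℝ :=
  (Matrix.detRowAlternating (R := ℝ) (n := Fin n)).compLinearMap (LinearMap.pi fun i => g (e i))

lemma volForm_eq {n : ℕ} (g : V →ₗ[ℝ] V →ₗ[ℝ] ℝ) (e v : Fin n → V) :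
    volForm (fun x y => g x y) e v = volAlt g e v := by
  rw [volForm, ← Matrix.det_transpose]
  rfl

lemma append_comp_perm {k m : ℕ} {α : Type*} (a : Fin k → α) (v : Fin m → α)
    (σ : Equiv.Perm (Fin k)) :
    Fin.append (a ∘ σ) v =
      Fin.append a v ∘ (finSumFinEquiv.permCongr (Equiv.Perm.sumCongr σ (1 : Equiv.Perm (Fin m)))) := by
  funext x
  refine Fin.addCases (fun i => ?_) (fun i => ?_) x <;>
  simp [Equiv.permCongr_apply]

/-- Permuting the first block is a block permutation of all `n` slots, with the sign of `σ`. -/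
lemma volAlt_append_perm {n k m : ℕ} (h : k + m = n) (w : V [⋀^Fin n]→ₗ[ℝ] ℝ)
    (a : Fin k → V) (v : Fin m → V) (σ : Equiv.Perm (Fin k)) :
    w (fun j => Fin.append (a ∘ σ) v (Fin.cast h.symm j)) =
      ((Equiv.Perm.sign σ : ℤ) : ℝ) * w (fun j => Fin.append a v (Fin.cast h.symm j)) := by
  subst h
  simp only [Fin.cast_eq_self]
  rw [append_comp_perm]
  have := w.map_perm (Fin.append a v)
    (finSumFinEquiv.permCongr (Equiv.Perm.sumCongr σ (1 : Equiv.Perm (Fin m))))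
  simp only [Equiv.Perm.sign_permCongr, Equiv.Perm.sign_sumCongr, map_one, mul_one] at this
  rw [show (fun j => (Fin.append a v ∘ _) j) = (Fin.append a v ∘ _) from rfl]
  rw [this, Units.smul_def, zsmul_eq_mul]

lemma sign_mul_self_real {k : ℕ} (σ : Equiv.Perm (Fin k)) :
    ((Equiv.Perm.sign σ : ℤ) : ℝ) * ((Equiv.Perm.sign σ : ℤ) : ℝ) = 1 := by
  rcases Int.units_eq_one_or (Equiv.Perm.sign σ) with h | h <;> simp [h]

/-- For an alternating form the Hodge star may be computed with a sum over all multi-indices. -/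
lemma hodge_eq_sum {n k m : ℕ} (g : V →ₗ[ℝ] V →ₗ[ℝ] ℝ) (e : Fin n → V) (h : k + m = n)
    (b : (Fin k → V) → ℝ)
    (hb : ∀ w (σ : Equiv.Perm (Fin k)), b (w ∘ σ) = ((Equiv.Perm.sign σ : ℤ) : ℝ) * b w)
    (v : Fin m → V) :
    hodge (fun x y => g x y) e h b v = (Nat.factorial k : ℝ)⁻¹ * ∑ i : Fin k → Fin n,
      b (e ∘ i) * volAlt g e (fun j => Fin.append (e ∘ i) v (Fin.cast h.symm j)) := by
  classical
  rw [sum_eq_factorial_mul_sum_strictMono, ← mul_assoc, inv_mul_cancel₀ (by positivity), one_mul,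
    hodge]
  · simp only [volForm_eq]
    refine Finset.sum_congr (by congr) fun i _ => rfl
  · intro i hi
    simp only [Function.Injective, not_forall] at hi
    obtain ⟨a, a', hab, hne⟩ := hi
    refine mul_eq_zero_of_right _ ?_
    subst h
    refine (volAlt g e).map_eq_zero_of_eq _ (i := Fin.castAdd m a) (j := Fin.castAdd m a') ?_ ?_
    · simp [hab]
    · simpa using hne
  · intro i σ
    rw [← Function.comp_assoc, hb, volAlt_append_perm h]
    linear_combination (b (e ∘ i) *
      volAlt g e (fun j => Fin.append (e ∘ i) v (Fin.cast h.symm j))) * sign_mul_self_real σ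

omit [AddCommGroup V] [Module ℝ V] in
lemma wedge_perm {p q : ℕ} (a : (Fin p → V) → ℝ) (b : (Fin q → V) → ℝ) (w : Fin (p + q) → V)
    (τ : Equiv.Perm (Fin (p + q))) :
    wedge a b (w ∘ τ) = ((Equiv.Perm.sign τ : ℤ) : ℝ) * wedge a b w := by
  simp only [wedge]
  rw [mul_left_comm]
  congr 1
  rw [Finset.mul_sum]
  refine Fintype.sum_equiv (Equiv.mulLeft τ) (M := ℝ) _ _ fun σ => ?_
  simp only [Equiv.coe_mulLeft, Equiv.Perm.sign_mul, Units.val_mul, Int.cast_mul,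
    Equiv.Perm.coe_mul, Function.comp_apply]
  linear_combination -(((Equiv.Perm.sign σ : ℤ) : ℝ) * (a (fun i => w (τ (σ (Fin.castAdd q i)))) *
    b (fun j => w (τ (σ (Fin.natAdd p j)))))) * sign_mul_self_real τ

/-- After reindexing, every permutation in the wedge contributes the same sum, because its sign is
cancelled by the sign from the volume form. The `(p + q)!` equal terms give the factor, so the wedge
never has to be expanded. -/
lemma sum_wedge_mul_vol {n p q m : ℕ} (a : (Fin p → V) → ℝ) (b : (Fin q → V) → ℝ)
    (e : Fin n → V) (w : V [⋀^Fin n]→ₗ[ℝ] ℝ) (h : (p + q) + m = n) (v : Fin m → V) :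
    ∑ i : Fin (p + q) → Fin n, wedge a b (e ∘ i) *
        w (fun j => Fin.append (e ∘ i) v (Fin.cast h.symm j)) =
      ((Nat.factorial p : ℝ) * (Nat.factorial q : ℝ))⁻¹ * (Nat.factorial (p + q) : ℝ) *
        ∑ i : Fin (p + q) → Fin n, (a (fun s => e (i (Fin.castAdd q s))) *
          b (fun s => e (i (Fin.natAdd p s)))) *
          w (fun j => Fin.append (e ∘ i) v (Fin.cast h.symm j)) := by
  simp only [wedge, mul_assoc, ← Finset.mul_sum]
  congr 2
  simp only [Finset.sum_mul]
  rw [Finset.sum_comm]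
  have key : ∀ σ : Equiv.Perm (Fin (p + q)), ∑ i : Fin (p + q) → Fin n,
      ((Equiv.Perm.sign σ : ℤ) : ℝ) * (a (fun s => (e ∘ i) (σ (Fin.castAdd q s))) *
        b (fun s => (e ∘ i) (σ (Fin.natAdd p s)))) *
          w (fun j => Fin.append (e ∘ i) v (Fin.cast h.symm j)) =
      ∑ i : Fin (p + q) → Fin n, (a (fun s => e (i (Fin.castAdd q s))) *
          b (fun s => e (i (Fin.natAdd p s)))) *
          w (fun j => Fin.append (e ∘ i) v (Fin.cast h.symm j)) := by
    intro σ
    refine Fintype.sum_equiv (Equiv.arrowCongr σ.symm (Equiv.refl _)) _ _ fun i => ?_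
    have h1 : (Equiv.arrowCongr σ.symm (Equiv.refl (Fin n))) i = i ∘ σ := by
      funext x
      simp
    rw [h1, ← Function.comp_assoc, volAlt_append_perm h]
    simp only [Function.comp_apply]
    ring
  simp only [mul_assoc] at key
  simp only [mul_assoc, key]
  simp [Fintype.card_perm]

end HodgeSums

end G2Hyp
end

/-! ### Orthonormal bases of a bilinear form. -/

noncomputable section

namespace G2Hyp

section Frames

variable {V : Type*} [AddCommGroup V] [Module ℝ V]

/-- Pairing a vanishing combination with each `e i` kills its coefficients, so orthonormality alone
gives independence; the dimension count does the rest. -/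
lemma frame_expand {n : ℕ} [FiniteDimensional ℝ V] (hn : Module.finrank ℝ V = n)
    (g : V →ₗ[ℝ] V →ₗ[ℝ] ℝ) {e : Fin n → V} (he : IsOrthonormalFrame (fun x y => g x y) e) (v : V) :
    v = ∑ i, g (e i) v • e i := by
  have hli : LinearIndependent ℝ e := by
    rw [Fintype.linearIndependent_iff]
    intro c hc i
    have := congrArg (g (e i)) hc
    simpa [map_sum, he i] using this
  let b := basisOfLinearIndependentOfCardEqFinrank' e hli (by simp [hn])
  have hb : ∀ i, b i = e i := fun i => by simp [b]
  have h1 := b.sum_repr v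
  simp only [hb] at h1
  have h2 : ∀ i, g (e i) v = b.repr v i := by
    intro i
    conv_lhs => rw [← h1]
    simp [map_sum, he i]
  simp only [h2, h1]

/-- An orthonormal basis of a real vector space with a symmetric bilinear form. -/
structure IsONBasis {n : ℕ} (g : V →ₗ[ℝ] V →ₗ[ℝ] ℝ) (e : Fin n → V) : Prop where
  ortho : ∀ i j, g (e i) (e j) = if i = j then 1 else 0
  expand : ∀ v, v = ∑ i, g (e i) v • e i
  symm : ∀ x y, g x y = g y x

namespace IsONBasis

variable {n : ℕ} {g : V →ₗ[ℝ] V →ₗ[ℝ] ℝ} {e : Fin n → V}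

lemma of_frame [FiniteDimensional ℝ V] (hn : Module.finrank ℝ V = n)
    (hs : ∀ x y, g x y = g y x) (he : IsOrthonormalFrame (fun x y => g x y) e) : IsONBasis g e :=
  ⟨he, frame_expand hn g he, hs⟩

lemma apply_eq_sum (h : IsONBasis g e) (f : V →ₗ[ℝ] ℝ) (v : V) : f v = ∑ i, g (e i) v * f (e i) := by
  conv_lhs => rw [h.expand v]
  simp [map_sum]

lemma inner_eq_sum (h : IsONBasis g e) (x y : V) : g x y = ∑ i, g (e i) x * g (e i) y := by
  rw [h.apply_eq_sum (g x) y]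
  exact Finset.sum_congr rfl fun i _ => by rw [h.symm x, mul_comm]

lemma eq_of_inner (h : IsONBasis g e) {x y : V} (hxy : ∀ z, g x z = g y z) : x = y := by
  rw [h.expand x, h.expand y]
  exact Finset.sum_congr rfl fun i _ => by rw [h.symm, hxy, h.symm]

lemma self_nonneg (h : IsONBasis g e) (x : V) : 0 ≤ g x x := by
  rw [h.inner_eq_sum]
  exact Finset.sum_nonneg fun i _ => mul_self_nonneg _

lemma eq_zero_of_self (h : IsONBasis g e) {x : V} (hx : g x x = 0) : x = 0 := by
  rw [h.inner_eq_sum, Finset.sum_eq_zero_iff_of_nonneg fun i _ => mul_self_nonneg _] at hx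
  rw [h.expand x]
  exact Finset.sum_eq_zero fun i hi => by rw [mul_self_eq_zero.1 (hx i hi), zero_smul]

/-- The contraction of a bilinear map over an orthonormal basis does not depend on the basis. -/
lemma contract_eq (h : IsONBasis g e) {f : Fin n → V} (hf : IsONBasis g f)
    (β : V →ₗ[ℝ] V →ₗ[ℝ] ℝ) : ∑ i, β (e i) (e i) = ∑ i, β (f i) (f i) := by
  have h1 : ∀ i, β (e i) (e i) = ∑ j, ∑ k, g (f j) (e i) * (g (f k) (e i) * β (f j) (f k)) := by
    intro i
    rw [hf.apply_eq_sum (β (e i)) (e i), Finset.sum_comm]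
    refine Finset.sum_congr rfl fun k _ => ?_
    have := hf.apply_eq_sum (β.flip (f k)) (e i)
    simp only [LinearMap.flip_apply] at this
    rw [this, Finset.mul_sum]
    exact Finset.sum_congr rfl fun j _ => by ring
  simp only [h1]
  rw [Finset.sum_comm]
  refine Finset.sum_congr rfl fun j _ => ?_
  rw [Finset.sum_comm]
  have h2 : ∀ k, ∑ i, g (f j) (e i) * (g (f k) (e i) * β (f j) (f k)) =
      (if j = k then 1 else 0) * β (f j) (f k) := by
    intro k
    rw [← hf.ortho j k, h.inner_eq_sum (f j) (f k), Finset.sum_mul]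
    exact Finset.sum_congr rfl fun i _ => by rw [h.symm (e i), h.symm (e i)]; ring
  simp only [h2]
  simp

end IsONBasis

end Frames

/-! ### Integer tables of the model forms on the Fano plane. -/

/-- Values of the model three-form `∑ e_i ∧ e_{i+1} ∧ e_{i+3}`, by differences of indices. -/
def phiTbl : Fin 7 → Fin 7 → ℤ
  | 1, 3 => 1 | 2, 6 => 1 | 4, 5 => 1
  | 3, 1 => -1 | 6, 2 => -1 | 5, 4 => -1
  | _, _ => 0

/-- Components of the model three-form in a Cayley frame. -/
def phiZ (a b c : Fin 7) : ℤ := phiTbl (b - a) (c - a)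

/-- Components of the Hodge dual of the model three-form in a Cayley frame. -/
def starZ (a b c d : Fin 7) : ℤ :=
  (if a = c ∧ b = d then 1 else 0) - (if a = d ∧ b = c then 1 else 0) -
    ∑ k, phiZ a b k * phiZ c d k

/-- The seven oriented lines of the Fano plane, as increasing triples. -/
def line : Fin 7 → Fin 3 → Fin 7 :=
  ![![0, 1, 3], ![1, 2, 4], ![2, 3, 5], ![3, 4, 6], ![0, 4, 5], ![1, 5, 6], ![0, 2, 6]]

/-- The sign of a self-map of `Fin n`, by counting inversions (correct for bijections). -/
def sgnZ {n : ℕ} (f : Fin n → Fin n) : ℤ :=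
  ∏ i, ∏ j ∈ Finset.Ioi i, if f i < f j then 1 else -1

section Tables

set_option maxRecDepth 100000

lemma phiZ_swap12 : ∀ a b c, phiZ a b c = -phiZ b a c := by decide +kernel
lemma phiZ_of_strictMono : ∀ i : Fin 3 → Fin 7, StrictMono i →
    (∃ l, i = line l) ∨ phiZ (i 0) (i 1) (i 2) = 0 := by decide +kernel
lemma phiZ_line : ∀ l, phiZ (line l 0) (line l 1) (line l 2) = 1 := by decide +kernel
lemma line_strictMono : ∀ l, StrictMono (line l) := by decide +kernel
lemma line_injective : Function.Injective line := by decide +kernel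

/-- This matches the cross-product formula for `*φ` with the Hodge star: a quadruple pairs with the
lines disjoint from it. Only sorted quadruples are compared, to keep the finite check small. -/
lemma starZ_sorted : ∀ a b c d, a < b → b < c → c < d → starZ a b c d =
    ∑ l : Fin 7, if Function.Injective ![line l 0, line l 1, line l 2, a, b, c, d] then
      sgnZ ![line l 0, line l 1, line l 2, a, b, c, d] else 0 := by decide +kernel

/-- One index is fixed at `0`; invariance of the tables under translation in `ℤ/7` covers the
others. -/
lemma sum_starZ_mul_starZ_zero : ∀ b, ∑ i, ∑ j, ∑ k, starZ 0 i j k * starZ b i j k =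
    if 0 = b then 24 else 0 := by decide +kernel

/-- The guard spares the evaluation of `starZ` wherever the other factor is zero; for each `a` at
most one `k` survives. -/
lemma sum_phiZ_mul_starZ_zero : ∀ a b c d,
    ∑ k, (if phiZ 0 a k = 0 then 0 else phiZ 0 a k * starZ k b c d) =
      (if a = b then 1 else 0) * phiZ 0 c d - (if a = c then 1 else 0) * phiZ 0 b d
      + (if a = d then 1 else 0) * phiZ 0 b c - (if 0 = b then 1 else 0) * phiZ a c d
      + (if 0 = c then 1 else 0) * phiZ a b d - (if 0 = d then 1 else 0) * phiZ a b c := by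
  decide +kernel

lemma starZ_swap23 : ∀ a b c d, starZ a b c d = -starZ a c b d := by decide +kernel

end Tables

lemma phiZ_add (a b c s : Fin 7) : phiZ (a + s) (b + s) (c + s) = phiZ a b c := by
  simp only [phiZ, add_sub_add_right_eq_sub]

lemma starZ_add (a b c d s : Fin 7) : starZ (a + s) (b + s) (c + s) (d + s) = starZ a b c d := by
  simp only [starZ, add_left_inj]
  congr 1
  symm
  refine Fintype.sum_equiv (Equiv.addRight s) _ _ fun k => ?_
  simp [phiZ_add]

lemma starZ_swap12 (a b c d : Fin 7) : starZ a b c d = -starZ b a c d := by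
  simp only [starZ, phiZ_swap12 a b, neg_mul, Finset.sum_neg_distrib, and_comm (a := a = d),
    and_comm (a := a = c)]
  ring

lemma starZ_swap34 (a b c d : Fin 7) : starZ a b c d = -starZ a b d c := by
  simp only [starZ, phiZ_swap12 c d, mul_neg, Finset.sum_neg_distrib]
  ring

lemma sum_starZ_mul_starZ (a b : Fin 7) : ∑ i, ∑ j, ∑ k, starZ a i j k * starZ b i j k =
    if a = b then 24 else 0 := by
  have h := sum_starZ_mul_starZ_zero (b - a)
  have e : (0 = b - a) ↔ a = b := by rw [eq_comm, sub_eq_zero, eq_comm]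
  simp only [e] at h
  rw [← h]
  symm
  refine Fintype.sum_equiv (Equiv.addRight a) _ _ fun i => ?_
  refine Fintype.sum_equiv (Equiv.addRight a) _ _ fun j => ?_
  refine Fintype.sum_equiv (Equiv.addRight a) _ _ fun k => ?_
  have h1 := starZ_add 0 i j k a
  have h2 := starZ_add (b - a) i j k a
  rw [zero_add] at h1
  rw [sub_add_cancel] at h2
  simp [h1, h2]

lemma sum_phiZ_mul_starZ (l a b c d : Fin 7) : ∑ k, phiZ l a k * starZ k b c d =
    (if a = b then 1 else 0) * phiZ l c d - (if a = c then 1 else 0) * phiZ l b d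
      + (if a = d then 1 else 0) * phiZ l b c - (if l = b then 1 else 0) * phiZ a c d
      + (if l = c then 1 else 0) * phiZ a b d - (if l = d then 1 else 0) * phiZ a b c := by
  have h := sum_phiZ_mul_starZ_zero (a - l) (b - l) (c - l) (d - l)
  have e : ∀ x, (0 = x - l) ↔ l = x := fun x => by rw [eq_comm, sub_eq_zero, eq_comm]
  have p0 : ∀ x y, phiZ 0 (x - l) (y - l) = phiZ l x y := fun x y => by
    simpa using (phiZ_add 0 (x - l) (y - l) l).symm
  have p1 : ∀ x y z, phiZ (x - l) (y - l) (z - l) = phiZ x y z := fun x y z => by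
    simpa using (phiZ_add (x - l) (y - l) (z - l) l).symm
  simp only [e, sub_left_inj, p0, p1] at h
  rw [← h]
  symm
  refine Fintype.sum_equiv (Equiv.addRight l) _ _ fun k => ?_
  have h1 : phiZ 0 (a - l) k = phiZ l a (k + l) := by
    simpa using (phiZ_add 0 (a - l) k l).symm
  have h2 : starZ k (b - l) (c - l) (d - l) = starZ (k + l) b c d := by
    simpa using (starZ_add k (b - l) (c - l) (d - l) l).symm
  simp only [h1, h2, Equiv.coe_addRight]
  split_ifs with h0
  · simp [h0]
  · rfl

/-- A function of four indices, antisymmetric in adjacent indices, vanishes if it vanishes on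
increasing indices. -/
lemma eq_zero_of_antisymm_of_sorted {D : Fin 7 → Fin 7 → Fin 7 → Fin 7 → ℝ}
    (h12 : ∀ a b c d, D a b c d = -D b a c d) (h23 : ∀ a b c d, D a b c d = -D a c b d)
    (h34 : ∀ a b c d, D a b c d = -D a b d c)
    (h : ∀ a b c d, a < b → b < c → c < d → D a b c d = 0) (a b c d : Fin 7) : D a b c d = 0 := by
  -- Insertion sort: the first index is moved right past smaller ones, and meeting an equal index
  -- gives `D = -D`.
  have L1 : ∀ a b c d, b < c → c < d → D a b c d = 0 := by
    intro a b c d hbc hcd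
    rcases lt_trichotomy a b with hab | rfl | hab
    · exact h _ _ _ _ hab hbc hcd
    · linarith [h12 a a c d]
    rw [h12, neg_eq_zero]
    rcases lt_trichotomy a c with hac | rfl | hac
    · exact h _ _ _ _ hab hac hcd
    · linarith [h23 b a a d]
    rw [h23, neg_eq_zero]
    rcases lt_trichotomy a d with had | rfl | had
    · exact h _ _ _ _ hbc hac had
    · linarith [h34 b c a a]
    rw [h34, neg_eq_zero]
    exact h _ _ _ _ hbc hcd had
  have L2 : ∀ a b c d, c < d → D a b c d = 0 := by
    intro a b c d hcd
    rcases lt_trichotomy b c with hbc | rfl | hbc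
    · exact L1 _ _ _ _ hbc hcd
    · linarith [h23 a b b d]
    rw [h23, neg_eq_zero]
    rcases lt_trichotomy b d with hbd | rfl | hbd
    · exact L1 _ _ _ _ hbc hbd
    · linarith [h34 a c b b]
    rw [h34, neg_eq_zero]
    exact L1 _ _ _ _ hcd hbd
  rcases lt_trichotomy c d with hcd | rfl | hcd
  · exact L2 _ _ _ _ hcd
  · linarith [h34 a b c c]
  · rw [h34, neg_eq_zero]
    exact L2 _ _ _ _ hcd

end G2Hyp
end

/-! ### Three-forms, cross products and `*φ` as curried multilinear maps. -/

noncomputable section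

namespace G2Hyp

section Currying

variable {V : Type*} [AddCommGroup V] [Module ℝ V]

/-- An alternating three-form as a curried trilinear map. -/
def tri (φ : V [⋀^Fin 3]→ₗ[ℝ] ℝ) : V →ₗ[ℝ] V →ₗ[ℝ] V →ₗ[ℝ] ℝ :=
  LinearMap.mk₂ ℝ (fun x y =>
      { toFun := fun z => φ ![x, y, z]
        map_add' := fun z z' =>
          congrArg (fun f => f ![]) ((((φ.curryLeft x).curryLeft y).curryLeft).map_add z z')
        map_smul' := fun c z => by
          have h := (((φ.curryLeft x).curryLeft y).curryLeft).map_smul c z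
          exact congrArg (fun f => f ![]) h })
    (fun x x' y => by
      ext z
      exact congrArg (fun f => f ![y, z]) (φ.curryLeft.map_add x x'))
    (fun c x y => by
      ext z
      exact congrArg (fun f => f ![y, z]) (φ.curryLeft.map_smul c x))
    (fun x y y' => by
      ext z
      exact congrArg (fun f => f ![z]) ((φ.curryLeft x).curryLeft.map_add y y'))
    (fun c x y => by
      ext z
      exact congrArg (fun f => f ![z]) ((φ.curryLeft x).curryLeft.map_smul c y))

variable (φ : V [⋀^Fin 3]→ₗ[ℝ] ℝ)

lemma tri_apply (x y z : V) : tri φ x y z = φ ![x, y, z] := rfl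

lemma apply_eq_tri (v : Fin 3 → V) : φ v = tri φ (v 0) (v 1) (v 2) := by
  rw [tri_apply]
  congr 1
  funext i
  fin_cases i <;> rfl

lemma tri_swap12 (x y z : V) : tri φ x y z = -tri φ y x z := by
  rw [tri_apply, tri_apply, ← φ.map_swap ![y, x, z] (show (0 : Fin 3) ≠ 1 by decide)]
  congr 1
  funext i
  fin_cases i <;> rfl

lemma tri_swap23 (x y z : V) : tri φ x y z = -tri φ x z y := by
  rw [tri_apply, tri_apply, ← φ.map_swap ![x, z, y] (show (1 : Fin 3) ≠ 2 by decide)]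
  congr 1
  funext i
  fin_cases i <;> rfl

lemma tri_rot (x y z : V) : tri φ x y z = tri φ y z x := by
  rw [tri_swap12, tri_swap23, neg_neg]

lemma tri_self12 (x z : V) : tri φ x x z = 0 := by linarith [tri_swap12 φ x x z]
lemma tri_self23 (x z : V) : tri φ x z z = 0 := by linarith [tri_swap23 φ x z z]
lemma tri_self13 (x z : V) : tri φ x z x = 0 := by rw [tri_rot, tri_self23]

end Currying

section Seven

variable {V : Type*} [AddCommGroup V] [Module ℝ V]

/-- `e` is an orthonormal basis in which `φ` has the components of the model three-form. -/
structure IsG2Basis (g : V →ₗ[ℝ] V →ₗ[ℝ] ℝ) (φ : V [⋀^Fin 3]→ₗ[ℝ] ℝ) (e : Fin 7 → V) : Prop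
    extends IsONBasis g e where
  table : ∀ a b c, tri φ (e a) (e b) (e c) = phiZ a b c

/-- The six products are the Leibniz expansion of the determinants in the definition of a Cayley
frame, evaluated on the frame itself. -/
lemma det_delta_eq_phiZ : ∀ a b c : Fin 7, ∑ i : Fin 7,
    ((if i = a then 1 else 0) * (if i + 1 = b then 1 else 0) * (if i + 3 = c then 1 else 0)
    - (if i = a then 1 else 0) * (if i + 1 = c then 1 else 0) * (if i + 3 = b then 1 else 0)
    - (if i = b then 1 else 0) * (if i + 1 = a then 1 else 0) * (if i + 3 = c then 1 else 0)
    + (if i = b then 1 else 0) * (if i + 1 = c then 1 else 0) * (if i + 3 = a then 1 else 0)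
    + (if i = c then 1 else 0) * (if i + 1 = a then 1 else 0) * (if i + 3 = b then 1 else 0)
    - (if i = c then 1 else 0) * (if i + 1 = b then 1 else 0) * (if i + 3 = a then 1 else 0) : ℤ)
    = phiZ a b c := by decide +kernel

lemma IsG2Basis.of_cayley [FiniteDimensional ℝ V] (hn : Module.finrank ℝ V = 7)
    {g : V →ₗ[ℝ] V →ₗ[ℝ] ℝ} (hs : ∀ x y, g x y = g y x) {φ : V [⋀^Fin 3]→ₗ[ℝ] ℝ}
    {e : Fin 7 → V} (he : IsCayleyFrame (fun x y => g x y) φ e) : IsG2Basis g φ e where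
  toIsONBasis := IsONBasis.of_frame hn hs he.1
  table a b c := by
    rw [tri_apply, he.2, ← det_delta_eq_phiZ, Int.cast_sum]
    refine Finset.sum_congr rfl fun i _ => ?_
    have ho : ∀ i j, g (e i) (e j) = if i = j then 1 else 0 := he.1
    simp only [Matrix.det_fin_three, Matrix.of_apply, Matrix.cons_val_zero, Matrix.cons_val_one,
      Matrix.cons_val, ho]
    push_cast
    rfl

/-- The cross product as a bilinear map. -/
def crossL (φ : V [⋀^Fin 3]→ₗ[ℝ] ℝ) (e : Fin 7 → V) : V →ₗ[ℝ] V →ₗ[ℝ] V :=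
  LinearMap.mk₂ ℝ (fun x y => ∑ k, tri φ x y (e k) • e k)
    (fun x x' y => by simp [add_smul, Finset.sum_add_distrib])
    (fun c x y => by simp [mul_smul, Finset.smul_sum])
    (fun x y y' => by simp [add_smul, Finset.sum_add_distrib])
    (fun c x y => by simp [mul_smul, Finset.smul_sum])

/-- The four-form `*φ` in terms of the cross product. -/
def starL (g : V →ₗ[ℝ] V →ₗ[ℝ] ℝ) (P : V →ₗ[ℝ] V →ₗ[ℝ] V) : V →ₗ[ℝ] V →ₗ[ℝ] V →ₗ[ℝ] V →ₗ[ℝ] ℝ :=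
  LinearMap.mk₂ ℝ (fun x y => LinearMap.mk₂ ℝ
      (fun z w => g x z * g y w - g x w * g y z - g (P x y) (P z w))
      (fun z z' w => by simp only [map_add, LinearMap.add_apply]; ring)
      (fun c z w => by simp only [map_smul, LinearMap.smul_apply, smul_eq_mul]; ring)
      (fun z w w' => by simp only [map_add]; ring)
      (fun c z w => by simp only [map_smul, smul_eq_mul]; ring))
    (fun x x' y => by ext z w; simp only [map_add, LinearMap.add_apply, LinearMap.mk₂_apply]; ring)
    (fun c x y => by
      ext z w; simp only [map_smul, LinearMap.smul_apply, smul_eq_mul, LinearMap.mk₂_apply]; ring)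
    (fun x y y' => by ext z w; simp only [map_add, LinearMap.add_apply, LinearMap.mk₂_apply]; ring)
    (fun c x y => by
      ext z w; simp only [map_smul, LinearMap.smul_apply, smul_eq_mul, LinearMap.mk₂_apply]; ring)

lemma starL_apply (g : V →ₗ[ℝ] V →ₗ[ℝ] ℝ) (P : V →ₗ[ℝ] V →ₗ[ℝ] V) (x y z w : V) :
    starL g P x y z w = g x z * g y w - g x w * g y z - g (P x y) (P z w) := rfl

namespace IsG2Basis

variable {g : V →ₗ[ℝ] V →ₗ[ℝ] ℝ} {φ : V [⋀^Fin 3]→ₗ[ℝ] ℝ} {e : Fin 7 → V}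

lemma cross_inner (h : IsG2Basis g φ e) (x y z : V) : g (crossL φ e x y) z = tri φ x y z := by
  rw [h.apply_eq_sum (tri φ x y) z]
  simp only [crossL, LinearMap.mk₂_apply, map_sum, LinearMap.sum_apply, map_smul,
    LinearMap.smul_apply, smul_eq_mul]
  exact Finset.sum_congr rfl fun i _ => mul_comm _ _

lemma starL_table (h : IsG2Basis g φ e) (a b c d : Fin 7) :
    starL g (crossL φ e) (e a) (e b) (e c) (e d) = starZ a b c d := by
  rw [starL_apply, h.inner_eq_sum (crossL φ e (e a) (e b))]
  have h1 : ∀ a b i, g (e i) (crossL φ e (e a) (e b)) = phiZ a b i := fun a b i => by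
    rw [h.symm, h.cross_inner, h.table]
  simp only [h1, h.ortho, starZ]
  push_cast
  simp only [← ite_and, mul_ite, mul_one, mul_zero, and_comm]

/-- A function linear in each of four arguments vanishes if it vanishes on a basis. -/
lemma _root_.G2Hyp.IsONBasis.eq_zero4 {n : ℕ} {e : Fin n → V} (h : IsONBasis g e)
    {F : V → V → V → V → ℝ}
    (h1 : ∀ y z w, IsLinearMap ℝ fun x => F x y z w) (h2 : ∀ x z w, IsLinearMap ℝ fun y => F x y z w)
    (h3 : ∀ x y w, IsLinearMap ℝ fun z => F x y z w) (h4 : ∀ x y z, IsLinearMap ℝ fun w => F x y z w)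
    (hF : ∀ a b c d, F (e a) (e b) (e c) (e d) = 0) (x y z w : V) : F x y z w = 0 := by
  have key : ∀ {G : V → ℝ}, IsLinearMap ℝ G → (∀ i, G (e i) = 0) → ∀ v, G v = 0 := by
    intro G hG h0 v
    have := h.apply_eq_sum hG.mk' v
    simpa [h0] using this
  exact key (h1 y z w) (fun a => key (h2 _ z w) (fun b => key (h3 _ _ w) (fun c =>
    key (h4 _ _ _) (fun d => hF a b c d) w) z) y) x

lemma starL_swap12 (h : IsG2Basis g φ e) (x y z w : V) :
    starL g (crossL φ e) x y z w = -starL g (crossL φ e) y x z w := by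
  have := h.eq_zero4
    (F := fun x y z w => starL g (crossL φ e) x y z w + starL g (crossL φ e) y x z w)
    (fun _ _ _ => ⟨by intros; simp; ring, by intros; simp; ring⟩)
    (fun _ _ _ => ⟨by intros; simp; ring, by intros; simp; ring⟩)
    (fun _ _ _ => ⟨by intros; simp; ring, by intros; simp; ring⟩)
    (fun _ _ _ => ⟨by intros; simp; ring, by intros; simp; ring⟩)
    (fun a b c d => by
      simp only [h.starL_table]
      rw [starZ_swap12]; push_cast; ring) x y z w
  linarith

lemma starL_pair (h : IsG2Basis g φ e) (x y z w : V) :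
    starL g (crossL φ e) x y z w = starL g (crossL φ e) z w x y := by
  rw [starL_apply, starL_apply, h.symm (crossL φ e x y), h.symm x, h.symm y, h.symm x, h.symm y]
  ring

lemma starL_swap34 (h : IsG2Basis g φ e) (x y z w : V) :
    starL g (crossL φ e) x y z w = -starL g (crossL φ e) x y w z := by
  rw [h.starL_pair, h.starL_swap12, h.starL_pair]

/-- The formula for `starL` is formally skew only within each pair. Skewness across the pairs is
special to the cross product and is checked on the table. -/
lemma starL_swap23 (h : IsG2Basis g φ e) (x y z w : V) :
    starL g (crossL φ e) x y z w = -starL g (crossL φ e) x z y w := by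
  have := h.eq_zero4
    (F := fun x y z w => starL g (crossL φ e) x y z w + starL g (crossL φ e) x z y w)
    (fun _ _ _ => ⟨by intros; simp; ring, by intros; simp; ring⟩)
    (fun _ _ _ => ⟨by intros; simp; ring, by intros; simp; ring⟩)
    (fun _ _ _ => ⟨by intros; simp; ring, by intros; simp; ring⟩)
    (fun _ _ _ => ⟨by intros; simp; ring, by intros; simp; ring⟩)
    (fun a b c d => by
      simp only [h.starL_table]
      rw [starZ_swap23]; push_cast; ring) x y z w
  linarith

end IsG2Basis

end Seven

end G2Hyp
end

/-! ### The Hodge dual of `φ` in terms of the cross product. -/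

noncomputable section

namespace G2Hyp

section Seven

variable {V : Type*} [AddCommGroup V] [Module ℝ V]

/-- Counting inversions turns values of the volume form into integers that can be compared with the
tables. -/
lemma volAlt_comp {n : ℕ} {g : V →ₗ[ℝ] V →ₗ[ℝ] ℝ} {e : Fin n → V} (h : IsONBasis g e)
    (f : Fin n → Fin n) :
    volAlt g e (e ∘ f) = ((if Function.Injective f then sgnZ f else 0 : ℤ) : ℝ) := by
  classical
  split_ifs with hf
  · obtain ⟨σ, rfl⟩ : ∃ σ : Equiv.Perm (Fin n), f = σ :=
      ⟨Equiv.ofBijective f (Finite.injective_iff_bijective.1 hf), rfl⟩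
    have h1 : volAlt g e e = 1 := by
      rw [← volForm_eq, volForm]
      have : (Matrix.of fun i j => g (e i) (e j)) = (1 : Matrix (Fin n) (Fin n) ℝ) := by
        ext i j
        simp [h.ortho, Matrix.one_apply]
      rw [this, Matrix.det_one]
    rw [AlternatingMap.map_perm, h1, Equiv.Perm.sign_eq_prod_prod_Ioi, Units.smul_def]
    simp only [sgnZ, Units.coe_prod, zsmul_eq_mul, mul_one]
    congr 1
    refine Finset.prod_congr rfl fun i _ => Finset.prod_congr rfl fun j _ => ?_
    split_ifs <;> rfl
  · simp only [Function.Injective, not_forall] at hf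
    obtain ⟨a, b, hab, hne⟩ := hf
    rw [(volAlt g e).map_eq_zero_of_eq _ (i := a) (j := b) (by simp [hab]) hne]
    simp

lemma isLinearMap_update {n : ℕ} (w : V [⋀^Fin n]→ₗ[ℝ] ℝ) (i : Fin n) {m : V → Fin n → V}
    (hm : ∀ x, m x = Function.update (m 0) i x) : IsLinearMap ℝ fun x => w (m x) := by
  have : (fun x => w (m x)) = fun x => w.toMultilinearMap.toLinearMap (m 0) i x := by
    funext x
    conv_lhs => rw [hm x]
    rfl
  rw [this]
  exact LinearMap.isLinear _

lemma isLinearMap_sum {ι : Type*} [Fintype ι] {F : ι → V → ℝ} (h : ∀ i, IsLinearMap ℝ (F i)) :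
    IsLinearMap ℝ fun x => ∑ i, F i x :=
  ⟨fun x y => by simp [(h _).map_add, Finset.sum_add_distrib],
    fun c x => by simp [(h _).map_smul, Finset.mul_sum]⟩

lemma isLinearMap_sub {F F' : V → ℝ} (h : IsLinearMap ℝ F) (h' : IsLinearMap ℝ F') :
    IsLinearMap ℝ fun x => F x - F' x :=
  ⟨fun x y => by rw [h.map_add, h'.map_add]; ring,
    fun c x => by rw [h.map_smul, h'.map_smul, smul_eq_mul, smul_eq_mul, smul_eq_mul]; ring⟩

lemma alt_swap {n : ℕ} (w : V [⋀^Fin n]→ₗ[ℝ] ℝ) {v v' : Fin n → V} (i j : Fin n) (hij : i ≠ j)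
    (h : v' = v ∘ Equiv.swap i j) : w v' = -w v := by
  rw [h, w.map_swap _ hij]

variable {g : V →ₗ[ℝ] V →ₗ[ℝ] ℝ} {φ : V [⋀^Fin 3]→ₗ[ℝ] ℝ} {e : Fin 7 → V}

omit [AddCommGroup V] [Module ℝ V] in
lemma append_three_four (a : Fin 3 → V) (v : Fin 4 → V) (h : 7 = 3 + 4) :
    (fun j : Fin 7 => Fin.append a v (Fin.cast h j)) =
      ![a 0, a 1, a 2, v 0, v 1, v 2, v 3] := by
  funext j
  fin_cases j <;> rfl

omit [AddCommGroup V] [Module ℝ V] in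
lemma append_four_three (a : Fin 4 → V) (v : Fin 3 → V) (h : 7 = 4 + 3) :
    (fun j : Fin 7 => Fin.append a v (Fin.cast h j)) =
      ![a 0, a 1, a 2, a 3, v 0, v 1, v 2] := by
  funext j
  fin_cases j <;> rfl

lemma alt7_swap01 (w : V [⋀^Fin 7]→ₗ[ℝ] ℝ) (x0 x1 x2 x3 x4 x5 x6 : V) :
    w ![x0, x1, x2, x3, x4, x5, x6] = -w ![x1, x0, x2, x3, x4, x5, x6] :=
  alt_swap w 0 1 (by decide) (by funext j; fin_cases j <;> rfl)

lemma alt7_swap12 (w : V [⋀^Fin 7]→ₗ[ℝ] ℝ) (x0 x1 x2 x3 x4 x5 x6 : V) :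
    w ![x0, x1, x2, x3, x4, x5, x6] = -w ![x0, x2, x1, x3, x4, x5, x6] :=
  alt_swap w 1 2 (by decide) (by funext j; fin_cases j <;> rfl)

lemma alt7_swap23 (w : V [⋀^Fin 7]→ₗ[ℝ] ℝ) (x0 x1 x2 x3 x4 x5 x6 : V) :
    w ![x0, x1, x2, x3, x4, x5, x6] = -w ![x0, x1, x3, x2, x4, x5, x6] :=
  alt_swap w 2 3 (by decide) (by funext j; fin_cases j <;> rfl)

lemma alt7_swap34 (w : V [⋀^Fin 7]→ₗ[ℝ] ℝ) (x0 x1 x2 x3 x4 x5 x6 : V) :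
    w ![x0, x1, x2, x3, x4, x5, x6] = -w ![x0, x1, x2, x4, x3, x5, x6] :=
  alt_swap w 3 4 (by decide) (by funext j; fin_cases j <;> rfl)

lemma alt7_swap45 (w : V [⋀^Fin 7]→ₗ[ℝ] ℝ) (x0 x1 x2 x3 x4 x5 x6 : V) :
    w ![x0, x1, x2, x3, x4, x5, x6] = -w ![x0, x1, x2, x3, x5, x4, x6] :=
  alt_swap w 4 5 (by decide) (by funext j; fin_cases j <;> rfl)

lemma alt7_swap56 (w : V [⋀^Fin 7]→ₗ[ℝ] ℝ) (x0 x1 x2 x3 x4 x5 x6 : V) :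
    w ![x0, x1, x2, x3, x4, x5, x6] = -w ![x0, x1, x2, x3, x4, x6, x5] :=
  alt_swap w 5 6 (by decide) (by funext j; fin_cases j <;> rfl)

/-- The first point of a line. -/
def linePt1 (l : Fin 7) : Fin 7 := line l 0

/-- The second point of a line. -/
def linePt2 (l : Fin 7) : Fin 7 := line l 1

/-- The third point of a line. -/
def linePt3 (l : Fin 7) : Fin 7 := line l 2

/-- The sum of the contractions of the volume form with the seven lines. -/
def lineSum (g : V →ₗ[ℝ] V →ₗ[ℝ] ℝ) (e : Fin 7 → V) (x y z w : V) : ℝ :=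
  ∑ l, volAlt g e ![e (linePt1 l), e (linePt2 l), e (linePt3 l), x, y, z, w]

lemma lineSum_swap12 (x y z w : V) : lineSum g e x y z w = -lineSum g e y x z w := by
  rw [lineSum, lineSum, ← Finset.sum_neg_distrib]
  exact Finset.sum_congr rfl fun l _ => alt7_swap34 (volAlt g e) _ _ _ _ _ _ _

lemma lineSum_swap23 (x y z w : V) : lineSum g e x y z w = -lineSum g e x z y w := by
  rw [lineSum, lineSum, ← Finset.sum_neg_distrib]
  exact Finset.sum_congr rfl fun l _ => alt7_swap45 (volAlt g e) _ _ _ _ _ _ _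

lemma lineSum_swap34 (x y z w : V) : lineSum g e x y z w = -lineSum g e x y w z := by
  rw [lineSum, lineSum, ← Finset.sum_neg_distrib]
  exact Finset.sum_congr rfl fun l _ => alt7_swap56 (volAlt g e) _ _ _ _ _ _ _

lemma lineSum_sorted (h : IsONBasis g e) (a b c d : Fin 7) (hab : a < b) (hbc : b < c)
    (hcd : c < d) : (starZ a b c d : ℝ) = lineSum g e (e a) (e b) (e c) (e d) := by
  rw [starZ_sorted a b c d hab hbc hcd, Int.cast_sum, lineSum]
  refine Finset.sum_congr rfl fun l _ => ?_
  rw [← volAlt_comp h]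
  congr 1
  funext j
  fin_cases j <;> rfl

/-- Both sides are antisymmetric in adjacent indices, so increasing quadruples suffice. -/
lemma lineSum_table (h : IsONBasis g e) (a b c d : Fin 7) :
    (starZ a b c d : ℝ) = lineSum g e (e a) (e b) (e c) (e d) := by
  rw [← sub_eq_zero]
  refine eq_zero_of_antisymm_of_sorted
    (D := fun a b c d => (starZ a b c d : ℝ) - lineSum g e (e a) (e b) (e c) (e d))
    ?_ ?_ ?_ ?_ a b c d
  · intro a b c d
    rw [starZ_swap12, lineSum_swap12]
    push_cast
    ring
  · intro a b c d
    rw [starZ_swap23, lineSum_swap23]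
    push_cast
    ring
  · intro a b c d
    rw [starZ_swap34, lineSum_swap34]
    push_cast
    ring
  · intro a b c d hab hbc hcd
    exact sub_eq_zero.2 (lineSum_sorted h a b c d hab hbc hcd)

lemma isLinearMap_alt7 (w : V [⋀^Fin 7]→ₗ[ℝ] ℝ) (a b c x y z v : V) :
    (IsLinearMap ℝ fun x => w ![a, b, c, x, y, z, v]) ∧
    (IsLinearMap ℝ fun y => w ![a, b, c, x, y, z, v]) ∧
    (IsLinearMap ℝ fun z => w ![a, b, c, x, y, z, v]) ∧
    (IsLinearMap ℝ fun v => w ![a, b, c, x, y, z, v]) :=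
  ⟨isLinearMap_update w 3 fun x => by funext j; fin_cases j <;> rfl,
    isLinearMap_update w 4 fun x => by funext j; fin_cases j <;> rfl,
    isLinearMap_update w 5 fun x => by funext j; fin_cases j <;> rfl,
    isLinearMap_update w 6 fun x => by funext j; fin_cases j <;> rfl⟩

lemma starL_eq_lineSum (h : IsG2Basis g φ e) (x y z w : V) :
    starL g (crossL φ e) x y z w = lineSum g e x y z w := by
  rw [← sub_eq_zero]
  refine h.eq_zero4 (F := fun x y z w => starL g (crossL φ e) x y z w - lineSum g e x y z w)
    (fun y z w => ?_) (fun x z w => ?_) (fun x y w => ?_) (fun x y z => ?_)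
    (fun a b c d => ?_) x y z w
  · exact isLinearMap_sub ⟨by intros; simp, by intros; simp⟩
      (isLinearMap_sum fun l => (isLinearMap_alt7 _ _ _ _ 0 _ _ _).1)
  · exact isLinearMap_sub ⟨by intros; simp, by intros; simp⟩
      (isLinearMap_sum fun l => (isLinearMap_alt7 _ _ _ _ _ 0 _ _).2.1)
  · exact isLinearMap_sub ⟨by intros; simp, by intros; simp⟩
      (isLinearMap_sum fun l => (isLinearMap_alt7 _ _ _ _ _ _ 0 _).2.2.1)
  · exact isLinearMap_sub ⟨by intros; simp, by intros; simp⟩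
      (isLinearMap_sum fun l => (isLinearMap_alt7 _ _ _ _ _ _ _ 0).2.2.2)
  · exact sub_eq_zero.2 ((h.starL_table a b c d).trans (lineSum_table h.toIsONBasis a b c d))

/-- This cuts the 35 increasing triples in the Hodge star down to the seven lines on which `φ` is
non-zero. -/
lemma sum_strictMono_eq_sum_line (F : (Fin 3 → Fin 7) → ℝ)
    (hF : ∀ i, StrictMono i → (∃ l, i = line l) ∨ F i = 0)
    [DecidablePred fun i : Fin 3 → Fin 7 => StrictMono i] :
    ∑ i : Fin 3 → Fin 7 with StrictMono i, F i = ∑ l, F (line l) := by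
  classical
  rw [← Finset.sum_image (s := Finset.univ) (f := F) (fun a _ b _ hab => line_injective hab)]
  symm
  refine Finset.sum_subset ?_ ?_
  · intro i hi
    simp only [Finset.mem_image, Finset.mem_univ, true_and] at hi
    obtain ⟨l, rfl⟩ := hi
    exact Finset.mem_filter.2 ⟨Finset.mem_univ _, line_strictMono l⟩
  · intro i hi hi'
    rcases hF i (Finset.mem_filter.1 hi).2 with ⟨l, rfl⟩ | h0
    · exact absurd (Finset.mem_image_of_mem _ (Finset.mem_univ l)) hi'
    · exact h0

lemma hodge_eq_sum_filter {n k m : ℕ} (g : V →ₗ[ℝ] V →ₗ[ℝ] ℝ) (e : Fin n → V) (h : k + m = n)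
    (b : (Fin k → V) → ℝ) (v : Fin m → V) [DecidablePred fun i : Fin k → Fin n => StrictMono i] :
    hodge (fun x y => g x y) e h b v = ∑ i : Fin k → Fin n with StrictMono i,
      b (fun s => e (i s)) *
        volAlt g e (fun j => Fin.append (fun s => e (i s)) v (Fin.cast h.symm j)) := by
  simp only [hodge, volForm_eq]
  exact Finset.sum_congr (by congr) fun i _ => rfl

lemma phi_frame (h : IsG2Basis g φ e) (i : Fin 3 → Fin 7) :
    φ (fun s => e (i s)) = phiZ (i 0) (i 1) (i 2) := by
  rw [apply_eq_tri, h.table]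

lemma phi_line (h : IsG2Basis g φ e) (l : Fin 7) : φ (fun s => e (line l s)) = 1 := by
  have h2 : (phiZ (line l 0) (line l 1) (line l 2) : ℝ) = 1 := by exact_mod_cast phiZ_line l
  rw [phi_frame h, h2]

lemma alt_append_of_eq_one {c : ℝ} (hc : c = 1) (w : V [⋀^Fin 7]→ₗ[ℝ] ℝ) (t : Fin 3 → V)
    (v : Fin 4 → V) (hk : 7 = 3 + 4) {u : V × V × V} (hu : u = (t 0, t 1, t 2)) :
    c * w (fun j => Fin.append t v (Fin.cast hk j)) =
      w ![u.1, u.2.1, u.2.2, v 0, v 1, v 2, v 3] := by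
  rw [hc, one_mul, append_three_four, hu]

lemma phi_line_mul_alt (h : IsG2Basis g φ e) (w : V [⋀^Fin 7]→ₗ[ℝ] ℝ) (v : Fin 4 → V)
    (hk : 7 = 3 + 4) (l : Fin 7) :
    φ (fun s => e (line l s)) * w (fun j => Fin.append (fun s => e (line l s)) v (Fin.cast hk j)) =
      w ![e (linePt1 l), e (linePt2 l), e (linePt3 l), v 0, v 1, v 2, v 3] := by
  exact alt_append_of_eq_one (phi_line h l) w (fun s => e (line l s)) v _
    (u := (e (linePt1 l), e (linePt2 l), e (linePt3 l))) rfl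

lemma hodge_phi (h : IsG2Basis g φ e) (hk : 3 + 4 = 7) (v : Fin 4 → V) :
    hodge (fun x y => g x y) e hk φ v = starL g (crossL φ e) (v 0) (v 1) (v 2) (v 3) := by
  rw [starL_eq_lineSum h, hodge_eq_sum_filter, sum_strictMono_eq_sum_line, lineSum]
  · refine Fintype.sum_congr _ _ fun l => ?_
    exact phi_line_mul_alt h (volAlt g e) v hk.symm l
  · intro i hi
    refine (phiZ_of_strictMono i hi).imp_right fun h0 => ?_
    rw [phi_frame h, h0, Int.cast_zero, zero_mul]

set_option maxRecDepth 100000 in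
/-- A sum over triples of indices against the volume form is the Hodge dual. -/
lemma sum_phi_mul_vol (h : IsG2Basis g φ e) (x y z w : V) :
    ∑ a, ∑ b, ∑ c, tri φ (e a) (e b) (e c) * volAlt g e ![e a, e b, e c, x, y, z, w] =
      6 * starL g (crossL φ e) x y z w := by
  have h1 := hodge_eq_sum g e (by norm_num : 3 + 4 = 7) φ
    (fun w σ => by rw [φ.map_perm, Units.smul_def, zsmul_eq_mul]) ![x, y, z, w]
  rw [hodge_phi h] at h1
  simp only [append_three_four, apply_eq_tri] at h1
  have h2 : ∀ f : (Fin 3 → Fin 7) → ℝ, ∑ i, f i = ∑ a, ∑ b, ∑ c, f ![a, b, c] := by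
    intro f
    rw [← (Fin.consEquiv (fun _ => Fin 7)).sum_comp, Fintype.sum_prod_type]
    refine Finset.sum_congr rfl fun a _ => ?_
    rw [← (Fin.consEquiv (fun _ => Fin 7)).sum_comp, Fintype.sum_prod_type]
    refine Finset.sum_congr rfl fun b _ => ?_
    rw [← (Equiv.funUnique (Fin 1) (Fin 7)).symm.sum_comp]
    refine Finset.sum_congr rfl fun c _ => congrArg f ?_
    funext j
    fin_cases j <;> rfl
  rw [h2] at h1
  have h3 : (Nat.factorial 3 : ℝ) = 6 := by norm_num [Nat.factorial]
  rw [h3] at h1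
  simp only [Matrix.cons_val_zero, Matrix.cons_val_one, Matrix.cons_val, Function.comp_apply] at h1
  rw [h1]
  ring

end Seven

end G2Hyp
end

/-! ### Contractions of `*φ`, and the one-form `*(*δ ∧ φ)` for `δ = 3 x ∧ φ`. -/

noncomputable section

namespace G2Hyp

section Seven

variable {V : Type*} [AddCommGroup V] [Module ℝ V]

variable {g : V →ₗ[ℝ] V →ₗ[ℝ] ℝ} {φ : V [⋀^Fin 3]→ₗ[ℝ] ℝ} {e : Fin 7 → V}

lemma IsONBasis.eq_zero1 {n : ℕ} {e : Fin n → V} (h : IsONBasis g e) {F : V → ℝ}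
    (hF : IsLinearMap ℝ F) (h0 : ∀ i, F (e i) = 0) (v : V) : F v = 0 := by
  have := h.apply_eq_sum hF.mk' v
  simpa [h0] using this

/-- This is `(l × a) ⌟ *φ = a ∧ (l ⌟ φ) - l ∧ (a ⌟ φ)`. Both sides are linear in all five vectors,
so it reduces to the table. It is the source of `dφ = 3 l ∧ φ` and of the shape of `∇ω`. -/
lemma IsG2Basis.starL_cross (h : IsG2Basis g φ e) (l a b c d : V) :
    starL g (crossL φ e) (crossL φ e l a) b c d =
      g a b * tri φ l c d - g a c * tri φ l b d + g a d * tri φ l b c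
        - g l b * tri φ a c d + g l c * tri φ a b d - g l d * tri φ a b c := by
  rw [← sub_eq_zero]
  refine h.eq_zero1 (F := fun l => starL g (crossL φ e) (crossL φ e l a) b c d -
      (g a b * tri φ l c d - g a c * tri φ l b d + g a d * tri φ l b c
        - g l b * tri φ a c d + g l c * tri φ a b d - g l d * tri φ a b c))
    ⟨by intros; simp; ring, by intros; simp; ring⟩ (fun l => ?_) l
  refine h.eq_zero4 (F := fun a b c d => starL g (crossL φ e) (crossL φ e (e l) a) b c d -
      (g a b * tri φ (e l) c d - g a c * tri φ (e l) b d + g a d * tri φ (e l) b c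
        - g (e l) b * tri φ a c d + g (e l) c * tri φ a b d - g (e l) d * tri φ a b c))
    (fun _ _ _ => ⟨by intros; simp; ring, by intros; simp; ring⟩)
    (fun _ _ _ => ⟨by intros; simp; ring, by intros; simp; ring⟩)
    (fun _ _ _ => ⟨by intros; simp; ring, by intros; simp; ring⟩)
    (fun _ _ _ => ⟨by intros; simp; ring, by intros; simp; ring⟩) (fun a b c d => ?_) a b c d
  have h1 : starL g (crossL φ e) (crossL φ e (e l) (e a)) (e b) (e c) (e d) =
      ((∑ k, phiZ l a k * starZ k b c d : ℤ) : ℝ) := by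
    rw [crossL, LinearMap.mk₂_apply]
    simp only [map_sum, map_smul, LinearMap.sum_apply, LinearMap.smul_apply, smul_eq_mul, h.table]
    push_cast
    exact Finset.sum_congr rfl fun k _ => by rw [← h.starL_table]; rfl
  rw [h1, sum_phiZ_mul_starZ]
  simp only [h.ortho, h.table]
  push_cast
  ring

/-- The constant: each basis vector occurs in four of the seven terms of `*φ`, and each term is
counted `3!` times. -/
lemma IsG2Basis.sum_starL_mul_starL (h : IsG2Basis g φ e) (x y : V) :
    ∑ i, ∑ j, ∑ k, starL g (crossL φ e) x (e i) (e j) (e k) *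
      starL g (crossL φ e) y (e i) (e j) (e k) = 24 * g x y := by
  rw [← sub_eq_zero]
  have hlin : ∀ y, IsLinearMap ℝ fun x => ∑ i, ∑ j, ∑ k,
      starL g (crossL φ e) x (e i) (e j) (e k) * starL g (crossL φ e) y (e i) (e j) (e k) := by
    intro y
    refine isLinearMap_sum fun i => isLinearMap_sum fun j => isLinearMap_sum fun k => ?_
    exact ⟨by intros; simp; ring, by intros; simp; ring⟩
  have hlin' : ∀ x, IsLinearMap ℝ fun y => ∑ i, ∑ j, ∑ k,
      starL g (crossL φ e) x (e i) (e j) (e k) * starL g (crossL φ e) y (e i) (e j) (e k) := by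
    intro y
    refine isLinearMap_sum fun i => isLinearMap_sum fun j => isLinearMap_sum fun k => ?_
    exact ⟨by intros; simp; ring, by intros; simp; ring⟩
  refine h.eq_zero1 (F := fun x => (∑ i, ∑ j, ∑ k, starL g (crossL φ e) x (e i) (e j) (e k) *
      starL g (crossL φ e) y (e i) (e j) (e k)) - 24 * g x y)
    (isLinearMap_sub (hlin y) ⟨by intros; simp; ring, by intros; simp; ring⟩) (fun a => ?_) x
  refine h.eq_zero1 (F := fun y => (∑ i, ∑ j, ∑ k, starL g (crossL φ e) (e a) (e i) (e j) (e k) *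
      starL g (crossL φ e) y (e i) (e j) (e k)) - 24 * g (e a) y)
    (isLinearMap_sub (hlin' (e a)) ⟨by intros; simp; ring, by intros; simp; ring⟩) (fun b => ?_) y
  have h0 := sum_starZ_mul_starZ a b
  have h1 : ((∑ i, ∑ j, ∑ k, starZ a i j k * starZ b i j k : ℤ) : ℝ) =
      ((if a = b then 24 else 0 : ℤ) : ℝ) := by rw [h0]
  push_cast at h1
  simp only [h.starL_table, h.ortho, h1]
  split_ifs <;> simp

lemma sum_fin_three_fun (f : (Fin 3 → Fin 7) → ℝ) : ∑ i, f i = ∑ a, ∑ b, ∑ c, f ![a, b, c] := by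
  rw [← (Fin.consEquiv (fun _ => Fin 7)).sum_comp, Fintype.sum_prod_type]
  refine Finset.sum_congr rfl fun a _ => ?_
  rw [← (Fin.consEquiv (fun _ => Fin 7)).sum_comp, Fintype.sum_prod_type]
  refine Finset.sum_congr rfl fun b _ => ?_
  rw [← (Equiv.funUnique (Fin 1) (Fin 7)).symm.sum_comp]
  refine Finset.sum_congr rfl fun c _ => congrArg f ?_
  funext j
  fin_cases j <;> rfl

lemma sum_fin_four_fun (f : (Fin 4 → Fin 7) → ℝ) :
    ∑ i, f i = ∑ a, ∑ b, ∑ c, ∑ d, f ![a, b, c, d] := by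
  rw [← (Fin.consEquiv (fun _ => Fin 7)).sum_comp, Fintype.sum_prod_type]
  refine Finset.sum_congr rfl fun a _ => ?_
  rw [sum_fin_three_fun]
  rfl

lemma sum_fin_six_fun (f : (Fin 6 → Fin 7) → ℝ) :
    ∑ i, f i = ∑ a, ∑ b, ∑ c, ∑ a', ∑ b', ∑ c', f ![a, b, c, a', b', c'] := by
  rw [← (Fin.consEquiv (fun _ => Fin 7)).sum_comp, Fintype.sum_prod_type]
  refine Finset.sum_congr rfl fun a _ => ?_
  rw [← (Fin.consEquiv (fun _ => Fin 7)).sum_comp, Fintype.sum_prod_type]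
  refine Finset.sum_congr rfl fun b _ => ?_
  rw [sum_fin_four_fun]
  rfl

lemma sum4_swap12 {ι : Type*} [Fintype ι] (F : ι → ι → ι → ι → ℝ) :
    ∑ a, ∑ b, ∑ c, ∑ d, F a b c d = ∑ a, ∑ b, ∑ c, ∑ d, F b a c d := Finset.sum_comm

lemma sum4_swap23 {ι : Type*} [Fintype ι] (F : ι → ι → ι → ι → ℝ) :
    ∑ a, ∑ b, ∑ c, ∑ d, F a b c d = ∑ a, ∑ b, ∑ c, ∑ d, F a c b d :=
  Finset.sum_congr rfl fun _ _ => Finset.sum_comm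

lemma sum4_swap34 {ι : Type*} [Fintype ι] (F : ι → ι → ι → ι → ℝ) :
    ∑ a, ∑ b, ∑ c, ∑ d, F a b c d = ∑ a, ∑ b, ∑ c, ∑ d, F a b d c :=
  Finset.sum_congr rfl fun _ _ => Finset.sum_congr rfl fun _ _ => Finset.sum_comm

lemma sum4_neg {ι : Type*} [Fintype ι] {F F' : ι → ι → ι → ι → ℝ}
    (h : ∀ a b c d, F a b c d = -F' a b c d) :
    ∑ a, ∑ b, ∑ c, ∑ d, F a b c d = -∑ a, ∑ b, ∑ c, ∑ d, F' a b c d := by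
  simp only [h, Finset.sum_neg_distrib]

/-- `*(x ∧ φ) = -x ⌟ *φ`, in terms of sums against the volume form. -/
lemma sum_wedge_phi_mul_vol (h : IsG2Basis g φ e) (x u v w : V) :
    ∑ a, ∑ b, ∑ c, ∑ d, (g x (e a) * tri φ (e b) (e c) (e d) - g x (e b) * tri φ (e a) (e c) (e d)
        + g x (e c) * tri φ (e a) (e b) (e d) - g x (e d) * tri φ (e a) (e b) (e c)) *
        volAlt g e ![e a, e b, e c, e d, u, v, w] = -24 * starL g (crossL φ e) x u v w := by
  -- Here the sum over `d` rebuilds `x` in the fourth slot. The other three sums follow from this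
  -- one by adjacent transpositions, with alternating signs.
  have t4 : ∑ a, ∑ b, ∑ c, ∑ d, g x (e d) * tri φ (e a) (e b) (e c) *
      volAlt g e ![e a, e b, e c, e d, u, v, w] = 6 * starL g (crossL φ e) x u v w := by
    rw [← sum_phi_mul_vol h]
    refine Finset.sum_congr rfl fun a _ => Finset.sum_congr rfl fun b _ =>
      Finset.sum_congr rfl fun c _ => ?_
    have hl : IsLinearMap ℝ fun y => volAlt g e ![e a, e b, e c, y, u, v, w] :=
      (isLinearMap_alt7 (volAlt g e) _ _ _ 0 _ _ _).1
    have := h.apply_eq_sum hl.mk' x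
    simp only [IsLinearMap.mk'_apply] at this
    rw [this, Finset.mul_sum]
    refine Finset.sum_congr rfl fun d _ => ?_
    rw [h.symm x]
    ring
  have t3 : ∑ a, ∑ b, ∑ c, ∑ d, g x (e c) * tri φ (e a) (e b) (e d) *
      volAlt g e ![e a, e b, e c, e d, u, v, w] = -(6 * starL g (crossL φ e) x u v w) := by
    rw [← t4, sum4_swap34]
    exact sum4_neg fun a b c d => by rw [alt7_swap23]; ring
  have t2 : ∑ a, ∑ b, ∑ c, ∑ d, g x (e b) * tri φ (e a) (e c) (e d) *
      volAlt g e ![e a, e b, e c, e d, u, v, w] = 6 * starL g (crossL φ e) x u v w := by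
    rw [← neg_neg (6 * _), ← t3, sum4_swap23]
    exact sum4_neg fun a b c d => by rw [alt7_swap12]; ring
  have t1 : ∑ a, ∑ b, ∑ c, ∑ d, g x (e a) * tri φ (e b) (e c) (e d) *
      volAlt g e ![e a, e b, e c, e d, u, v, w] = -(6 * starL g (crossL φ e) x u v w) := by
    rw [← t2, sum4_swap12]
    exact sum4_neg fun a b c d => by rw [alt7_swap01]; ring
  simp only [add_mul, sub_mul, Finset.sum_add_distrib, Finset.sum_sub_distrib, t1, t2, t3, t4]
  ring

set_option maxRecDepth 10000 in
/-- The Hodge dual of `3 x ∧ φ`. -/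
lemma hodge_four_form (h : IsG2Basis g φ e) (x : V) (δ : V [⋀^Fin 4]→ₗ[ℝ] ℝ)
    (hδ : ∀ a b c d, δ ![a, b, c, d] = 3 * (g x a * tri φ b c d - g x b * tri φ a c d
      + g x c * tri φ a b d - g x d * tri φ a b c)) (hk : 4 + 3 = 7) (v : Fin 3 → V) :
    hodge (fun x y => g x y) e hk δ v = -3 * starL g (crossL φ e) x (v 0) (v 1) (v 2) := by
  rw [hodge_eq_sum g e hk δ (fun w σ => by rw [δ.map_perm, Units.smul_def, zsmul_eq_mul])]
  have h1 : ∀ a b c d : Fin 7, (e ∘ ![a, b, c, d]) = ![e a, e b, e c, e d] := by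
    intro a b c d
    funext j
    fin_cases j <;> rfl
  have h3 : (Nat.factorial 4 : ℝ) = 24 := by norm_num [Nat.factorial]
  generalize hw : volAlt g e = w
  rw [sum_fin_four_fun, h3]
  simp only [append_four_three, h1, hδ, mul_assoc, ← Finset.mul_sum]
  have h2 := sum_wedge_phi_mul_vol h x (v 0) (v 1) (v 2)
  rw [hw] at h2
  simp only [Matrix.cons_val_zero, Matrix.cons_val_one, Matrix.cons_val]
  rw [h2]
  ring

set_option maxRecDepth 10000 in
/-- `*(*δ ∧ φ) = -12 x` for `δ = 3 x ∧ φ`. -/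
lemma hodge_hodge_wedge (h : IsG2Basis g φ e) (x y : V) (A : (Fin 3 → V) → ℝ)
    (hA : ∀ v, A v = -3 * starL g (crossL φ e) x (v 0) (v 1) (v 2)) (hk : (3 + 3) + 1 = 7) :
    hodge (fun x y => g x y) e hk (wedge A φ) (fun _ => y) = -12 * g x y := by
  rw [hodge_eq_sum g e hk _ (wedge_perm A φ), sum_wedge_mul_vol _ _ _ _ hk]
  have h3 : (Nat.factorial 3 : ℝ) = 6 := by norm_num [Nat.factorial]
  have h6 : (Nat.factorial (3 + 3) : ℝ) = 720 := by norm_num [Nat.factorial]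
  -- The nine transpositions that interchange the two blocks and the three that bring `y` to the
  -- front of `*φ` each give `-1`, so the signs cancel.
  have key : ∀ a b c, ∑ a', ∑ b', ∑ c', tri φ (e a') (e b') (e c') *
      volAlt g e ![e a, e b, e c, e a', e b', e c', y] =
        6 * starL g (crossL φ e) y (e a) (e b) (e c) := by
    intro a b c
    rw [h.starL_swap12, h.starL_swap23, h.starL_swap34, neg_neg, mul_neg, ← sum_phi_mul_vol h]
    simp only [← Finset.sum_neg_distrib]
    refine Finset.sum_congr rfl fun a' _ => Finset.sum_congr rfl fun b' _ =>
      Finset.sum_congr rfl fun c' _ => ?_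
    rw [alt7_swap23, alt7_swap12, alt7_swap01, alt7_swap34, alt7_swap23, alt7_swap12, alt7_swap45,
      alt7_swap34, alt7_swap23]
    ring
  rw [h3, h6, sum_fin_six_fun]
  have e1 : ∀ a b c a' b' c' : Fin 7, (e ∘ ![a, b, c, a', b', c']) =
      ![e a, e b, e c, e a', e b', e c'] := by
    intro a b c a' b' c'
    funext j
    fin_cases j <;> rfl
  generalize hw : volAlt g e = w at key ⊢
  have e2 : ∀ a b c a' b' c' : Fin 7,
      (fun s : Fin 3 => e (![a, b, c, a', b', c'] (Fin.castAdd 3 s))) = ![e a, e b, e c] := by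
    intro a b c a' b' c'
    funext j
    fin_cases j <;> rfl
  have e3 : ∀ a b c a' b' c' : Fin 7,
      (fun s : Fin 3 => e (![a, b, c, a', b', c'] (Fin.natAdd 3 s))) = ![e a', e b', e c'] := by
    intro a b c a' b' c'
    funext j
    fin_cases j <;> rfl
  have e4 : ∀ a b c a' b' c' : Fin 7,
      w (fun j => Fin.append (e ∘ ![a, b, c, a', b', c']) (fun _ : Fin 1 => y)
        (Fin.cast hk.symm j)) = w ![e a, e b, e c, e a', e b', e c', y] := by
    intro a b c a' b' c'
    congr 1
    funext j
    fin_cases j <;> rfl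
  simp only [e2, e3, e4, hA, ← tri_apply, mul_assoc, ← Finset.mul_sum, key, Matrix.cons_val_zero,
    Matrix.cons_val_one, Matrix.cons_val]
  have h7 : ∀ a b c, starL g (crossL φ e) x (e a) (e b) (e c) *
      (6 * starL g (crossL φ e) y (e a) (e b) (e c)) = 6 * (starL g (crossL φ e) x (e a) (e b) (e c)
        * starL g (crossL φ e) y (e a) (e b) (e c)) := fun a b c => by ring
  -- The constants combine to `-3 · 6 · 24 / (3! · 3!) = -12`.
  simp only [h7, ← Finset.mul_sum, h.sum_starL_mul_starL]
  ring

end Seven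

end G2Hyp
end

/-! ### Cross product identities and Cayley frames adapted to a unit vector. -/

noncomputable section

namespace G2Hyp

section Seven

variable {V : Type*} [AddCommGroup V] [Module ℝ V]

variable {g : V →ₗ[ℝ] V →ₗ[ℝ] ℝ} {φ : V [⋀^Fin 3]→ₗ[ℝ] ℝ} {e : Fin 7 → V}

lemma starPhi_eq (h : IsG2Basis g φ (cayleyFrame (fun x y => g x y) φ)) (v : Fin 4 → V) :
    starPhi (fun x y => g x y) φ v =
      starL g (crossL φ (cayleyFrame (fun x y => g x y) φ)) (v 0) (v 1) (v 2) (v 3) :=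
  hodge_phi h _ v

lemma starStarWedge_eq (h : IsG2Basis g φ (cayleyFrame (fun x y => g x y) φ)) (x : V)
    (δ : V [⋀^Fin 4]→ₗ[ℝ] ℝ)
    (hδ : ∀ a b c d, δ ![a, b, c, d] = 3 * (g x a * tri φ b c d - g x b * tri φ a c d
      + g x c * tri φ a b d - g x d * tri φ a b c)) (y : V) :
    starStarWedge (fun x y => g x y) φ δ y = -12 * g x y :=
  hodge_hodge_wedge h x y _ (hodge_four_form h x δ hδ _) _

namespace IsG2Basis

lemma cross_swap (h : IsG2Basis g φ e) (x y : V) : crossL φ e x y = -crossL φ e y x := by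
  refine h.eq_of_inner fun z => ?_
  rw [h.cross_inner, map_neg, LinearMap.neg_apply, h.cross_inner, tri_swap12]

/-- Total skewness gives `*φ (x, y, x, w) = 0`; the identity is that equation written out. -/
lemma inner_cross_cross (h : IsG2Basis g φ e) (x y w : V) :
    g (crossL φ e x y) (crossL φ e x w) = g x x * g y w - g x w * g y x := by
  have h1 := starL_apply g (crossL φ e) x y x w
  have h2 := h.starL_swap23 x y x w
  have h3 := h.starL_swap12 x x y w
  linarith

lemma cross_cross_self (h : IsG2Basis g φ e) (x y : V) :
    crossL φ e x (crossL φ e x y) = -(g x x) • y + g x y • x := by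
  refine h.eq_of_inner fun z => ?_
  rw [h.cross_inner, tri_swap23, ← h.cross_inner, h.inner_cross_cross]
  simp only [map_add, map_smul, LinearMap.add_apply, LinearMap.smul_apply, smul_eq_mul]
  rw [h.symm z y, h.symm z x]
  ring

lemma cross_cross_polar (h : IsG2Basis g φ e) (x z y : V) :
    crossL φ e x (crossL φ e z y) + crossL φ e z (crossL φ e x y) =
      -(2 * g x z) • y + g x y • z + g z y • x := by
  have h1 := h.cross_cross_self (x + z) y
  have h2 := h.cross_cross_self x y
  have h3 := h.cross_cross_self z y
  simp only [map_add, LinearMap.add_apply, h2, h3, h.symm z x] at h1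
  rw [← sub_eq_zero] at h1 ⊢
  rw [← h1]
  module

lemma cross_cross_anticomm (h : IsG2Basis g φ e) {x y z : V} (hxz : g x z = 0) (hxy : g x y = 0)
    (hzy : g z y = 0) : crossL φ e x (crossL φ e z y) = -crossL φ e z (crossL φ e x y) := by
  have := h.cross_cross_polar x z y
  rw [hxz, hxy, hzy] at this
  rw [eq_neg_iff_add_eq_zero, this]
  simp

/-- The equality case of Cauchy–Schwarz: `x × y` and `z` are unit vectors with inner product one. -/
lemma cross_eq_of_tri_eq_one (h : IsG2Basis g φ e) {x y z : V} (hx : g x x = 1) (hy : g y y = 1)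
    (hxy : g x y = 0) (hz : g z z = 1) (ht : tri φ x y z = 1) : crossL φ e x y = z := by
  rw [← sub_eq_zero]
  apply h.eq_zero_of_self
  have h1 := h.inner_cross_cross x y y
  have h2 := h.cross_inner x y z
  simp only [map_sub, LinearMap.sub_apply]
  rw [h.symm z, h1, h2, hx, hy, hz, hxy, ht]
  ring

end IsG2Basis

/-- An orthonormal basis in which `φ` is one on the seven oriented lines is a Cayley frame. -/
lemma IsG2Basis.of_lines (h : IsG2Basis g φ e) {f : Fin 7 → V} (hf : IsONBasis g f)
    (hl : ∀ i, tri φ (f i) (f (i + 1)) (f (i + 3)) = 1) : IsG2Basis g φ f where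
  toIsONBasis := hf
  table := by
    have one : ∀ i, g (f i) (f i) = 1 := fun i => by simp [hf.ortho]
    have zero : ∀ i j, i ≠ j → g (f i) (f j) = 0 := fun i j hij => by simp [hf.ortho, hij]
    -- Rotating each line cyclically gives the products with differences 1, 2 and 4; skewness gives
    -- 3, 6 and 5. Together they are the full multiplication table.
    have c1 : ∀ i, crossL φ e (f i) (f (i + 1)) = f (i + 3) := fun i =>
      h.cross_eq_of_tri_eq_one (one _) (one _) (zero _ _ (by simp)) (one _) (hl i)
    have c2 : ∀ i, crossL φ e (f i) (f (i + 2)) = f (i + 6) := by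
      intro i
      refine h.cross_eq_of_tri_eq_one (one _) (one _) (zero _ _ (by simp)) (one _) ?_
      have := hl (i + 6)
      rw [tri_rot, add_assoc, add_assoc] at this
      simpa [show (6 : Fin 7) + 1 = 0 from rfl, show (6 : Fin 7) + 3 = 2 from rfl] using this
    have c4 : ∀ i, crossL φ e (f i) (f (i + 4)) = f (i + 5) := by
      intro i
      refine h.cross_eq_of_tri_eq_one (one _) (one _) (zero _ _ (by simp)) (one _) ?_
      have := hl (i + 4)
      rw [tri_rot, tri_rot, add_assoc, add_assoc] at this
      simpa [show (4 : Fin 7) + 1 = 5 from rfl, show (4 : Fin 7) + 3 = 0 from rfl] using this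
    have c3 : ∀ i, crossL φ e (f i) (f (i + 3)) = -f (i + 1) := by
      intro i
      have := c4 (i + 3)
      rw [h.cross_swap, add_assoc, add_assoc] at this
      simp only [show (3 : Fin 7) + 4 = 0 from rfl, show (3 : Fin 7) + 5 = 1 from rfl,
        add_zero] at this
      rw [← this, neg_neg]
    have c5 : ∀ i, crossL φ e (f i) (f (i + 5)) = -f (i + 4) := by
      intro i
      have := c2 (i + 5)
      rw [h.cross_swap, add_assoc, add_assoc] at this
      simp only [show (5 : Fin 7) + 2 = 0 from rfl, show (5 : Fin 7) + 6 = 4 from rfl,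
        add_zero] at this
      rw [← this, neg_neg]
    have c6 : ∀ i, crossL φ e (f i) (f (i + 6)) = -f (i + 2) := by
      intro i
      have := c1 (i + 6)
      rw [h.cross_swap, add_assoc, add_assoc] at this
      simp only [show (6 : Fin 7) + 1 = 0 from rfl, show (6 : Fin 7) + 3 = 2 from rfl,
        add_zero] at this
      rw [← this, neg_neg]
    intro a b c
    obtain ⟨s, rfl⟩ : ∃ s, b = a + s := ⟨b - a, by abel⟩
    obtain ⟨t, rfl⟩ : ∃ t, c = a + t := ⟨c - a, by abel⟩
    rw [phiZ, add_sub_cancel_left, add_sub_cancel_left, ← h.cross_inner]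
    have key : ∀ s t, g (crossL φ e (f a) (f (a + s))) (f (a + t)) = phiTbl s t := by
      intro s
      fin_cases s
      · intro t
        have h0 : crossL φ e (f a) (f a) = 0 := h.eq_of_inner fun z => by
          rw [h.cross_inner, tri_self12]; simp
        simp only [Fin.zero_eta, add_zero, h0, map_zero, LinearMap.zero_apply]
        fin_cases t <;> simp [phiTbl]
      all_goals
        intro t
        simp only [Fin.mk_one, Fin.reduceFinMk, c1, c2, c3, c4, c5, c6, map_neg,
          LinearMap.neg_apply, hf.ortho, add_right_inj]
        fin_cases t <;> simp [phiTbl]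
    exact key s t

lemma exists_unit_orthogonal (h : IsONBasis g e) [FiniteDimensional ℝ V]
    (hV : Module.finrank ℝ V = 7) (a b c : V) :
    ∃ v, g v v = 1 ∧ g a v = 0 ∧ g b v = 0 ∧ g c v = 0 := by
  let L : V →ₗ[ℝ] (Fin 3 → ℝ) := LinearMap.pi ![g a, g b, g c]
  have hker : LinearMap.ker L ≠ ⊥ := LinearMap.ker_ne_bot_of_finrank_lt (by simp [hV])
  obtain ⟨v, hv, hv0⟩ := (Submodule.ne_bot_iff _).1 hker
  have hv' : L v = 0 := hv
  have hpos : 0 < g v v := lt_of_le_of_ne (h.self_nonneg v) fun h0 => hv0 (h.eq_zero_of_self h0.symm)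
  have h0 := congrFun hv' 0
  have h1 := congrFun hv' 1
  have h2 := congrFun hv' 2
  simp only [L, LinearMap.pi_apply, Matrix.cons_val_zero, Matrix.cons_val_one, Matrix.cons_val,
    Pi.zero_apply] at h0 h1 h2
  refine ⟨(Real.sqrt (g v v))⁻¹ • v, ?_, ?_, ?_, ?_⟩
  · simp only [map_smul, LinearMap.smul_apply, smul_eq_mul]
    rw [← mul_assoc, ← mul_inv, Real.mul_self_sqrt hpos.le, inv_mul_cancel₀ hpos.ne']
  all_goals simp [h0, h1, h2]

/-- Every unit vector is the first vector of a Cayley frame. -/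
theorem IsG2Basis.exists_adapted (h : IsG2Basis g φ e) [FiniteDimensional ℝ V]
    (hV : Module.finrank ℝ V = 7) {a : V} (ha : g a a = 1) :
    ∃ f, IsG2Basis g φ f ∧ f 0 = a := by
  -- A basic triple as for the octonions: `b ⊥ a`, then `c ⊥ a, b, a × b`. The other four frame
  -- vectors are products of these three.
  obtain ⟨b, hb, hab, -, -⟩ := exists_unit_orthogonal h.toIsONBasis hV a a a
  obtain ⟨c, hc, hac, hbc, habc⟩ := exists_unit_orthogonal h.toIsONBasis hV a b (crossL φ e a b)
  have tabc : tri φ a b c = 0 := by rw [← h.cross_inner, habc]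
  have tbca : tri φ b c a = 0 := by rw [← tri_rot, tabc]
  have tcab : tri φ c a b = 0 := by rw [tri_rot, tabc]
  have hba : g b a = 0 := by rw [h.symm, hab]
  have hca : g c a = 0 := by rw [h.symm, hac]
  have hcb : g c b = 0 := by rw [h.symm, hbc]
  have hca' := h.cross_swap a c
  -- The two rewritings of `c × (a × b)` put `a` or `b` in front, so that orthogonality to either
  -- vector becomes a repeated argument in `φ`.
  have e5a : crossL φ e c (crossL φ e a b) = crossL φ e a (crossL φ e b c) := by
    rw [h.cross_cross_anticomm hca hcb hab, h.cross_swap c b, map_neg, neg_neg]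
  have e5b : crossL φ e c (crossL φ e a b) = -crossL φ e b (crossL φ e a c) := by
    rw [e5a, h.cross_cross_anticomm hab hac hbc]
  have n3 : g (crossL φ e a b) (crossL φ e a b) = 1 := by
    rw [h.inner_cross_cross, ha, hb, hab, hba]; ring
  have n4 : g (crossL φ e b c) (crossL φ e b c) = 1 := by
    rw [h.inner_cross_cross, hb, hc, hbc, hcb]; ring
  have n6 : g (crossL φ e a c) (crossL φ e a c) = 1 := by
    rw [h.inner_cross_cross, ha, hc, hac, hca]; ring
  have c_ab : g c (crossL φ e a b) = 0 := by rw [h.symm, habc]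
  have n5 : g (crossL φ e c (crossL φ e a b)) (crossL φ e c (crossL φ e a b)) = 1 := by
    rw [h.inner_cross_cross, hc, n3, c_ab, habc]; ring
  have a3 : g (crossL φ e a b) a = 0 := by rw [h.cross_inner, tri_self13]
  have b3 : g (crossL φ e a b) b = 0 := by rw [h.cross_inner, tri_self23]
  have a4 : g (crossL φ e b c) a = 0 := by rw [h.cross_inner, tbca]
  have b4 : g (crossL φ e b c) b = 0 := by rw [h.cross_inner, tri_self13]
  have c4 : g (crossL φ e b c) c = 0 := by rw [h.cross_inner, tri_self23]
  have a6 : g (crossL φ e a c) a = 0 := by rw [h.cross_inner, tri_self13]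
  have b6 : g (crossL φ e a c) b = 0 := by rw [h.cross_inner, tri_swap23, tabc, neg_zero]
  have c6 : g (crossL φ e a c) c = 0 := by rw [h.cross_inner, tri_self23]
  have a5 : g (crossL φ e c (crossL φ e a b)) a = 0 := by rw [e5a, h.cross_inner, tri_self13]
  have b5 : g (crossL φ e c (crossL φ e a b)) b = 0 := by
    rw [e5b, map_neg, LinearMap.neg_apply, h.cross_inner, tri_self13, neg_zero]
  have c5 : g (crossL φ e c (crossL φ e a b)) c = 0 := by rw [h.cross_inner, tri_self13]
  have h34 : g (crossL φ e a b) (crossL φ e b c) = 0 := by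
    rw [h.cross_swap a b, map_neg, LinearMap.neg_apply, h.inner_cross_cross, hb, hac, hbc, hab]
    ring
  have h36 : g (crossL φ e a b) (crossL φ e a c) = 0 := by
    rw [h.inner_cross_cross, ha, hbc, hac]; ring
  have h46 : g (crossL φ e b c) (crossL φ e a c) = 0 := by
    rw [h.cross_swap a c, h.cross_swap b c, map_neg, map_neg, LinearMap.neg_apply, neg_neg,
      h.inner_cross_cross, hba, hca]; ring
  have h53 : g (crossL φ e c (crossL φ e a b)) (crossL φ e a b) = 0 := by
    rw [h.cross_inner, tri_self23]
  have h54 : g (crossL φ e c (crossL φ e a b)) (crossL φ e b c) = 0 := by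
    rw [e5a, h.cross_inner, tri_self23]
  have h56 : g (crossL φ e c (crossL φ e a b)) (crossL φ e a c) = 0 := by
    rw [e5b, map_neg, LinearMap.neg_apply, h.cross_inner, tri_self23, neg_zero]
  have l3 : tri φ (crossL φ e a b) (crossL φ e b c) (crossL φ e a c) = 1 := by
    have h1 : crossL φ e (crossL φ e b c) (crossL φ e c a) =
        -crossL φ e c (crossL φ e (crossL φ e b c) a) :=
      h.cross_cross_anticomm c4 a4 hca
    have h2 : crossL φ e (crossL φ e b c) a = -crossL φ e c (crossL φ e a b) := by
      rw [h.cross_swap, e5a]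
    rw [tri_rot, ← h.cross_inner, h.cross_swap a c, map_neg, h1, h2]
    simp only [map_neg, neg_neg, LinearMap.neg_apply, h.cross_cross_self, hc, c_ab]
    simp [n3]
  let f : Fin 7 → V := ![a, b, c, crossL φ e a b, crossL φ e b c, crossL φ e c (crossL φ e a b),
    crossL φ e a c]
  have hfo : IsOrthonormalFrame (fun x y => g x y) f := by
    intro i j
    have hsymm : ∀ i j : Fin 7, i < j → g (f j) (f i) = 0 := by
      intro i j hij
      fin_cases i <;> fin_cases j <;> first
        | exact absurd hij (by decide)
        | (simp only [f, Fin.zero_eta, Fin.mk_one, Fin.reduceFinMk, Matrix.cons_val_zero,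
            Matrix.cons_val_one, Matrix.cons_val]
           first | assumption | (rw [h.symm]; assumption))
    rcases lt_trichotomy i j with hij | rfl | hij
    · rw [if_neg hij.ne]
      exact (h.symm _ _).trans (hsymm i j hij)
    · rw [if_pos rfl]
      fin_cases i <;> simp only [f, Fin.zero_eta, Fin.mk_one, Fin.reduceFinMk, Matrix.cons_val_zero,
            Matrix.cons_val_one, Matrix.cons_val] <;> assumption
    · rw [if_neg hij.ne']
      exact hsymm j i hij
  refine ⟨f, h.of_lines (IsONBasis.of_frame hV h.symm hfo) fun i => ?_, rfl⟩
  have l0 : tri φ a b (crossL φ e a b) = 1 := by rw [← h.cross_inner, n3]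
  have l1 : tri φ b c (crossL φ e b c) = 1 := by rw [← h.cross_inner, n4]
  have l2 : tri φ c (crossL φ e a b) (crossL φ e c (crossL φ e a b)) = 1 := by
    rw [← h.cross_inner, n5]
  have l4 : tri φ (crossL φ e b c) (crossL φ e c (crossL φ e a b)) a = 1 := by
    rw [tri_rot, tri_rot, ← h.cross_inner, ← e5a, n5]
  have l5 : tri φ (crossL φ e c (crossL φ e a b)) (crossL φ e a c) b = 1 := by
    have h1 : crossL φ e b (crossL φ e a c) = -crossL φ e c (crossL φ e a b) := by
      rw [e5b, neg_neg]
    rw [tri_rot, tri_swap12, ← h.cross_inner, h1, map_neg, LinearMap.neg_apply, n5, neg_neg]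
  have l6 : tri φ (crossL φ e a c) a c = 1 := by
    rw [tri_rot, ← h.cross_inner, n6]
  fin_cases i <;> assumption

end Seven

end G2Hyp
end

/-! ### `SU(3)` linear algebra: `T* ⊗ u(3)^⊥` as the space of bilinear forms. -/

noncomputable section

namespace G2Hyp

section SU3Algebra

variable {V : Type*} [AddCommGroup V] [Module ℝ V]

/-- An orthonormal basis of a six-dimensional space together with a compatible complex structure
`J` and the real part `ρ` of a complex volume form. -/
structure IsSU3Basis (g : V →ₗ[ℝ] V →ₗ[ℝ] ℝ) (J : V →ₗ[ℝ] V) (ρ : V →ₗ[ℝ] V →ₗ[ℝ] V →ₗ[ℝ] ℝ)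
    (f : Fin 6 → V) : Prop extends IsONBasis g f where
  J_sq : ∀ x, J (J x) = -x
  J_skew : ∀ x y, g (J x) y = -g x (J y)
  swap12 : ∀ x y z, ρ x y z = -ρ y x z
  swap23 : ∀ x y z, ρ x y z = -ρ x z y
  rho_J : ∀ x y z, ρ (J x) y z = ρ x (J y) z
  contract : ∀ y z u v, ∑ d, ρ (f d) y z * ρ (f d) u v =
    g y u * g z v - g y v * g z u - g y (J u) * g z (J v) + g y (J v) * g z (J u)

namespace IsSU3Basis

variable {g : V →ₗ[ℝ] V →ₗ[ℝ] ℝ} {J : V →ₗ[ℝ] V} {ρ : V →ₗ[ℝ] V →ₗ[ℝ] V →ₗ[ℝ] ℝ}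
  {f : Fin 6 → V}

lemma J_isometry (h : IsSU3Basis g J ρ f) (x y : V) : g (J x) (J y) = g x y := by
  rw [h.J_skew, h.J_sq, map_neg, neg_neg]

lemma inner_J_self (h : IsSU3Basis g J ρ f) (x : V) : g x (J x) = 0 := by
  have := h.J_skew x x
  rw [h.symm] at this
  linarith

lemma rho_self (h : IsSU3Basis g J ρ f) (x z : V) : ρ x x z = 0 := by linarith [h.swap12 x x z]

lemma rot (h : IsSU3Basis g J ρ f) (x y z : V) : ρ x y z = ρ y z x := by
  rw [h.swap12, h.swap23, neg_neg]

lemma rho_J' (h : IsSU3Basis g J ρ f) (x y z : V) : ρ x (J y) z = ρ x y (J z) := by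
  rw [h.rot, h.rho_J, ← h.rot]

lemma rho_J_self (h : IsSU3Basis g J ρ f) (x z : V) : ρ (J x) x z = 0 := by
  have h1 := h.rho_J x x z
  have h2 := h.swap12 (J x) x z
  linarith

lemma rho_J_J (h : IsSU3Basis g J ρ f) (x y z : V) : ρ x (J y) (J z) = -ρ x y z := by
  rw [h.rho_J', h.J_sq, map_neg]

lemma sum_inner_mul (h : IsSU3Basis g J ρ f) (F : V →ₗ[ℝ] ℝ) (x : V) :
    ∑ d, g x (f d) * F (f d) = F x := by
  rw [h.apply_eq_sum F x]
  exact Finset.sum_congr rfl fun d _ => by rw [h.symm]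

lemma sum_inner_J_mul (h : IsSU3Basis g J ρ f) (F : V →ₗ[ℝ] ℝ) (x : V) :
    ∑ d, g x (J (f d)) * F (f d) = -F (J x) := by
  rw [← h.sum_inner_mul F (J x), ← Finset.sum_neg_distrib]
  exact Finset.sum_congr rfl fun d _ => by rw [h.J_skew]; ring

/-- `J` is skew-adjoint, so it changes sign when it passes to the other argument under a trace. -/
lemma sum_J (h : IsSU3Basis g J ρ f) (β : V →ₗ[ℝ] V →ₗ[ℝ] ℝ) :
    ∑ i, β (J (f i)) (f i) = -∑ i, β (f i) (J (f i)) := by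
  have h1 : ∀ i, β (J (f i)) (f i) = ∑ k, g (J (f i)) (f k) * β (f k) (f i) := fun i =>
    (h.sum_inner_mul (β.flip (f i)) (J (f i))).symm
  simp only [h1]
  rw [Finset.sum_comm, ← Finset.sum_neg_distrib]
  refine Finset.sum_congr rfl fun k _ => ?_
  rw [← h.sum_inner_mul (β (f k)) (J (f k)), ← Finset.sum_neg_distrib]
  exact Finset.sum_congr rfl fun i _ => by rw [h.J_skew, h.symm]; ring

lemma sum_J_J (h : IsSU3Basis g J ρ f) (β : V →ₗ[ℝ] V →ₗ[ℝ] ℝ) :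
    ∑ i, β (J (f i)) (J (f i)) = ∑ i, β (f i) (f i) := by
  have := h.sum_J (β.compl₂ J)
  simp only [LinearMap.compl₂_apply, h.J_sq, map_neg, Finset.sum_neg_distrib, neg_neg] at this
  exact this

/-- Contraction of two copies of `ρ` in the last argument. -/
lemma contract3 (h : IsSU3Basis g J ρ f) (y z u v : V) : ∑ d, ρ y z (f d) * ρ u v (f d) =
    g y u * g z v - g y v * g z u - g y (J u) * g z (J v) + g y (J v) * g z (J u) := by
  rw [← h.contract]
  exact Finset.sum_congr rfl fun d _ => by rw [h.rot (f d), h.rot (f d)]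

lemma sum_inner_self (h : IsSU3Basis g J ρ f) : ∑ i, g (f i) (f i) = 6 := by
  simp [h.ortho]

/-- Tracing `contract3` gives `6 - 1 - 1 = 4`, the constant that the factor `1 / 4` in `rForm`
compensates. -/
lemma contract23 (h : IsSU3Basis g J ρ f) (x y : V) :
    ∑ i, ∑ j, ρ x (f i) (f j) * ρ y (f i) (f j) = 4 * g x y := by
  simp only [h.contract3]
  have h1 := h.sum_inner_mul (g y) x
  have h2 := h.sum_inner_J_mul (g (J y)) x
  rw [h.J_isometry] at h2
  have e : ∀ i, g x y * g (f i) (f i) - g x (f i) * g (f i) y - g x (J y) * g (f i) (J (f i)) +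
      g x (J (f i)) * g (f i) (J y) =
      g x y * g (f i) (f i) - g x (f i) * g y (f i) + g x (J (f i)) * g (J y) (f i) := by
    intro i
    rw [h.inner_J_self, h.symm (f i) y, h.symm (f i) (J y)]
    ring
  simp only [e, Finset.sum_add_distrib, Finset.sum_sub_distrib, ← Finset.mul_sum,
    h.sum_inner_self, h1]
  rw [h2, h.symm y x]
  have h3 : g (J y) (J x) = g x y := by rw [h.J_isometry, h.symm]
  linarith

/-- The bilinear form `R` with `R (α) (x, y) = ½ ⟨x ⌟ α, y ⌟ ρ⟩`. -/
def rForm (ρ : V →ₗ[ℝ] V →ₗ[ℝ] V →ₗ[ℝ] ℝ) (f : Fin 6 → V) (α : V →ₗ[ℝ] V →ₗ[ℝ] V →ₗ[ℝ] ℝ) :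
    V →ₗ[ℝ] V →ₗ[ℝ] ℝ :=
  LinearMap.mk₂ ℝ (fun x y => (1 / 4) * ∑ i, ∑ j, α x (f i) (f j) * ρ y (f i) (f j))
    (fun x x' y => by
      simp only [map_add, LinearMap.add_apply, add_mul, Finset.sum_add_distrib]; ring)
    (fun c x y => by
      simp only [map_smul, LinearMap.smul_apply, smul_eq_mul, mul_assoc, ← Finset.mul_sum]; ring)
    (fun x y y' => by
      simp only [map_add, LinearMap.add_apply, mul_add, Finset.sum_add_distrib])
    (fun c x y => by
      simp only [map_smul, LinearMap.smul_apply, smul_eq_mul, mul_left_comm _ c, ← Finset.mul_sum])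

/-- The tensor in `T* ⊗ u(3)^⊥` with a given image under `rForm`. -/
def ofForm (ρ : V →ₗ[ℝ] V →ₗ[ℝ] V →ₗ[ℝ] ℝ) (f : Fin 6 → V) (b : V →ₗ[ℝ] V →ₗ[ℝ] ℝ) :
    V →ₗ[ℝ] V →ₗ[ℝ] V →ₗ[ℝ] ℝ :=
  ∑ d, (b.flip (f d)).smulRight (ρ (f d))

lemma rForm_apply (α : V →ₗ[ℝ] V →ₗ[ℝ] V →ₗ[ℝ] ℝ) (x y : V) : rForm ρ f α x y =
    (1 / 4) * ∑ i, ∑ j, α x (f i) (f j) * ρ y (f i) (f j) := rfl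

lemma ofForm_apply (b : V →ₗ[ℝ] V →ₗ[ℝ] ℝ) (x y z : V) :
    ofForm ρ f b x y z = ∑ d, b x (f d) * ρ (f d) y z := by
  simp [ofForm]

lemma rForm_ofForm (h : IsSU3Basis g J ρ f) (b : V →ₗ[ℝ] V →ₗ[ℝ] ℝ) (x y : V) :
    rForm ρ f (ofForm ρ f b) x y = b x y := by
  simp only [rForm_apply, ofForm_apply, Finset.sum_mul]
  have h1 : ∑ i, ∑ j, ∑ d, b x (f d) * ρ (f d) (f i) (f j) * ρ y (f i) (f j) =
      ∑ d, b x (f d) * (4 * g (f d) y) := by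
    simp only [← h.contract23, Finset.mul_sum, ← mul_assoc]
    rw [Finset.sum_comm' (t' := Finset.univ) (s' := fun _ => Finset.univ) (by simp)]
    conv_lhs => enter [2, j]; rw [Finset.sum_comm]
    rw [Finset.sum_comm]
    exact Finset.sum_congr rfl fun d _ => Finset.sum_comm
  rw [h1, ← h.sum_inner_mul (b x) y, Finset.mul_sum]
  exact Finset.sum_congr rfl fun d _ => by rw [h.symm]; ring

/-- Two copies of `ρ` contracted in one slot give, up to the factor 4, the projection of two-forms
to those that change sign under `J`. Such forms are fixed by it, so on `hermTensors` the two maps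
are mutually inverse. -/
lemma ofForm_rForm (h : IsSU3Basis g J ρ f) {α : V →ₗ[ℝ] V →ₗ[ℝ] V →ₗ[ℝ] ℝ}
    (hα : α ∈ hermTensors J) : ofForm ρ f (rForm ρ f α) = α := by
  ext x y z
  obtain ⟨hs, hJ⟩ := hα
  simp only [ofForm_apply, rForm_apply]
  have h1 : ∀ i j, ∑ d, ρ (f d) (f i) (f j) * ρ (f d) y z =
      g y (f i) * g z (f j) - g z (f i) * g y (f j) - g (J y) (f i) * g (J z) (f j) +
        g (J z) (f i) * g (J y) (f j) := by
    intro i j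
    rw [h.contract, h.symm (f i), h.symm (f j), h.symm (f i), h.symm (f j), h.symm (f i),
      h.symm (f j), h.symm (f i), h.symm (f j)]
  have h2 : ∀ u v : V, ∑ i, ∑ j, α x (f i) (f j) * (g u (f i) * g v (f j)) = α x u v := by
    intro u v
    refine Eq.trans ?_ (h.sum_inner_mul ((α x).flip v) u)
    refine Finset.sum_congr rfl fun i _ => ?_
    rw [LinearMap.flip_apply, ← h.sum_inner_mul (α x (f i)) v, Finset.mul_sum]
    exact Finset.sum_congr rfl fun j _ => by ring
  calc ∑ d, 1 / 4 * (∑ i, ∑ j, α x (f i) (f j) * ρ (f d) (f i) (f j)) * ρ (f d) y z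
      = 1 / 4 * ∑ i, ∑ j, α x (f i) (f j) * ∑ d, ρ (f d) (f i) (f j) * ρ (f d) y z := by
        simp only [mul_assoc, ← Finset.mul_sum, Finset.sum_mul]
        congr 1
        simp only [Finset.mul_sum]
        rw [Finset.sum_comm]
        refine Finset.sum_congr rfl fun i _ => ?_
        rw [Finset.sum_comm]
    _ = 1 / 4 * (α x y z - α x z y - α x (J y) (J z) + α x (J z) (J y)) := by
        simp only [h1, mul_add, mul_sub, Finset.sum_add_distrib, Finset.sum_sub_distrib, h2]
    _ = α x y z := by
        rw [hs x z y, hJ x y z, hJ x z y, hs x z y]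
        ring

lemma ofForm_mem_herm (h : IsSU3Basis g J ρ f) (b : V →ₗ[ℝ] V →ₗ[ℝ] ℝ) :
    ofForm ρ f b ∈ hermTensors J := by
  refine ⟨fun x y z => ?_, fun x y z => ?_⟩
  · simp only [ofForm_apply, ← Finset.sum_neg_distrib]
    exact Finset.sum_congr rfl fun d _ => by rw [h.swap23]; ring
  · simp only [ofForm_apply, ← Finset.sum_neg_distrib]
    exact Finset.sum_congr rfl fun d _ => by rw [h.rho_J_J]; ring

/-- `rho_J` moves `J` from `y` to the summation index, and `sum_J` moves it on to `b` at the price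
of a sign. -/
lemma ofForm_J_J (h : IsSU3Basis g J ρ f) {b : V →ₗ[ℝ] V →ₗ[ℝ] ℝ} {t : ℝ}
    (hb : ∀ x y, b (J x) (J y) = t * b x y) (x y z : V) :
    ofForm ρ f b (J x) (J y) z = -t * ofForm ρ f b x y z := by
  simp only [ofForm_apply]
  have h1 := h.sum_J (LinearMap.mk₂ ℝ (fun u v => b (J x) v * ρ u y z)
    (by intros; simp; ring) (by intros; simp; ring) (by intros; simp; ring)
    (by intros; simp; ring))
  simp only [LinearMap.mk₂_apply, h.rho_J, hb] at h1
  rw [h1, Finset.mul_sum, ← Finset.sum_neg_distrib]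
  exact Finset.sum_congr rfl fun d _ => by ring

lemma rForm_J_J (h : IsSU3Basis g J ρ f) {α : V →ₗ[ℝ] V →ₗ[ℝ] V →ₗ[ℝ] ℝ} {t : ℝ}
    (hα : ∀ x y z, α (J x) (J y) z = t * α x y z) (x y : V) :
    rForm ρ f α (J x) (J y) = -t * rForm ρ f α x y := by
  simp only [rForm_apply, h.rho_J]
  have h1 := h.sum_J (LinearMap.mk₂ ℝ (fun u v => ∑ j, α (J x) v (f j) * ρ y u (f j))
    (by intros; simp [mul_add, Finset.sum_add_distrib])
    (by intros; simp [Finset.mul_sum, mul_left_comm])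
    (by intros; simp [add_mul, Finset.sum_add_distrib])
    (by intros; simp [Finset.mul_sum, mul_assoc]))
  simp only [LinearMap.mk₂_apply, hα] at h1
  rw [h1]
  simp only [mul_assoc, ← Finset.mul_sum]
  ring

end IsSU3Basis

end SU3Algebra

end G2Hyp
end

/-! ### The modules `W₁` and `W₂` as `J`-invariant bilinear forms. -/

noncomputable section

namespace G2Hyp

section SU3Algebra

variable {V : Type*} [AddCommGroup V] [Module ℝ V]

namespace IsSU3Basis

variable {g : V →ₗ[ℝ] V →ₗ[ℝ] ℝ} {J : V →ₗ[ℝ] V} {ρ : V →ₗ[ℝ] V →ₗ[ℝ] V →ₗ[ℝ] ℝ}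
  {f : Fin 6 → V}

/-- The contraction identity is first proved in a frame adapted to the normal; it is needed in the
frame `onFrame` that the definitions use. -/
lemma of_basis (h : IsSU3Basis g J ρ f) {f' : Fin 6 → V} (hf : IsONBasis g f') :
    IsSU3Basis g J ρ f' where
  toIsONBasis := hf
  J_sq := h.J_sq
  J_skew := h.J_skew
  swap12 := h.swap12
  swap23 := h.swap23
  rho_J := h.rho_J
  contract y z u v := by
    rw [← h.contract]
    have := hf.contract_eq h.toIsONBasis (LinearMap.mk₂ ℝ (fun a b => ρ a y z * ρ b u v)
      (by intros; simp; ring) (by intros; simp; ring) (by intros; simp; ring)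
      (by intros; simp; ring))
    simpa only [LinearMap.mk₂_apply] using this

/-- The two traces of a bilinear form. -/
def trace (f : Fin 6 → V) (b : V →ₗ[ℝ] V →ₗ[ℝ] ℝ) : ℝ := ∑ i, b (f i) (f i)

def traceJ (J : V →ₗ[ℝ] V) (f : Fin 6 → V) (b : V →ₗ[ℝ] V →ₗ[ℝ] ℝ) : ℝ :=
  ∑ i, b (f i) (J (f i))

lemma herm_apply (h : IsSU3Basis g J ρ f) {α : V →ₗ[ℝ] V →ₗ[ℝ] V →ₗ[ℝ] ℝ}
    (hα : α ∈ hermTensors J) (x y z : V) :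
    α x y z = ∑ d, rForm ρ f α x (f d) * ρ (f d) y z := by
  rw [← ofForm_apply, h.ofForm_rForm hα]

/-- This is the contraction of `rForm` with the first two arguments of `α` interchanged; on totally
skew tensors comparing the two determines `rForm` from its traces. -/
lemma contract_swap (h : IsSU3Basis g J ρ f) {α : V →ₗ[ℝ] V →ₗ[ℝ] V →ₗ[ℝ] ℝ}
    (hα : α ∈ hermTensors J) (x u : V) :
    ∑ i, ∑ j, α (f i) x (f j) * ρ u (f i) (f j) =
      rForm ρ f α x u + rForm ρ f α (J x) (J u) - trace f (rForm ρ f α) * g x u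
        + traceJ J f (rForm ρ f α) * g x (J u) := by
  simp only [h.herm_apply hα (f _) x]
  generalize rForm ρ f α = b
  have h1 : ∀ i, ∑ j, (∑ d, b (f i) (f d) * ρ (f d) x (f j)) * ρ u (f i) (f j) =
      g x (f i) * b (f i) u - b (f i) (f i) * g x u - g x (J (f i)) * b (f i) (J u)
        + b (f i) (J (f i)) * g x (J u) := by
    intro i
    have h2 : ∑ j, (∑ d, b (f i) (f d) * ρ (f d) x (f j)) * ρ u (f i) (f j) =
        ∑ d, b (f i) (f d) * ∑ j, ρ (f d) x (f j) * ρ u (f i) (f j) := by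
      simp only [Finset.sum_mul, Finset.mul_sum, mul_assoc]
      exact Finset.sum_comm
    rw [h2]
    simp only [h.contract3]
    rw [h.apply_eq_sum (b (f i)) u, h.apply_eq_sum (b (f i)) (f i),
      h.apply_eq_sum (b (f i)) (J u), h.apply_eq_sum (b (f i)) (J (f i))]
    simp only [Finset.mul_sum, Finset.sum_mul, ← Finset.sum_sub_distrib, ← Finset.sum_add_distrib]
    exact Finset.sum_congr rfl fun d _ => by ring
  simp only [h1, Finset.sum_add_distrib, Finset.sum_sub_distrib, ← Finset.sum_mul]
  have h3 := h.sum_inner_mul (b.flip u) x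
  have h4 := h.sum_inner_J_mul (b.flip (J u)) x
  simp only [LinearMap.flip_apply] at h3 h4
  rw [h3, h4]
  simp only [trace, traceJ]
  ring

/-- This expresses the trace of `α` through the skew anti-invariant part of its bilinear form, which
separates `W₃` from `W₄`. -/
lemma contract_trace (h : IsSU3Basis g J ρ f) {α : V →ₗ[ℝ] V →ₗ[ℝ] V →ₗ[ℝ] ℝ}
    (hα : α ∈ hermTensors J) (u v : V) :
    ∑ k, ρ u v (f k) * ∑ i, α (f i) (f i) (f k) =
      rForm ρ f α v u - rForm ρ f α u v - rForm ρ f α (J v) (J u) + rForm ρ f α (J u) (J v) := by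
  simp only [h.herm_apply hα (f _) (f _)]
  generalize rForm ρ f α = b
  have h0 : ∑ k, ρ u v (f k) * ∑ i, ∑ d, b (f i) (f d) * ρ (f d) (f i) (f k) =
      ∑ i, ∑ d, b (f i) (f d) * ∑ k, ρ u v (f k) * ρ (f d) (f i) (f k) := by
    simp only [Finset.mul_sum]
    rw [Finset.sum_comm]
    refine Finset.sum_congr rfl fun i _ => ?_
    rw [Finset.sum_comm]
    exact Finset.sum_congr rfl fun d _ => Finset.sum_congr rfl fun k _ => by ring
  rw [h0]
  have h1 : ∀ i, ∑ d, b (f i) (f d) * ∑ k, ρ u v (f k) * ρ (f d) (f i) (f k) =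
      g v (f i) * b (f i) u - g u (f i) * b (f i) v + g v (J (f i)) * b (f i) (J u)
        - g u (J (f i)) * b (f i) (J v) := by
    intro i
    simp only [h.contract3]
    rw [h.apply_eq_sum (b (f i)) u, h.apply_eq_sum (b (f i)) v,
      h.apply_eq_sum (b (f i)) (J u), h.apply_eq_sum (b (f i)) (J v)]
    simp only [Finset.mul_sum, ← Finset.sum_sub_distrib, ← Finset.sum_add_distrib]
    refine Finset.sum_congr rfl fun d _ => ?_
    have e1 : g u (J (f d)) = -g (f d) (J u) := by rw [← h.J_skew, h.symm]
    have e2 : g v (J (f d)) = -g (f d) (J v) := by rw [← h.J_skew, h.symm]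
    rw [e1, e2, h.symm u (f d), h.symm v (f d)]
    ring
  simp only [h1, Finset.sum_add_distrib, Finset.sum_sub_distrib]
  have h2 := h.sum_inner_mul (b.flip u) v
  have h3 := h.sum_inner_mul (b.flip v) u
  have h4 := h.sum_inner_J_mul (b.flip (J u)) v
  have h5 := h.sum_inner_J_mul (b.flip (J v)) u
  simp only [LinearMap.flip_apply] at h2 h3 h4 h5
  rw [h2, h3, h4, h5]
  ring

lemma rForm_eq_zero (h : IsSU3Basis g J ρ f) {α : V →ₗ[ℝ] V →ₗ[ℝ] V →ₗ[ℝ] ℝ}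
    (hα : α ∈ hermTensors J) (h0 : ∀ x y, rForm ρ f α x y = 0) : α = 0 := by
  ext x y z
  simp [h.herm_apply hα, h0]

/-- The image of a totally skew tensor is a combination of `g` and `g (·, J ·)`. -/
lemma rForm_W1 (h : IsSU3Basis g J ρ f) {α : V →ₗ[ℝ] V →ₗ[ℝ] V →ₗ[ℝ] ℝ}
    (hα : α ∈ W1 J) (x u : V) : rForm ρ f α x u =
      (trace f (rForm ρ f α) * g x u - traceJ J f (rForm ρ f α) * g x (J u)) / 6 := by
  obtain ⟨hα, hs⟩ := hα
  have sk : ∀ x y z, α x y z = -α y x z := by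
    intro x y z
    have := hs (x + y) z
    simp only [map_add, LinearMap.add_apply, hs] at this
    linarith
  have hJ : ∀ x y z, α (J x) (J y) z = -1 * α x y z := by
    intro x y z
    rw [hα.1, sk, hα.1 z, hα.2, sk x, hα.1 y x, sk y z, hα.1 z y x]
    ring
  have h1 := h.contract_swap hα x u
  -- With `b = rForm ρ f α`, which is `J`-invariant here, `contract_swap` reads `-4b = b + b -
  -- (trace terms)`; hence the 6.
  have h2 : ∑ i, ∑ j, α (f i) x (f j) * ρ u (f i) (f j) = -(4 * rForm ρ f α x u) := by
    rw [rForm_apply, ← mul_assoc]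
    norm_num
    simp only [← Finset.sum_neg_distrib]
    exact Finset.sum_congr rfl fun i _ => Finset.sum_congr rfl fun j _ => by
      rw [sk, neg_mul]
  have h3 := h.rForm_J_J hJ x u
  rw [h2, h3] at h1
  linarith

/-- The cyclic identity at `(x, Jy, Jz)` and its permutations, with the Hermitian symmetries, is a
linear system that forces this. -/
lemma W2_J_J {α : V →ₗ[ℝ] V →ₗ[ℝ] V →ₗ[ℝ] ℝ} (h : IsSU3Basis g J ρ f)
    (hα : α ∈ W2 J) (x y z : V) : α (J x) (J y) z = -1 * α x y z := by
  obtain ⟨⟨hs, hJ⟩, hc⟩ := hα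
  have hD : ∀ x y z, α (J x) (J y) z = -α (J x) (J z) y := by
    intro x y z
    have h1 := hJ (J x) y (J z)
    rw [h.J_sq, map_neg] at h1
    rw [hs (J x) (J z) y]
    linarith
  have hd : ∀ x y z, α (J y) (J z) x - α (J z) (J y) x = α x y z := by
    intro x y z
    have h1 := hc x (J y) (J z)
    rw [hJ, hs (J z) x] at h1
    linarith
  have a1 := hd z x y
  have a2 := hd y z x
  have a3 := hd x y z
  have b1 := hD x y z
  have b2 := hD y x z
  have b3 := hD z x y
  have c := hc x y z
  linarith

lemma sum_rot (F : Fin 6 → Fin 6 → Fin 6 → ℝ) :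
    ∑ x, ∑ i, ∑ j, F i j x = ∑ x, ∑ i, ∑ j, F x i j := by
  rw [Finset.sum_comm]
  exact Finset.sum_congr rfl fun i _ => Finset.sum_comm

/-- Cyclic permutation of the arguments of a trilinear form. -/
def rotT (α : V →ₗ[ℝ] V →ₗ[ℝ] V →ₗ[ℝ] ℝ) : V →ₗ[ℝ] V →ₗ[ℝ] V →ₗ[ℝ] ℝ :=
  LinearMap.mk₂ ℝ (fun x y => (α y).flip x) (by intros; ext; simp) (by intros; ext; simp)
    (by intros; ext; simp) (by intros; ext; simp)

lemma rotT_apply (α : V →ₗ[ℝ] V →ₗ[ℝ] V →ₗ[ℝ] ℝ) (x y z : V) : rotT α x y z = α y z x := rfl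

lemma trace_rForm (α : V →ₗ[ℝ] V →ₗ[ℝ] V →ₗ[ℝ] ℝ) : trace f (rForm ρ f α) =
    (1 / 4) * ∑ x, ∑ i, ∑ j, α (f x) (f i) (f j) * ρ (f x) (f i) (f j) := by
  simp only [trace, rForm_apply, Finset.mul_sum]

lemma traceJ_rForm (α : V →ₗ[ℝ] V →ₗ[ℝ] V →ₗ[ℝ] ℝ) : traceJ J f (rForm ρ f α) =
    (1 / 4) * ∑ x, ∑ i, ∑ j, α (f x) (f i) (f j) * ρ (J (f x)) (f i) (f j) := by
  simp only [traceJ, rForm_apply, Finset.mul_sum]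

lemma trace_rForm_rotT (h : IsSU3Basis g J ρ f) (α : V →ₗ[ℝ] V →ₗ[ℝ] V →ₗ[ℝ] ℝ) :
    trace f (rForm ρ f (rotT α)) = trace f (rForm ρ f α) := by
  rw [trace_rForm, trace_rForm,
    ← sum_rot fun x i j => α (f x) (f i) (f j) * ρ (f x) (f i) (f j)]
  congr 1
  refine Finset.sum_congr rfl fun x _ => Finset.sum_congr rfl fun i _ =>
    Finset.sum_congr rfl fun j _ => ?_
  rw [rotT_apply, h.rot (f x)]

lemma traceJ_rForm_rotT (h : IsSU3Basis g J ρ f) (α : V →ₗ[ℝ] V →ₗ[ℝ] V →ₗ[ℝ] ℝ) :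
    traceJ J f (rForm ρ f (rotT α)) = traceJ J f (rForm ρ f α) := by
  rw [traceJ_rForm, traceJ_rForm,
    ← sum_rot fun x i j => α (f x) (f i) (f j) * ρ (J (f x)) (f i) (f j)]
  congr 1
  refine Finset.sum_congr rfl fun x _ => Finset.sum_congr rfl fun i _ =>
    Finset.sum_congr rfl fun j _ => ?_
  rw [rotT_apply, h.rot (J (f x)), h.rho_J, h.rho_J']

lemma rForm_add (α β : V →ₗ[ℝ] V →ₗ[ℝ] V →ₗ[ℝ] ℝ) (x y : V) :
    rForm ρ f (α + β) x y = rForm ρ f α x y + rForm ρ f β x y := by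
  simp only [rForm_apply, LinearMap.add_apply, add_mul, Finset.sum_add_distrib]
  ring

lemma rForm_zero : rForm ρ f 0 = 0 := by
  ext x y
  simp [rForm_apply]

lemma rForm_smul (c : ℝ) (α : V →ₗ[ℝ] V →ₗ[ℝ] V →ₗ[ℝ] ℝ) (x y : V) :
    rForm ρ f (c • α) x y = c * rForm ρ f α x y := by
  simp only [rForm_apply, LinearMap.smul_apply, smul_eq_mul, mul_assoc, ← Finset.mul_sum]
  ring

lemma trace_cyclic (h : IsSU3Basis g J ρ f) (α : V →ₗ[ℝ] V →ₗ[ℝ] V →ₗ[ℝ] ℝ) :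
    trace f (rForm ρ f (α + rotT α + rotT (rotT α))) = 3 * trace f (rForm ρ f α) := by
  have : trace f (rForm ρ f (α + rotT α + rotT (rotT α))) = trace f (rForm ρ f α)
      + trace f (rForm ρ f (rotT α)) + trace f (rForm ρ f (rotT (rotT α))) := by
    simp only [trace, rForm_add, Finset.sum_add_distrib]
  rw [this, h.trace_rForm_rotT (rotT α), h.trace_rForm_rotT]
  ring

lemma traceJ_cyclic (h : IsSU3Basis g J ρ f) (α : V →ₗ[ℝ] V →ₗ[ℝ] V →ₗ[ℝ] ℝ) :
    traceJ J f (rForm ρ f (α + rotT α + rotT (rotT α))) = 3 * traceJ J f (rForm ρ f α) := by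
  have : traceJ J f (rForm ρ f (α + rotT α + rotT (rotT α))) = traceJ J f (rForm ρ f α)
      + traceJ J f (rForm ρ f (rotT α)) + traceJ J f (rForm ρ f (rotT (rotT α))) := by
    simp only [traceJ, rForm_add, Finset.sum_add_distrib]
  rw [this, h.traceJ_rForm_rotT (rotT α), h.traceJ_rForm_rotT]
  ring

/-- Both traces are full contractions with the cyclically invariant forms `ρ` and `ρ (J ·, ·, ·)`,
so a cyclic sum triples them; here the cyclic sum is zero. -/
lemma traces_W2 (h : IsSU3Basis g J ρ f) {α : V →ₗ[ℝ] V →ₗ[ℝ] V →ₗ[ℝ] ℝ}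
    (hα : α ∈ W2 J) : trace f (rForm ρ f α) = 0 ∧ traceJ J f (rForm ρ f α) = 0 := by
  have h0 : α + rotT α + rotT (rotT α) = 0 := by
    ext x y z
    simpa [rotT_apply] using hα.2 x y z
  have h1 := h.trace_cyclic α
  have h2 := h.traceJ_cyclic α
  rw [h0, rForm_zero] at h1 h2
  simp only [trace, traceJ, LinearMap.zero_apply, Finset.sum_const_zero] at h1 h2 ⊢
  constructor <;> linarith

lemma ofForm_mem_W1 (h : IsSU3Basis g J ρ f) {b : V →ₗ[ℝ] V →ₗ[ℝ] ℝ} {p q : ℝ}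
    (hb : ∀ x y, b x y = p * g x y + q * g x (J y)) : ofForm ρ f b ∈ W1 J := by
  refine ⟨h.ofForm_mem_herm b, fun x z => ?_⟩
  have h1 := h.sum_inner_mul ((ρ.flip x).flip z) x
  have h2 := h.sum_inner_J_mul ((ρ.flip x).flip z) x
  simp only [LinearMap.flip_apply, h.rho_self, h.rho_J_self, neg_zero] at h1 h2
  simp only [ofForm_apply, hb, add_mul, mul_assoc, Finset.sum_add_distrib, ← Finset.mul_sum, h1,
    h2, mul_zero, add_zero]

/-- The cyclic sum of the tensor is totally skew, so its bilinear form is determined by its traces.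
These are three times the vanishing traces of `b`, hence the cyclic sum is zero. -/
lemma ofForm_mem_W2 (h : IsSU3Basis g J ρ f) {b : V →ₗ[ℝ] V →ₗ[ℝ] ℝ}
    (hb : ∀ x y, b (J x) (J y) = b x y) (h1 : trace f b = 0) (h2 : traceJ J f b = 0) :
    ofForm ρ f b ∈ W2 J := by
  have hα := h.ofForm_mem_herm b
  have hr : rForm ρ f (ofForm ρ f b) = b := by ext x y; exact h.rForm_ofForm b x y
  have hJ : ∀ x y z, ofForm ρ f b (J x) (J y) z = -1 * ofForm ρ f b x y z :=
    h.ofForm_J_J (t := 1) (by simpa using hb)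
  set α := ofForm ρ f b with hαdef
  refine ⟨hα, ?_⟩
  have hc : α + rotT α + rotT (rotT α) ∈ W1 J := by
    refine ⟨⟨fun x y z => ?_, fun x y z => ?_⟩, fun x z => ?_⟩
    · simp only [LinearMap.add_apply, rotT_apply]
      rw [hα.1 x y z, hα.1 y z x, hα.1 z x y]
      ring
    · simp only [LinearMap.add_apply, rotT_apply]
      rw [hα.2, hJ, hα.1 (J z) x, hJ, hα.1 z y x]
      ring
    · simp only [LinearMap.add_apply, rotT_apply]
      have h3 := hα.1 z x x
      rw [hα.1 x z x]
      linarith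
  have hz := h.rForm_eq_zero hc.1 (fun x y => by
    rw [h.rForm_W1 hc, h.trace_cyclic, h.traceJ_cyclic, hr, h1, h2]
    ring)
  intro x y z
  have := congrArg (fun β : V →ₗ[ℝ] V →ₗ[ℝ] V →ₗ[ℝ] ℝ => β x y z) hz
  simpa [rotT_apply] using this

end IsSU3Basis

end SU3Algebra

end G2Hyp
end

/-! ### The modules `W₃` and `W₄` as anti-invariant bilinear forms. -/

noncomputable section

namespace G2Hyp

section SU3Algebra

variable {V : Type*} [AddCommGroup V] [Module ℝ V]

lemma IsONBasis.onFrame {n : ℕ} {g : V →ₗ[ℝ] V →ₗ[ℝ] ℝ} {e : Fin n → V} (h : IsONBasis g e) :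
    IsONBasis g (onFrame n fun x y => g x y) := by
  have b : Module.Basis (Fin n) ℝ V := Module.Basis.ofEquivFun
    { toFun := fun v i => g (e i) v
      map_add' := fun x y => by ext; simp
      map_smul' := fun c x => by ext; simp
      invFun := fun c => ∑ i, c i • e i
      left_inv := fun v => (h.expand v).symm
      right_inv := fun c => by ext i; simp [h.ortho] }
  have : FiniteDimensional ℝ V := Module.Finite.of_basis b
  exact IsONBasis.of_frame (by rw [Module.finrank_eq_card_basis b, Fintype.card_fin]) h.symm
    (Classical.epsilon_spec (p := IsOrthonormalFrame fun x y => g x y) ⟨e, h.ortho⟩)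

namespace IsSU3Basis

variable {g : V →ₗ[ℝ] V →ₗ[ℝ] ℝ} {J : V →ₗ[ℝ] V} {ρ : V →ₗ[ℝ] V →ₗ[ℝ] V →ₗ[ℝ] ℝ}
  {f : Fin 6 → V}

lemma tr12_eq (h : IsSU3Basis g J ρ f) (α : V →ₗ[ℝ] V →ₗ[ℝ] V →ₗ[ℝ] ℝ) (z : V) :
    tr12 (fun x y => g x y) α z = ∑ i, α (f i) (f i) z := by
  have := h.toIsONBasis.onFrame.contract_eq h.toIsONBasis
    (LinearMap.mk₂ ℝ (fun x y => α x y z) (by intros; simp) (by intros; simp) (by intros; simp)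
      (by intros; simp))
  simp only [LinearMap.mk₂_apply] at this
  exact this

/-- For an anti-invariant form `b` and zero trace, `contract_trace` reads `0 = 2 (b (y, x) - b (x,
y))`. -/
lemma contract_trace_of_anti (h : IsSU3Basis g J ρ f) {α : V →ₗ[ℝ] V →ₗ[ℝ] V →ₗ[ℝ] ℝ}
    (hα : α ∈ hermTensors J) (hb : ∀ x y, rForm ρ f α (J x) (J y) = -rForm ρ f α x y)
    (h0 : ∀ z, tr12 (fun x y => g x y) α z = 0) (x y : V) :
    rForm ρ f α x y = rForm ρ f α y x := by
  have := h.contract_trace hα x y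
  simp only [h.tr12_eq] at h0
  simp only [h0, mul_zero, Finset.sum_const_zero, hb] at this
  linarith

lemma rForm_W3 (h : IsSU3Basis g J ρ f) {α : V →ₗ[ℝ] V →ₗ[ℝ] V →ₗ[ℝ] ℝ}
    (hα : α ∈ W3 (fun x y => g x y) J) :
    (∀ x y, rForm ρ f α (J x) (J y) = -rForm ρ f α x y) ∧
      ∀ x y, rForm ρ f α x y = rForm ρ f α y x := by
  obtain ⟨hα, hJ, h0⟩ := hα
  have hb : ∀ x y, rForm ρ f α (J x) (J y) = -rForm ρ f α x y := by
    intro x y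
    rw [h.rForm_J_J (t := 1) (fun x y z => by linarith [hJ x y z])]
    ring
  exact ⟨hb, h.contract_trace_of_anti hα hb h0⟩

lemma ofForm_mem_W3 (h : IsSU3Basis g J ρ f) {b : V →ₗ[ℝ] V →ₗ[ℝ] ℝ}
    (hb : ∀ x y, b (J x) (J y) = -b x y) (hs : ∀ x y, b x y = b y x) :
    ofForm ρ f b ∈ W3 (fun x y => g x y) J := by
  refine ⟨h.ofForm_mem_herm b, fun x y z => ?_, fun z => ?_⟩
  · rw [h.ofForm_J_J (t := -1) (by simpa using hb)]
    ring
  · rw [h.tr12_eq]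
    simp only [ofForm_apply]
    have : ∑ i, ∑ d, b (f i) (f d) * ρ (f d) (f i) z =
        -∑ i, ∑ d, b (f i) (f d) * ρ (f d) (f i) z := by
      conv_lhs => rw [Finset.sum_comm]
      simp only [← Finset.sum_neg_distrib]
      refine Finset.sum_congr rfl fun i _ => Finset.sum_congr rfl fun d _ => ?_
      rw [hs, h.swap12]
      ring
    linarith

/-- The tensor in `W₄` with trace `τ`. -/
def ofTrace (g : V →ₗ[ℝ] V →ₗ[ℝ] ℝ) (J : V →ₗ[ℝ] V) (τ : V →ₗ[ℝ] ℝ) :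
    V →ₗ[ℝ] V →ₗ[ℝ] V →ₗ[ℝ] ℝ :=
  LinearMap.mk₂ ℝ (fun x y => (1 / 4 : ℝ) • (g x y • τ - τ y • g x - g x (J y) • (τ ∘ₗ J)
      + τ (J y) • (g x ∘ₗ J)))
    (by intros; ext; simp; ring) (by intros; ext; simp; ring) (by intros; ext; simp; ring)
    (by intros; ext; simp; ring)

lemma ofTrace_apply (τ : V →ₗ[ℝ] ℝ) (x y z : V) : ofTrace g J τ x y z =
    (1 / 4) * (g x y * τ z - g x z * τ y - g x (J y) * τ (J z) + g x (J z) * τ (J y)) := by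
  simp [ofTrace]
  ring

lemma tr12_ofTrace (h : IsSU3Basis g J ρ f) (τ : V →ₗ[ℝ] ℝ) (z : V) :
    tr12 (fun x y => g x y) (ofTrace g J τ) z = τ z := by
  rw [h.tr12_eq]
  simp only [ofTrace_apply, h.inner_J_self]
  have h1 := h.sum_inner_mul τ z
  have h2 := h.sum_inner_mul (τ ∘ₗ J) (J z)
  simp only [LinearMap.comp_apply, h.J_sq, map_neg] at h2
  simp only [h.symm (f _) z, h.symm (f _) (J z), zero_mul, sub_zero]
  rw [← Finset.mul_sum, Finset.sum_add_distrib, Finset.sum_sub_distrib, h1, h2, ← Finset.sum_mul,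
    h.sum_inner_self]
  ring

lemma ofTrace_mem_W4 (h : IsSU3Basis g J ρ f) (τ : V →ₗ[ℝ] ℝ) :
    ofTrace g J τ ∈ W4 (fun x y => g x y) J := by
  refine ⟨⟨fun x y z => ?_, fun x y z => ?_⟩, fun x y z => ?_⟩
  · simp only [ofTrace_apply]
    ring
  · simp only [ofTrace_apply, h.J_sq, map_neg]
    ring
  · simp only [h.tr12_ofTrace, ofTrace_apply]

/-- Each of the four terms inserts `x` or `Jx` into `ρ (x, ·, ·)`, and `ρ (x, x, ·) = ρ (x, Jx, ·) =
0`. -/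
lemma rForm_ofTrace_self (h : IsSU3Basis g J ρ f) (τ : V →ₗ[ℝ] ℝ) (x : V) :
    rForm ρ f (ofTrace g J τ) x x = 0 := by
  have key : ∀ (μ ν : V →ₗ[ℝ] ℝ), (∀ j, ∑ i, μ (f i) * ρ x (f i) (f j) = 0) →
      ∑ i, ∑ j, μ (f i) * ν (f j) * ρ x (f i) (f j) = 0 := by
    intro μ ν hμ
    rw [Finset.sum_comm]
    refine Finset.sum_eq_zero fun j _ => ?_
    have := congrArg (ν (f j) * ·) (hμ j)
    simp only [Finset.mul_sum, mul_zero] at this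
    rw [← this]
    exact Finset.sum_congr rfl fun i _ => by ring
  have hg : ∀ j, ∑ i, g x (f i) * ρ x (f i) (f j) = 0 := by
    intro j
    have := h.sum_inner_mul ((ρ x).flip (f j)) x
    simpa only [LinearMap.flip_apply, h.rho_self] using this
  have hgJ : ∀ j, ∑ i, g x (J (f i)) * ρ x (f i) (f j) = 0 := by
    intro j
    have := h.sum_inner_J_mul ((ρ x).flip (f j)) x
    rw [LinearMap.flip_apply, ← h.rho_J, h.rho_J_self, neg_zero] at this
    simpa only [LinearMap.flip_apply] using this
  have k1 := key (g x) τ hg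
  have k2 := key (g x ∘ₗ J) (τ ∘ₗ J) hgJ
  have swap : ∀ (μ ν : V →ₗ[ℝ] ℝ), ∑ i, ∑ j, μ (f j) * ν (f i) * ρ x (f i) (f j) =
      -∑ i, ∑ j, μ (f i) * ν (f j) * ρ x (f i) (f j) := by
    intro μ ν
    rw [Finset.sum_comm]
    simp only [← Finset.sum_neg_distrib]
    refine Finset.sum_congr rfl fun i _ => Finset.sum_congr rfl fun j _ => ?_
    rw [h.swap23]
    ring
  have k3 := swap (g x) τ
  have k4 := swap (g x ∘ₗ J) (τ ∘ₗ J)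
  simp only [LinearMap.comp_apply] at k2 k4
  rw [k1] at k3
  rw [k2] at k4
  simp only [rForm_apply, ofTrace_apply, mul_assoc, ← Finset.mul_sum, add_mul, sub_mul,
    Finset.sum_add_distrib, Finset.sum_sub_distrib] at k1 k2 k3 k4 ⊢
  rw [k1, k2, k3, k4]
  ring

lemma ofTrace_J_J (h : IsSU3Basis g J ρ f) (τ : V →ₗ[ℝ] ℝ) (x y z : V) :
    ofTrace g J τ (J x) (J y) z = 1 * ofTrace g J τ x y z := by
  simp only [ofTrace_apply, h.J_isometry, h.J_sq, map_neg, h.J_skew x z, h.J_skew x y]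
  ring

lemma rForm_ofTrace (h : IsSU3Basis g J ρ f) (τ : V →ₗ[ℝ] ℝ) :
    (∀ x y, rForm ρ f (ofTrace g J τ) (J x) (J y) = -rForm ρ f (ofTrace g J τ) x y) ∧
      ∀ x y, rForm ρ f (ofTrace g J τ) x y = -rForm ρ f (ofTrace g J τ) y x := by
  refine ⟨fun x y => ?_, fun x y => ?_⟩
  · rw [h.rForm_J_J (h.ofTrace_J_J τ)]
    ring
  · have := h.rForm_ofTrace_self τ (x + y)
    simp only [map_add, LinearMap.add_apply, h.rForm_ofTrace_self] at this
    linarith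

lemma rForm_W4 (h : IsSU3Basis g J ρ f) {α : V →ₗ[ℝ] V →ₗ[ℝ] V →ₗ[ℝ] ℝ}
    (hα : α ∈ W4 (fun x y => g x y) J) :
    (∀ x y, rForm ρ f α (J x) (J y) = -rForm ρ f α x y) ∧
      ∀ x y, rForm ρ f α x y = -rForm ρ f α y x := by
  have : α = ofTrace g J (∑ i, α (f i) (f i)) := by
    ext x y z
    rw [hα.2, ofTrace_apply]
    simp only [h.tr12_eq, LinearMap.sum_apply]
  rw [this]
  exact h.rForm_ofTrace _

/-- Subtracting the `W₄` tensor of equal trace leaves a traceless tensor whose form is skew and, by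
`contract_trace_of_anti`, symmetric. It vanishes, so the form of `ofTrace` need not be computed. -/
lemma ofForm_mem_W4 (h : IsSU3Basis g J ρ f) {b : V →ₗ[ℝ] V →ₗ[ℝ] ℝ}
    (hb : ∀ x y, b (J x) (J y) = -b x y) (hs : ∀ x y, b x y = -b y x) :
    ofForm ρ f b ∈ W4 (fun x y => g x y) J := by
  have hα := h.ofForm_mem_herm b
  have hr : ∀ x y, rForm ρ f (ofForm ρ f b) x y = b x y := h.rForm_ofForm b
  set α := ofForm ρ f b
  set τ : V →ₗ[ℝ] ℝ := ∑ i, α (f i) (f i)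
  have hmem := h.ofTrace_mem_W4 τ
  obtain ⟨h4J, h4s⟩ := h.rForm_ofTrace τ
  have hβ : α + (-1 : ℝ) • ofTrace g J τ ∈ hermTensors J :=
    add_mem hα (Submodule.smul_mem _ _ hmem.1)
  have hβr : ∀ x y, rForm ρ f (α + (-1 : ℝ) • ofTrace g J τ) x y =
      b x y - rForm ρ f (ofTrace g J τ) x y := by
    intro x y
    rw [rForm_add, rForm_smul, hr]
    ring
  have hsym := h.contract_trace_of_anti hβ (fun x y => by
      rw [hβr, hβr, h4J, hb]
      ring) (fun z => by
      rw [h.tr12_eq]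
      have h1 := h.tr12_ofTrace τ z
      rw [h.tr12_eq] at h1
      simp only [LinearMap.add_apply, LinearMap.smul_apply, smul_eq_mul, Finset.sum_add_distrib,
        ← Finset.mul_sum, h1]
      simp [τ, LinearMap.sum_apply])
  have hz := h.rForm_eq_zero hβ (fun x y => by
    have h1 := hsym x y
    rw [hβr, hβr] at h1
    rw [hβr]
    linarith [hs x y, h4s x y])
  have : α = ofTrace g J τ := by
    ext x y z
    have := congrArg (fun β : V →ₗ[ℝ] V →ₗ[ℝ] V →ₗ[ℝ] ℝ => β x y z) hz
    simp at this
    linarith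
  rw [this]
  exact hmem

end IsSU3Basis

end SU3Algebra

end G2Hyp
end

/-! ### Projections to the torsion classes and the effect of the phase. -/

noncomputable section

namespace G2Hyp

section SU3Algebra

variable {V : Type*} [AddCommGroup V] [Module ℝ V]

namespace IsSU3Basis

variable {g : V →ₗ[ℝ] V →ₗ[ℝ] ℝ} {J : V →ₗ[ℝ] V} {ρ : V →ₗ[ℝ] V →ₗ[ℝ] V →ₗ[ℝ] ℝ}
  {f : Fin 6 → V}

/-- The projections of a bilinear form to the `SU(3)`-summands that correspond to the torsion
classes. -/
def part (g : V →ₗ[ℝ] V →ₗ[ℝ] ℝ) (J : V →ₗ[ℝ] V) (f : Fin 6 → V) (r : V →ₗ[ℝ] V →ₗ[ℝ] ℝ) :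
    TorsionClass → V →ₗ[ℝ] V →ₗ[ℝ] ℝ
  | .W1p => (trace f r / 6) • g
  | .W1m => (-traceJ J f r / 6) • g.compl₂ J
  | .W2p => (1 / 4 : ℝ) • (r + r.flip + r.compl₁₂ J J + r.flip.compl₁₂ J J)
      + (-trace f r / 6) • g
  | .W2m => (1 / 4 : ℝ) • (r + (-1 : ℝ) • r.flip + r.compl₁₂ J J
      + (-1 : ℝ) • r.flip.compl₁₂ J J) + (traceJ J f r / 6) • g.compl₂ J
  | .W3 => (1 / 4 : ℝ) • (r + r.flip + (-1 : ℝ) • r.compl₁₂ J J + (-1 : ℝ) • r.flip.compl₁₂ J J)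
  | .W4 => (1 / 4 : ℝ) • (r + (-1 : ℝ) • r.flip + (-1 : ℝ) • r.compl₁₂ J J + r.flip.compl₁₂ J J)
  | .W5 => 0

/-- The bilinear forms in the summand of a torsion class. -/
def IsPart (g : V →ₗ[ℝ] V →ₗ[ℝ] ℝ) (J : V →ₗ[ℝ] V) (f : Fin 6 → V) (r : V →ₗ[ℝ] V →ₗ[ℝ] ℝ) :
    TorsionClass → Prop
  | .W1p => ∃ p : ℝ, ∀ x y, r x y = p * g x y
  | .W1m => ∃ q : ℝ, ∀ x y, r x y = q * g x (J y)
  | .W2p => (∀ x y, r (J x) (J y) = r x y) ∧ (∀ x y, r x y = r y x) ∧ trace f r = 0 ∧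
      traceJ J f r = 0
  | .W2m => (∀ x y, r (J x) (J y) = r x y) ∧ (∀ x y, r x y = -r y x) ∧ trace f r = 0 ∧
      traceJ J f r = 0
  | .W3 => (∀ x y, r (J x) (J y) = -r x y) ∧ ∀ x y, r x y = r y x
  | .W4 => (∀ x y, r (J x) (J y) = -r x y) ∧ ∀ x y, r x y = -r y x
  | .W5 => ∀ x y, r x y = 0

lemma part_apply (r : V →ₗ[ℝ] V →ₗ[ℝ] ℝ) (i : TorsionClass) (x y : V) : part g J f r i x y =
    match i with
    | .W1p => trace f r / 6 * g x y
    | .W1m => -traceJ J f r / 6 * g x (J y)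
    | .W2p => (1 / 4) * (r x y + r y x + r (J x) (J y) + r (J y) (J x)) - trace f r / 6 * g x y
    | .W2m => (1 / 4) * (r x y - r y x + r (J x) (J y) - r (J y) (J x))
        + traceJ J f r / 6 * g x (J y)
    | .W3 => (1 / 4) * (r x y + r y x - r (J x) (J y) - r (J y) (J x))
    | .W4 => (1 / 4) * (r x y - r y x - r (J x) (J y) + r (J y) (J x))
    | .W5 => 0 := by
  cases i <;> simp [part] <;> ring

lemma sum_part (r : V →ₗ[ℝ] V →ₗ[ℝ] ℝ) : part g J f r .W1p + part g J f r .W1m +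
    part g J f r .W2p + part g J f r .W2m + part g J f r .W3 + part g J f r .W4 = r := by
  ext x y
  simp only [LinearMap.add_apply, part_apply]
  ring

lemma trace_of_anti (h : IsSU3Basis g J ρ f) {r : V →ₗ[ℝ] V →ₗ[ℝ] ℝ}
    (hr : ∀ x y, r (J x) (J y) = -r x y) : trace f r = 0 ∧ traceJ J f r = 0 := by
  have h1 := h.sum_J_J r
  have h2 := h.sum_J r
  have h3 : ∀ x, r (J x) x = r x (J x) := by
    intro x
    have := hr x (J x)
    rw [h.J_sq, map_neg] at this
    linarith
  simp only [hr, h3, Finset.sum_neg_distrib] at h1 h2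
  exact ⟨by rw [trace]; linarith, by rw [traceJ]; linarith⟩

lemma part_eq_zero (h : IsSU3Basis g J ρ f) {r : V →ₗ[ℝ] V →ₗ[ℝ] ℝ} {i j : TorsionClass}
    (hr : IsPart g J f r i) (hij : j ≠ i) (x y : V) : part g J f r j x y = 0 := by
  rw [part_apply]
  have e1 : g (J y) (J x) = g x y := by rw [h.J_isometry, h.symm]
  have e2 : g y (J x) = -g x (J y) := by rw [h.symm, h.J_skew]
  have e3 : g (J y) x = g x (J y) := h.symm _ _
  have e4 : g (J x) y = -g x (J y) := h.J_skew _ _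
  cases i with
  | W1p =>
    obtain ⟨p, hp⟩ := hr
    have t : traceJ J f r = 0 := by simp [traceJ, hp, h.inner_J_self]
    have t' : trace f r = p * 6 := by
      simp only [trace, hp, ← Finset.mul_sum, h.sum_inner_self]
    cases j <;> simp only [t, t', hp, h.J_isometry, h.symm y x] <;> first | contradiction | ring
  | W1m =>
    obtain ⟨q, hq⟩ := hr
    have t : trace f r = 0 := by simp [trace, hq, h.inner_J_self]
    have t' : traceJ J f r = -(q * 6) := by
      simp only [traceJ, hq, h.J_sq, map_neg, ← Finset.mul_sum, mul_neg, Finset.sum_neg_distrib,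
        h.sum_inner_self]
    cases j <;> simp only [t, t', hq, h.J_sq, map_neg, e2, e3, e4] <;>
      first | contradiction | ring
  | W2p =>
    obtain ⟨h1, h2, h3, h4⟩ := hr
    cases j <;> simp only [h1, h2 y x, h3, h4] <;> first | contradiction | ring
  | W2m =>
    obtain ⟨h1, h2, h3, h4⟩ := hr
    cases j <;> simp only [h1, h2 y x, h3, h4] <;> first | contradiction | ring
  | W3 =>
    obtain ⟨h1, h2⟩ := hr
    obtain ⟨h3, h4⟩ := h.trace_of_anti h1
    cases j <;> simp only [h1, h2 y x, h3, h4] <;> first | contradiction | ring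
  | W4 =>
    obtain ⟨h1, h2⟩ := hr
    obtain ⟨h3, h4⟩ := h.trace_of_anti h1
    cases j <;> simp only [h1, h2 y x, h3, h4] <;> first | contradiction | ring
  | W5 =>
    have t : trace f r = 0 := by
      simp only [trace]
      exact Finset.sum_eq_zero fun i _ => hr _ _
    have t' : traceJ J f r = 0 := by
      simp only [traceJ]
      exact Finset.sum_eq_zero fun i _ => hr _ _
    have hr' : ∀ x y, r x y = 0 := hr
    cases j <;> simp only [t, t', hr'] <;> ring

lemma isPart_part (h : IsSU3Basis g J ρ f) (r : V →ₗ[ℝ] V →ₗ[ℝ] ℝ) (i : TorsionClass) :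
    IsPart g J f (part g J f r i) i := by
  have e2 : ∀ x y, g y (J x) = -g x (J y) := fun x y => by rw [h.symm, h.J_skew]
  have e5 : ∀ x y, r (J (J x)) (J (J y)) = r x y := fun x y => by simp [h.J_sq]
  have s1 := h.sum_J_J r
  have s2 := h.sum_J r
  have s3 : ∑ i, r (J (J (f i))) (J (f i)) = -∑ i, r (f i) (J (f i)) := by
    simp [h.J_sq]
  have s4 : ∑ i, r (J (f i)) (J (J (f i))) = ∑ i, r (f i) (J (f i)) := by
    have := h.sum_J_J (r.compl₂ J)
    simpa only [LinearMap.compl₂_apply] using this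
  cases i with
  | W1p => exact ⟨_, fun x y => part_apply r .W1p x y⟩
  | W1m => exact ⟨_, fun x y => part_apply r .W1m x y⟩
  | W2p =>
    refine ⟨fun x y => ?_, fun x y => ?_, ?_, ?_⟩
    · simp only [part_apply, e5, h.J_isometry]; ring
    · simp only [part_apply, h.symm y x]; ring
    · simp only [trace, part_apply, Finset.sum_sub_distrib, Finset.sum_add_distrib,
        ← Finset.mul_sum, s1, h.sum_inner_self]
      ring
    · simp only [traceJ, part_apply, Finset.sum_sub_distrib, Finset.sum_add_distrib,
        ← Finset.mul_sum, s2, s3, s4, h.inner_J_self]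
      simp
  | W2m =>
    refine ⟨fun x y => ?_, fun x y => ?_, ?_, ?_⟩
    · simp only [part_apply, e5, h.J_isometry]; ring
    · simp only [part_apply, e2 x y]; ring
    · simp only [trace, part_apply, Finset.sum_sub_distrib, Finset.sum_add_distrib,
        ← Finset.mul_sum, s1, h.inner_J_self]
      simp
    · simp only [traceJ, part_apply, Finset.sum_sub_distrib, Finset.sum_add_distrib,
        ← Finset.mul_sum, s2, s3, s4]
      simp only [h.J_sq, map_neg, Finset.sum_neg_distrib, h.sum_inner_self]
      ring
  | W3 =>
    refine ⟨fun x y => ?_, fun x y => ?_⟩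
    · simp only [part_apply, e5]; ring
    · simp only [part_apply]; ring
  | W4 =>
    refine ⟨fun x y => ?_, fun x y => ?_⟩
    · simp only [part_apply, e5]; ring
    · simp only [part_apply]; ring
  | W5 => exact fun x y => by simp [part_apply]

/-- Composition of the second argument of a bilinear form with `c + s J`. -/
def twist (J : V →ₗ[ℝ] V) (c s : ℝ) (b : V →ₗ[ℝ] V →ₗ[ℝ] ℝ) : V →ₗ[ℝ] V →ₗ[ℝ] ℝ :=
  c • b + s • b.compl₂ J

lemma twist_apply (c s : ℝ) (b : V →ₗ[ℝ] V →ₗ[ℝ] ℝ) (x y : V) :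
    twist J c s b x y = c * b x y + s * b x (J y) := by
  simp [twist]

/-- Since `J² = -1`, the map `c + s J` is a rotation with inverse `c - s J`. -/
lemma twist_twist (h : IsSU3Basis g J ρ f) {c s : ℝ} (hcs : c ^ 2 + s ^ 2 = 1)
    (b : V →ₗ[ℝ] V →ₗ[ℝ] ℝ) : twist J c s (twist J c (-s) b) = b := by
  ext x y
  simp only [twist_apply, h.J_sq, map_neg]
  linear_combination hcs * b x y

lemma trace_twist (c s : ℝ) (b : V →ₗ[ℝ] V →ₗ[ℝ] ℝ) :
    trace f (twist J c s b) = c * trace f b + s * traceJ J f b := by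
  simp only [trace, traceJ, twist_apply, Finset.sum_add_distrib, Finset.mul_sum]

lemma traceJ_twist (h : IsSU3Basis g J ρ f) (c s : ℝ) (b : V →ₗ[ℝ] V →ₗ[ℝ] ℝ) :
    traceJ J f (twist J c s b) = c * traceJ J f b - s * trace f b := by
  simp only [trace, traceJ, twist_apply, Finset.sum_add_distrib, Finset.mul_sum, h.J_sq, map_neg,
    mul_neg, Finset.sum_neg_distrib]
  ring

lemma twist_J_J {t : ℝ} {b : V →ₗ[ℝ] V →ₗ[ℝ] ℝ}
    (hb : ∀ x y, b (J x) (J y) = t * b x y) (c s : ℝ) (x y : V) :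
    twist J c s b (J x) (J y) = t * twist J c s b x y := by
  simp only [twist_apply, hb]
  ring

lemma anti_J {b : V →ₗ[ℝ] V →ₗ[ℝ] ℝ} (h : IsSU3Basis g J ρ f)
    (hb : ∀ x y, b (J x) (J y) = -b x y) (x y : V) : b x (J y) = b (J x) y := by
  have := hb x (J y)
  rw [h.J_sq, map_neg] at this
  linarith

/-- Contracting with `y ⌟ ψ` is contracting with `(c y + s Jy) ⌟ ρ`. The `½` of `r` and the `1 / 2!`
of the inner product make up the `1 / 4` of `rForm`. -/
lemma rMap_eq_twist (hf : f = onFrame 6 fun x y => g x y)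
    {c s : ℝ} {ψ : (Fin 3 → V) → ℝ} (hψ : ∀ v, ψ v = ρ (c • v 0 + s • J (v 0)) (v 1) (v 2))
    (α : V →ₗ[ℝ] V →ₗ[ℝ] V →ₗ[ℝ] ℝ) (x y : V) :
    rMap (fun x y => g x y) ψ α x y = twist J c s (rForm ρ f α) x y := by
  rw [rMap, formInner, ← hf, ← (finTwoArrowEquiv (Fin 6)).symm.sum_comp, Fintype.sum_prod_type]
  simp only [interior, hψ, twist_apply, rForm_apply, finTwoArrowEquiv_symm_apply,
    Fin.cons_zero, Fin.cons_one, Matrix.cons_val_zero, Matrix.cons_val_one,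
    show (2 : Fin 3) = Fin.succ 1 from rfl, Fin.cons_succ]
  simp only [map_add, map_smul, LinearMap.add_apply, LinearMap.smul_apply, smul_eq_mul, mul_add,
    Finset.sum_add_distrib, mul_left_comm _ c, mul_left_comm _ s, ← Finset.mul_sum]
  norm_num [Nat.factorial]
  ring

/-- The twist preserves invariance, anti-invariance and the vanishing of both traces. On
anti-invariant forms it also preserves symmetry type, as `b (x, Jy) = b (Jx, y)`; on invariant ones
the symmetry comes from the definition of the `±` halves, which are taken with respect to `ψ`. -/
lemma isPart_of_mem (h : IsSU3Basis g J ρ f) (hf : f = onFrame 6 fun x y => g x y)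
    {c s : ℝ} {ψ : (Fin 3 → V) → ℝ}
    (hψ : ∀ v, ψ v = ρ (c • v 0 + s • J (v 0)) (v 1) (v 2)) {i : TorsionClass}
    {α : V →ₗ[ℝ] V →ₗ[ℝ] V →ₗ[ℝ] ℝ} (hα : α ∈ torsionModule (fun x y => g x y) J ψ i) :
    IsPart g J f (twist J c s (rForm ρ f α)) i := by
  have e1 : ∀ x y, g y (J x) = -g x (J y) := fun x y => by rw [h.symm, h.J_skew]
  have hW1 : α ∈ W1 J → ∃ p q : ℝ, ∀ x y, twist J c s (rForm ρ f α) x y =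
      p * g x y + q * g x (J y) := by
    intro hα
    refine ⟨(c * trace f (rForm ρ f α) + s * traceJ J f (rForm ρ f α)) / 6,
      (s * trace f (rForm ρ f α) - c * traceJ J f (rForm ρ f α)) / 6, fun x y => ?_⟩
    rw [twist_apply, h.rForm_W1 hα x y, h.rForm_W1 hα x (J y), h.J_sq, map_neg]
    ring
  have hW2 : α ∈ W2 J → (∀ x y, twist J c s (rForm ρ f α) (J x) (J y) =
      twist J c s (rForm ρ f α) x y) ∧ trace f (twist J c s (rForm ρ f α)) = 0 ∧
      traceJ J f (twist J c s (rForm ρ f α)) = 0 := by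
    intro hα
    obtain ⟨t1, t2⟩ := h.traces_W2 hα
    refine ⟨fun x y => ?_, ?_, ?_⟩
    · rw [twist_J_J (t := 1), one_mul]
      intro x y
      rw [h.rForm_J_J (h.W2_J_J hα)]
      ring
    · rw [trace_twist, t1, t2]; ring
    · rw [h.traceJ_twist, t1, t2]; ring
  cases i with
  | W1p =>
    obtain ⟨hα, hs⟩ := hα
    simp only [rMap_eq_twist hf hψ] at hs
    obtain ⟨p, q, hpq⟩ := hW1 hα
    refine ⟨p, fun x y => ?_⟩
    have := hs x y
    rw [hpq, hpq, h.symm y x, e1 x y] at this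
    rw [hpq]
    linarith
  | W1m =>
    obtain ⟨hα, hs⟩ := hα
    simp only [rMap_eq_twist hf hψ] at hs
    obtain ⟨p, q, hpq⟩ := hW1 hα
    refine ⟨q, fun x y => ?_⟩
    have := hs x y
    rw [hpq, hpq, h.symm y x, e1 x y] at this
    rw [hpq]
    linarith
  | W2p =>
    obtain ⟨hα, hs⟩ := hα
    simp only [rMap_eq_twist hf hψ] at hs
    obtain ⟨h1, h2, h3⟩ := hW2 hα
    exact ⟨h1, fun x y => by rw [hs, one_mul], h2, h3⟩
  | W2m =>
    obtain ⟨hα, hs⟩ := hα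
    simp only [rMap_eq_twist hf hψ] at hs
    obtain ⟨h1, h2, h3⟩ := hW2 hα
    exact ⟨h1, fun x y => by rw [hs, neg_one_mul], h2, h3⟩
  | W3 =>
    obtain ⟨h1, h2⟩ := h.rForm_W3 hα
    refine ⟨fun x y => ?_, fun x y => ?_⟩
    · rw [twist_J_J (t := -1) (by simpa using h1), neg_one_mul]
    · rw [twist_apply, twist_apply, h.anti_J h1 x y, h2 x y, h2 (J x) y]
  | W4 =>
    obtain ⟨h1, h2⟩ := h.rForm_W4 hα
    refine ⟨fun x y => ?_, fun x y => ?_⟩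
    · rw [twist_J_J (t := -1) (by simpa using h1), neg_one_mul]
    · rw [twist_apply, twist_apply, h.anti_J h1 x y, h2 x y, h2 (J x) y]
      ring
  | W5 =>
    have hα' : α = 0 := hα
    intro x y
    rw [hα', rForm_zero, twist_apply]
    simp

lemma ofForm_mem (h : IsSU3Basis g J ρ f) (hf : f = onFrame 6 fun x y => g x y)
    {c s : ℝ} (hcs : c ^ 2 + s ^ 2 = 1) {ψ : (Fin 3 → V) → ℝ}
    (hψ : ∀ v, ψ v = ρ (c • v 0 + s • J (v 0)) (v 1) (v 2)) {i : TorsionClass}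
    {r : V →ₗ[ℝ] V →ₗ[ℝ] ℝ} (hr : IsPart g J f r i) :
    ofForm ρ f (twist J c (-s) r) ∈ torsionModule (fun x y => g x y) J ψ i := by
  have e1 : ∀ x y, g y (J x) = -g x (J y) := fun x y => by rw [h.symm, h.J_skew]
  have hR : ∀ x y, rMap (fun x y => g x y) ψ (ofForm ρ f (twist J c (-s) r)) x y = r x y := by
    intro x y
    have : rForm ρ f (ofForm ρ f (twist J c (-s) r)) = twist J c (-s) r := by
      ext; exact h.rForm_ofForm _ _ _
    rw [rMap_eq_twist hf hψ, this, h.twist_twist hcs]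
  cases i with
  | W1p =>
    obtain ⟨p, hp⟩ := hr
    refine ⟨h.ofForm_mem_W1 (p := c * p) (q := -s * p) fun x y => ?_, fun x y => ?_⟩
    · rw [twist_apply, hp, hp]; ring
    · rw [hR, hR, hp, hp, h.symm y x]; ring
  | W1m =>
    obtain ⟨q, hq⟩ := hr
    refine ⟨h.ofForm_mem_W1 (p := s * q) (q := c * q) fun x y => ?_, fun x y => ?_⟩
    · rw [twist_apply, hq, hq, h.J_sq, map_neg]; ring
    · rw [hR, hR, hq, hq, e1 x y]; ring
  | W2p =>
    obtain ⟨h1, h2, h3, h4⟩ := hr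
    refine ⟨h.ofForm_mem_W2 (fun x y => ?_) ?_ ?_, fun x y => ?_⟩
    · rw [twist_J_J (t := 1) (by simpa using h1), one_mul]
    · rw [trace_twist, h3, h4]; ring
    · rw [h.traceJ_twist, h3, h4]; ring
    · rw [hR, hR, h2, one_mul]
  | W2m =>
    obtain ⟨h1, h2, h3, h4⟩ := hr
    refine ⟨h.ofForm_mem_W2 (fun x y => ?_) ?_ ?_, fun x y => ?_⟩
    · rw [twist_J_J (t := 1) (by simpa using h1), one_mul]
    · rw [trace_twist, h3, h4]; ring
    · rw [h.traceJ_twist, h3, h4]; ring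
    · rw [hR, hR, h2, neg_one_mul]
  | W3 =>
    obtain ⟨h1, h2⟩ := hr
    refine h.ofForm_mem_W3 (fun x y => ?_) (fun x y => ?_)
    · rw [twist_J_J (t := -1) (by simpa using h1), neg_one_mul]
    · rw [twist_apply, twist_apply, h.anti_J h1 x y, h2 x y, h2 (J x) y]
  | W4 =>
    obtain ⟨h1, h2⟩ := hr
    refine h.ofForm_mem_W4 (fun x y => ?_) (fun x y => ?_)
    · rw [twist_J_J (t := -1) (by simpa using h1), neg_one_mul]
    · rw [twist_apply, twist_apply, h.anti_J h1 x y, h2 x y, h2 (J x) y]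
      ring
  | W5 =>
    have hr' : ∀ x y, r x y = 0 := hr
    change ofForm ρ f (twist J c (-s) r) = 0
    ext x y z
    simp [ofForm_apply, twist_apply, hr']

lemma part_add (r r' : V →ₗ[ℝ] V →ₗ[ℝ] ℝ) (i : TorsionClass) (x y : V) :
    part g J f (r + r') i x y = part g J f r i x y + part g J f r' i x y := by
  have t : trace f (r + r') = trace f r + trace f r' := by
    simp [trace, Finset.sum_add_distrib]
  have t' : traceJ J f (r + r') = traceJ J f r + traceJ J f r' := by
    simp [traceJ, Finset.sum_add_distrib]
  simp only [part_apply, t, t', LinearMap.add_apply]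
  cases i <;> ring

/-- Membership in a sum of torsion modules is the vanishing of the other components. -/
theorem mem_iSup_iff (h : IsSU3Basis g J ρ f) (hf : f = onFrame 6 fun x y => g x y)
    {c s : ℝ} (hcs : c ^ 2 + s ^ 2 = 1) {ψ : (Fin 3 → V) → ℝ}
    (hψ : ∀ v, ψ v = ρ (c • v 0 + s • J (v 0)) (v 1) (v 2)) (A : Set TorsionClass)
    {α : V →ₗ[ℝ] V →ₗ[ℝ] V →ₗ[ℝ] ℝ} (hα : α ∈ hermTensors J) :
    α ∈ ⨆ i ∈ A, torsionModule (fun x y => g x y) J ψ i ↔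
      ∀ j ∉ A, ∀ x y, part g J f (twist J c s (rForm ρ f α)) j x y = 0 := by
  constructor
  · intro hmem j hj x y
    have h0 : part g J f (0 : V →ₗ[ℝ] V →ₗ[ℝ] ℝ) j x y = 0 := by
      have := part_add (g := g) (J := J) (f := f) 0 0 j x y
      rw [add_zero] at this
      linarith
    have tz : twist J c s (rForm ρ f 0) = 0 := by
      ext; simp [twist_apply, rForm_zero]
    have ta : ∀ α β, twist J c s (rForm ρ f (α + β)) =
        twist J c s (rForm ρ f α) + twist J c s (rForm ρ f β) := by
      intro α β
      ext
      simp only [twist_apply, rForm_add, LinearMap.add_apply]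
      ring
    -- The projection with label `j` is additive and kills each summand with a label in `A`, since
    -- `j ∉ A`.
    refine Submodule.iSup_induction _ (motive := fun β =>
      part g J f (twist J c s (rForm ρ f β)) j x y = 0) hmem (fun i β hβ => ?_) ?_ ?_
    · by_cases hi : i ∈ A
      · simp only [hi, iSup_pos] at hβ
        exact h.part_eq_zero (h.isPart_of_mem hf hψ hβ) (fun hji => hj (by rwa [hji])) x y
      · simp only [hi, Submodule.mem_bot, not_false_eq_true, iSup_neg] at hβ
        rw [hβ, tz, h0]
    · rw [tz, h0]
    · intro β γ hβ hγ
      rw [ta, part_add, hβ, hγ, add_zero]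
  · intro hpart
    -- Each component, transported back to a tensor, is in its own module if its label is in `A` and
    -- is zero otherwise. The six components sum to `α`.
    have hmem : ∀ i, ofForm ρ f (twist J c (-s) (part g J f (twist J c s (rForm ρ f α)) i)) ∈
        ⨆ i ∈ A, torsionModule (fun x y => g x y) J ψ i := by
      intro i
      by_cases hi : i ∈ A
      · exact Submodule.mem_iSup_of_mem i (Submodule.mem_iSup_of_mem hi
          (h.ofForm_mem hf hcs hψ (h.isPart_part _ i)))
      · convert Submodule.zero_mem _
        ext x y z
        simp [ofForm_apply, twist_apply, hpart i hi]
    have hsum := add_mem (add_mem (add_mem (add_mem (add_mem (hmem .W1p) (hmem .W1m))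
      (hmem .W2p)) (hmem .W2m)) (hmem .W3)) (hmem .W4)
    convert hsum using 1
    have hs := sum_part (g := g) (J := J) (f := f) (twist J c s (rForm ρ f α))
    have hadd : ∀ a b : V →ₗ[ℝ] V →ₗ[ℝ] ℝ, ofForm ρ f (twist J c (-s) a)
        + ofForm ρ f (twist J c (-s) b) = ofForm ρ f (twist J c (-s) (a + b)) := by
      intro a b
      ext x y z
      simp only [ofForm_apply, twist_apply, LinearMap.add_apply, ← Finset.sum_add_distrib]
      exact Finset.sum_congr rfl fun d _ => by ring
    rw [hadd, hadd, hadd, hadd, hadd, hs]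
    have := h.twist_twist (c := c) (s := -s) (by linarith) (rForm ρ f α)
    rw [neg_neg] at this
    rw [this, h.ofForm_rForm hα]

end IsSU3Basis

end SU3Algebra

end G2Hyp
end

/-! ### Linear algebra of a hyperplane in a space with a `G₂`-structure. -/

noncomputable section

namespace G2Hyp

section HypersurfaceAlgebra

variable {V W : Type*} [AddCommGroup V] [Module ℝ V] [AddCommGroup W] [Module ℝ W]

/-- Pull-back of a three-form, in curried form. -/
def pullTri (φ : V [⋀^Fin 3]→ₗ[ℝ] ℝ) (ι : W →ₗ[ℝ] V) : W →ₗ[ℝ] W →ₗ[ℝ] W →ₗ[ℝ] ℝ :=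
  LinearMap.mk₂ ℝ (fun x y => tri φ (ι x) (ι y) ∘ₗ ι) (by intros; ext; simp) (by intros; ext; simp)
    (by intros; ext; simp) (by intros; ext; simp)

lemma pullTri_apply (φ : V [⋀^Fin 3]→ₗ[ℝ] ℝ) (ι : W →ₗ[ℝ] V) (x y z : W) :
    pullTri φ ι x y z = tri φ (ι x) (ι y) (ι z) := rfl

/-- `n` is a unit normal vector of the image of the injective map `ι`, in a space with a
`G₂`-structure. -/
structure IsUnitNormal (g : V →ₗ[ℝ] V →ₗ[ℝ] ℝ) (φ : V [⋀^Fin 3]→ₗ[ℝ] ℝ) (e : Fin 7 → V)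
    (ι : W →ₗ[ℝ] V) (n : V) : Prop extends IsG2Basis g φ e where
  inj : Function.Injective ι
  unit : g n n = 1
  orth : ∀ x, g n (ι x) = 0

namespace IsUnitNormal

variable {g : V →ₗ[ℝ] V →ₗ[ℝ] ℝ} {φ : V [⋀^Fin 3]→ₗ[ℝ] ℝ} {e : Fin 7 → V}
  {ι : W →ₗ[ℝ] V} {n : V} {J : W →ₗ[ℝ] W}

/-- The image of `ι` lies in the kernel of `⟨n, ·⟩`, and both have dimension six. -/
lemma exists_tangent (h : IsUnitNormal g φ e ι n) [FiniteDimensional ℝ V] [FiniteDimensional ℝ W]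
    (hV : Module.finrank ℝ V = 7) (hW : Module.finrank ℝ W = 6) {v : V} (hv : g n v = 0) :
    ∃ w, ι w = v := by
  have h1 : LinearMap.range ι ≤ LinearMap.ker (g n) := by
    rintro _ ⟨x, rfl⟩
    exact h.orth x
  have h2 : Module.finrank ℝ (LinearMap.range ι) = 6 := by
    rw [LinearMap.finrank_range_of_inj h.inj, hW]
  have h3 := LinearMap.finrank_range_add_finrank_ker (g n)
  have h4 : LinearMap.range (g n) = ⊤ := by
    rw [LinearMap.range_eq_top]
    intro c
    exact ⟨c • n, by simp [h.unit]⟩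
  rw [h4, hV, finrank_top, Module.finrank_self] at h3
  have h5 := Submodule.eq_of_le_of_finrank_eq h1 (by omega)
  have : v ∈ LinearMap.range ι := by
    rw [h5]
    exact hv
  exact this

lemma inner_cross_normal (h : IsUnitNormal g φ e ι n) (v : V) : g n (crossL φ e n v) = 0 := by
  rw [h.symm, h.cross_inner, tri_self13]

lemma exists_J (h : IsUnitNormal g φ e ι n) [FiniteDimensional ℝ V] [FiniteDimensional ℝ W]
    (hV : Module.finrank ℝ V = 7) (hW : Module.finrank ℝ W = 6) :
    ∃ J : W →ₗ[ℝ] W, ∀ x, ι (J x) = crossL φ e n (ι x) := by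
  obtain ⟨π, hπ⟩ := LinearMap.exists_leftInverse_of_injective ι (LinearMap.ker_eq_bot.2 h.inj)
  refine ⟨π ∘ₗ crossL φ e n ∘ₗ ι, fun x => ?_⟩
  obtain ⟨w, hw⟩ := h.exists_tangent hV hW (h.inner_cross_normal (ι x))
  simp only [LinearMap.comp_apply]
  rw [← hw]
  exact congrArg ι (LinearMap.congr_fun hπ w)

lemma tri_normal (h : IsUnitNormal g φ e ι n) (hJ : ∀ x, ι (J x) = crossL φ e n (ι x)) (x : W)
    (v : V) : tri φ n (ι x) v = g (ι (J x)) v := by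
  rw [hJ, h.cross_inner]

/-- With `n` normal the formula for `*φ` leaves `-⟨n × x, y × z⟩`. So `n ⌟ *φ` restricts to `-ρ (J
·, ·, ·)`, which puts `ψ₊` in the form `cos θ ρ + sin θ ρ (J ·, ·, ·)`. -/
lemma starL_normal (h : IsUnitNormal g φ e ι n) (hJ : ∀ x, ι (J x) = crossL φ e n (ι x))
    (x y z : W) : starL g (crossL φ e) n (ι x) (ι y) (ι z) = -pullTri φ ι (J x) y z := by
  rw [starL_apply, h.orth, h.orth, pullTri_apply, hJ, h.symm (crossL φ e n _), h.cross_inner,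
    ← tri_rot]
  ring

lemma J_J (h : IsUnitNormal g φ e ι n) (hJ : ∀ x, ι (J x) = crossL φ e n (ι x)) (x : W) :
    J (J x) = -x := by
  apply h.inj
  rw [hJ, hJ, h.cross_cross_self, h.unit, h.orth, map_neg]
  simp

/-- The frame consists of the last six vectors of a Cayley frame starting with `n`; an ambient trace
then splits into its normal and tangential parts. -/
lemma exists_frame (h : IsUnitNormal g φ e ι n) [FiniteDimensional ℝ V] [FiniteDimensional ℝ W]
    (hV : Module.finrank ℝ V = 7) (hW : Module.finrank ℝ W = 6) :
    ∃ f : Fin 6 → W, IsONBasis (g.compl₁₂ ι ι) f ∧ ∀ β : V →ₗ[ℝ] V →ₗ[ℝ] ℝ,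
      ∑ i, β (e i) (e i) = β n n + ∑ i, β (ι (f i)) (ι (f i)) := by
  obtain ⟨a, ha, ha0⟩ := h.exists_adapted hV h.unit
  have hn : ∀ i : Fin 6, ∃ w, ι w = a i.succ := fun i => h.exists_tangent hV hW (by
    rw [← ha0, ha.ortho, if_neg (Fin.succ_ne_zero i).symm])
  choose f hf using hn
  refine ⟨f, ⟨fun i j => ?_, fun x => ?_, fun x y => ?_⟩, fun β => ?_⟩
  · simp only [LinearMap.compl₁₂_apply, hf, ha.ortho, Fin.succ_inj]
  · apply h.inj
    conv_lhs => rw [ha.expand (ι x), Fin.sum_univ_succ, ha0, h.orth, zero_smul, zero_add]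
    simp only [map_sum, map_smul, LinearMap.compl₁₂_apply, hf]
  · exact h.symm _ _
  · rw [h.contract_eq ha.toIsONBasis, Fin.sum_univ_succ, ha0]
    simp only [hf]

lemma exists_isSU3Basis (h : IsUnitNormal g φ e ι n) [FiniteDimensional ℝ V]
    [FiniteDimensional ℝ W] (hV : Module.finrank ℝ V = 7) (hW : Module.finrank ℝ W = 6)
    (hJ : ∀ x, ι (J x) = crossL φ e n (ι x)) :
    ∃ f, IsSU3Basis (g.compl₁₂ ι ι) J (pullTri φ ι) f := by
  obtain ⟨f, hf, hsum⟩ := h.exists_frame hV hW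
  have hskew : ∀ x y, g (ι (J x)) (ι y) = -g (ι x) (ι (J y)) := by
    intro x y
    rw [← h.tri_normal hJ, h.symm, ← h.tri_normal hJ, tri_swap23]
  refine ⟨f, ⟨hf, h.J_J hJ, hskew, fun x y z => ?_, fun x y z => ?_, fun x y z => ?_,
    fun y z u v => ?_⟩⟩
  · exact tri_swap12 _ _ _ _
  · exact tri_swap23 _ _ _ _
  -- Moving `J` between arguments of `ρ` is the skewness of `n ⌟ *φ` in its first two arguments.
  · have h1 := h.starL_normal hJ x y z
    have h2 := h.starL_normal hJ y x z
    have h3 := h.starL_swap23 n (ι x) (ι y) (ι z)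
    have h4 : pullTri φ ι x (J y) z = -pullTri φ ι (J y) x z := tri_swap12 _ _ _ _
    linarith
  · have h1 := hsum (LinearMap.mk₂ ℝ
      (fun a b => tri φ (ι y) (ι z) a * tri φ (ι u) (ι v) b)
      (by intros; simp; ring) (by intros; simp; ring) (by intros; simp; ring)
      (by intros; simp; ring))
    have h2 : ∑ i, tri φ (ι y) (ι z) (e i) * tri φ (ι u) (ι v) (e i) =
        g (crossL φ e (ι y) (ι z)) (crossL φ e (ι u) (ι v)) := by
      rw [h.inner_eq_sum]
      exact Finset.sum_congr rfl fun i _ => by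
        rw [h.symm, h.cross_inner, h.symm, h.cross_inner]
    simp only [LinearMap.mk₂_apply, h2] at h1
    have h3 := starL_apply g (crossL φ e) (ι y) (ι z) (ι u) (ι v)
    -- On tangent vectors `y = n × (-Jy)`, so `starL_cross` evaluates `*φ (y, z, u, v)`. The formula
    -- for `starL` then gives `⟨y × z, u × v⟩`, whose tangential part is the required contraction.
    have h4 := h.starL_cross n (ι (-J y)) (ι z) (ι u) (ι v)
    rw [← hJ, map_neg, h.J_J hJ, neg_neg] at h4
    simp only [h.orth, h.tri_normal hJ, map_neg, LinearMap.neg_apply] at h4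
    have h5 : ∑ d, pullTri φ ι (f d) y z * pullTri φ ι (f d) u v =
        ∑ i, tri φ (ι y) (ι z) (ι (f i)) * tri φ (ι u) (ι v) (ι (f i)) :=
      Finset.sum_congr rfl fun d _ => by
        rw [pullTri_apply, pullTri_apply, tri_rot, tri_rot φ (ι (f d)) (ι u)]
    have h6 : ∀ a b, tri φ (ι a) (ι b) n = g (ι (J a)) (ι b) := fun a b => by
      rw [← h.tri_normal hJ, ← tri_rot]
    rw [h6, h6] at h1
    simp only [LinearMap.compl₁₂_apply]
    have s1 := hskew y u
    have s2 := hskew z v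
    have s3 := hskew y v
    have s4 := hskew z u
    have s5 : g (ι y) (ι (J u)) * g (ι z) (ι (J v)) = g (ι (J y)) (ι u) * g (ι (J z)) (ι v) := by
      rw [s1, s2]; ring
    have s6 : g (ι y) (ι (J v)) * g (ι z) (ι (J u)) = g (ι (J y)) (ι v) * g (ι (J z)) (ι u) := by
      rw [s3, s4]; ring
    rw [h5, s5, s6]
    linarith

/-- The covariant derivative of a locally conformally parallel three-form in a tangent direction,
with the normal vector inserted. -/
lemma starL_cross_normal (h : IsUnitNormal g φ e ι n)
    (hJ : ∀ x, ι (J x) = crossL φ e n (ι x)) (l : V) (x y z : W) :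
    -starL g (crossL φ e) (crossL φ e l (ι x)) n (ι y) (ι z) = g l n * pullTri φ ι x y z +
      IsSU3Basis.ofTrace (g.compl₁₂ ι ι) J ((4 : ℝ) • (tri φ l n ∘ₗ ι)) x y z := by
  have hskew : ∀ x y, g (ι (J x)) (ι y) = -g (ι x) (ι (J y)) := by
    intro x y
    rw [← h.tri_normal hJ, h.symm, ← h.tri_normal hJ, tri_swap23]
  have h1 : ∀ y, tri φ l n (ι (J y)) = -g l (ι y) := by
    intro y
    rw [tri_rot, h.tri_normal hJ, h.J_J hJ, map_neg, map_neg, LinearMap.neg_apply, h.symm]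
  have h2 : ∀ y, tri φ (ι x) n (ι y) = g (ι x) (ι (J y)) := by
    intro y
    rw [tri_swap12, h.tri_normal hJ, hskew, neg_neg]
  rw [h.starL_cross, IsSU3Basis.ofTrace_apply, pullTri_apply]
  simp only [LinearMap.smul_apply, LinearMap.comp_apply, smul_eq_mul, LinearMap.compl₁₂_apply, h1,
    h2, h.symm (ι x) n, h.orth]
  ring

/-- Split `a = ⟨n, a⟩ n - n × (n × a)`. The normal part gives a multiple of `ρ (J ·, ·, ·)`, the
tangential part the wedge of a one-form with the Kähler form up to sign. Only the existence of that
one-form matters, because such wedges are orthogonal to `ψ₋`. -/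
lemma starL_cross_tangent (h : IsUnitNormal g φ e ι n)
    (hJ : ∀ x, ι (J x) = crossL φ e n (ι x)) (a : V) :
    ∃ ν : W →ₗ[ℝ] ℝ, ∀ x y z, starL g (crossL φ e) a (ι x) (ι y) (ι z) =
      -(g n a * pullTri φ ι (J x) y z) + (ν x * g (ι (J y)) (ι z) - ν y * g (ι (J x)) (ι z)
        + ν z * g (ι (J x)) (ι y)) := by
  refine ⟨-(g (crossL φ e n a) ∘ₗ ι), fun x y z => ?_⟩
  have h1 : a = g n a • n + crossL φ e n (-crossL φ e n a) := by
    rw [map_neg, h.cross_cross_self, h.unit]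
    simp
  have h2 := h.starL_cross n (-crossL φ e n a) (ι x) (ι y) (ι z)
  simp only [h.orth, h.tri_normal hJ, map_neg, LinearMap.neg_apply] at h2
  conv_lhs => rw [h1]
  rw [map_add, map_smul]
  simp only [map_neg, LinearMap.add_apply, LinearMap.smul_apply, smul_eq_mul, h.starL_normal hJ,
    h2, LinearMap.neg_apply, LinearMap.comp_apply]
  ring

end IsUnitNormal

end HypersurfaceAlgebra

end G2Hyp
end

/-! ### Components of `∇ω`, and the `ψ₋`-component of `∇ψ₊`. -/

noncomputable section

namespace G2Hyp

section SU3Algebra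

variable {V : Type*} [AddCommGroup V] [Module ℝ V]

namespace IsSU3Basis

variable {g : V →ₗ[ℝ] V →ₗ[ℝ] ℝ} {J : V →ₗ[ℝ] V} {ρ : V →ₗ[ℝ] V →ₗ[ℝ] V →ₗ[ℝ] ℝ}
  {f : Fin 6 → V}

/-- The tensor with symmetric part `B + s₀ g` and trace `τ`. -/
def torsion (g : V →ₗ[ℝ] V →ₗ[ℝ] ℝ) (J : V →ₗ[ℝ] V) (ρ : V →ₗ[ℝ] V →ₗ[ℝ] V →ₗ[ℝ] ℝ)
    (f : Fin 6 → V) (B : V →ₗ[ℝ] V →ₗ[ℝ] ℝ) (s₀ : ℝ) (τ : V →ₗ[ℝ] ℝ) :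
    V →ₗ[ℝ] V →ₗ[ℝ] V →ₗ[ℝ] ℝ :=
  ofForm ρ f (B + s₀ • g) + ofTrace g J τ

lemma torsion_mem (h : IsSU3Basis g J ρ f) (B : V →ₗ[ℝ] V →ₗ[ℝ] ℝ) (s₀ : ℝ) (τ : V →ₗ[ℝ] ℝ) :
    torsion g J ρ f B s₀ τ ∈ hermTensors J :=
  add_mem (h.ofForm_mem_herm _) (h.ofTrace_mem_W4 τ).1

lemma torsion_apply (h : IsSU3Basis g J ρ f) (B : V →ₗ[ℝ] V →ₗ[ℝ] ℝ) (s₀ : ℝ) (τ : V →ₗ[ℝ] ℝ)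
    (x y z : V) : torsion g J ρ f B s₀ τ x y z =
      ∑ d, B x (f d) * ρ (f d) y z + (s₀ * ρ x y z + ofTrace g J τ x y z) := by
  have := h.sum_inner_mul ((ρ.flip y).flip z) x
  simp only [LinearMap.flip_apply] at this
  rw [torsion, LinearMap.add_apply, LinearMap.add_apply, LinearMap.add_apply, ofForm_apply]
  simp only [LinearMap.add_apply, LinearMap.smul_apply, smul_eq_mul, add_mul, mul_assoc,
    Finset.sum_add_distrib, ← Finset.mul_sum, this]
  ring

lemma tr12_torsion (h : IsSU3Basis g J ρ f) {B : V →ₗ[ℝ] V →ₗ[ℝ] ℝ}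
    (hB : ∀ x y, B x y = B y x) (s₀ : ℝ) (τ : V →ₗ[ℝ] ℝ) (z : V) :
    tr12 (fun x y => g x y) (torsion g J ρ f B s₀ τ) z = τ z := by
  have h1 := h.tr12_ofTrace τ z
  rw [h.tr12_eq] at h1 ⊢
  simp only [h.torsion_apply, h.rho_self, mul_zero, zero_add, Finset.sum_add_distrib, h1]
  have : ∑ i, ∑ d, B (f i) (f d) * ρ (f d) (f i) z =
      -∑ i, ∑ d, B (f i) (f d) * ρ (f d) (f i) z := by
    conv_lhs => rw [Finset.sum_comm]
    simp only [← Finset.sum_neg_distrib]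
    refine Finset.sum_congr rfl fun i _ => Finset.sum_congr rfl fun d _ => ?_
    rw [hB, h.swap12]
    ring
  linarith

lemma twist_torsion (h : IsSU3Basis g J ρ f) (B : V →ₗ[ℝ] V →ₗ[ℝ] ℝ) (s₀ : ℝ)
    (τ : V →ₗ[ℝ] ℝ) (c s : ℝ) (x y : V) :
    twist J c s (rForm ρ f (torsion g J ρ f B s₀ τ)) x y =
      c * (B x y + s₀ * g x y) + s * (B x (J y) + s₀ * g x (J y)) +
        twist J c s (rForm ρ f (ofTrace g J τ)) x y := by
  simp only [twist_apply, torsion, rForm_add, h.rForm_ofForm, LinearMap.add_apply,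
    LinearMap.smul_apply, smul_eq_mul]
  ring

/-- The components of the torsion. -/
lemma part_torsion (h : IsSU3Basis g J ρ f) {B : V →ₗ[ℝ] V →ₗ[ℝ] ℝ}
    (hB : ∀ x y, B x y = B y x) (s₀ : ℝ) (τ : V →ₗ[ℝ] ℝ) (c s : ℝ) {H : ℝ}
    (hH : H = (1 / 6) * ∑ i, B (f i) (f i)) (i : TorsionClass) (x y : V) :
    part g J f (twist J c s (rForm ρ f (torsion g J ρ f B s₀ τ))) i x y =
    match i with
    | .W1p => c * (H + s₀) * g x y
    | .W1m => s * (H + s₀) * g x (J y)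
    | .W2p => c * ((1 / 2) * (B x y + B (J x) (J y)) - H * g x y)
    | .W2m => s * ((1 / 2) * (B x (J y) - B (J x) y) - H * g x (J y))
    | .W3 => (1 / 2) * (c * (B x y - B (J x) (J y)) + s * (B x (J y) + B (J x) y))
    | .W4 => twist J c s (rForm ρ f (ofTrace g J τ)) x y
    | .W5 => 0 := by
  obtain ⟨w1, w2⟩ := h.rForm_ofTrace τ
  -- The contribution of `τ` stays anti-invariant and skew after the twist, so it enters no
  -- component except `W₄`.
  have hw1 : ∀ x y, twist J c s (rForm ρ f (ofTrace g J τ)) (J x) (J y) =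
      -twist J c s (rForm ρ f (ofTrace g J τ)) x y := fun x y => by
    rw [twist_J_J (t := -1) (by simpa using w1), neg_one_mul]
  have hw2 : ∀ x y, twist J c s (rForm ρ f (ofTrace g J τ)) x y =
      -twist J c s (rForm ρ f (ofTrace g J τ)) y x := fun x y => by
    rw [twist_apply, twist_apply, h.anti_J w1 x y, w2 x y, w2 (J x) y]
    ring
  obtain ⟨t1, t2⟩ := h.trace_of_anti hw1
  have hBJ : ∑ i, B (f i) (J (f i)) = 0 := by
    have := h.sum_J B
    simp only [hB (J _) _] at this
    linarith
  have T1 : trace f (twist J c s (rForm ρ f (torsion g J ρ f B s₀ τ))) = 6 * (c * (H + s₀)) := by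
    simp only [trace] at t1
    simp only [trace, h.twist_torsion, Finset.sum_add_distrib, ← Finset.mul_sum, h.sum_inner_self,
      hBJ, h.inner_J_self, t1, hH, Finset.sum_const_zero]
    ring
  have T2 : traceJ J f (twist J c s (rForm ρ f (torsion g J ρ f B s₀ τ))) =
      -(6 * (s * (H + s₀))) := by
    simp only [traceJ] at t2
    simp only [traceJ, h.twist_torsion, h.J_sq, map_neg, Finset.sum_add_distrib, ← Finset.mul_sum,
      h.sum_inner_self, Finset.sum_neg_distrib, hBJ, h.inner_J_self, t2, hH,
      Finset.sum_const_zero]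
    ring
  rw [part_apply, T1, T2]
  simp only [h.twist_torsion, h.J_sq, map_neg, h.J_isometry, hw1, hw2 y x]
  have e1 : g y x = g x y := h.symm _ _
  have e2 : g y (J x) = -g x (J y) := by rw [h.symm, h.J_skew]
  have e3 : g (J x) y = -g x (J y) := h.J_skew _ _
  have e4 : g (J y) x = g x (J y) := h.symm _ _
  have b1 := hB y x
  have b2 : B y (J x) = B (J x) y := hB _ _
  have b3 : B (J y) x = B x (J y) := hB _ _
  have b4 : B (J y) (J x) = B (J x) (J y) := hB _ _
  cases i <;> simp only [e1, e2, e3, e4, b1, b2, b3, b4] <;> ring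

section Conditions

variable (h : IsSU3Basis g J ρ f) {B : V →ₗ[ℝ] V →ₗ[ℝ] ℝ} (hB : ∀ x y, B x y = B y x) (s₀ : ℝ)
  (τ : V →ₗ[ℝ] ℝ) {c s : ℝ} {H : ℝ} (hH : H = (1 / 6) * ∑ i, B (f i) (f i))

include h hB hH

lemma part_W1p_iff : (∀ x y, part g J f (twist J c s (rForm ρ f (torsion g J ρ f B s₀ τ)))
    .W1p x y = 0) ↔ c * (H + s₀) = 0 := by
  simp only [h.part_torsion hB s₀ τ c s hH]
  refine ⟨fun h0 => ?_, fun h0 x y => by rw [h0, zero_mul]⟩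
  have := h0 (f 0) (f 0)
  simpa [h.ortho] using this

lemma part_W1m_iff : (∀ x y, part g J f (twist J c s (rForm ρ f (torsion g J ρ f B s₀ τ)))
    .W1m x y = 0) ↔ s * (H + s₀) = 0 := by
  simp only [h.part_torsion hB s₀ τ c s hH]
  refine ⟨fun h0 => ?_, fun h0 x y => by rw [h0, zero_mul]⟩
  have := h0 (f 0) (J (f 0))
  rw [h.J_sq, map_neg, h.ortho] at this
  simpa using this

lemma part_W2p_iff : (∀ x y, part g J f (twist J c s (rForm ρ f (torsion g J ρ f B s₀ τ)))
    .W2p x y = 0) ↔ ∀ x y, c * (2 * H * g x y) = c * (B x y + B (J x) (J y)) := by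
  simp only [h.part_torsion hB s₀ τ c s hH]
  exact forall₂_congr fun x y => ⟨fun h0 => by linarith, fun h0 => by linarith⟩

/-- The component is the symmetric form of the `W₂⁺` case with `J` moved into one argument, with `s`
in place of `c`; substituting `Jy` for `y` undoes this. -/
lemma part_W2m_iff : (∀ x y, part g J f (twist J c s (rForm ρ f (torsion g J ρ f B s₀ τ)))
    .W2m x y = 0) ↔ ∀ x y, s * (2 * H * g x y) = s * (B x y + B (J x) (J y)) := by
  simp only [h.part_torsion hB s₀ τ c s hH]
  refine ⟨fun h0 x y => ?_, fun h0 x y => ?_⟩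
  · have := h0 x (J y)
    simp only [h.J_sq, map_neg] at this
    linarith
  · have := h0 x (J y)
    simp only [h.J_sq, map_neg] at this
    linarith

/-- The component is the twist of `½ (B - IB)`. Its values at `y` and `Jy` together invert the
rotation, so the angle drops out. -/
lemma part_W3_iff (hcs : c ^ 2 + s ^ 2 = 1) :
    (∀ x y, part g J f (twist J c s (rForm ρ f (torsion g J ρ f B s₀ τ)))
    .W3 x y = 0) ↔ ∀ x y, B (J x) (J y) = B x y := by
  simp only [h.part_torsion hB s₀ τ c s hH]
  refine ⟨fun h0 x y => ?_, fun h0 x y => ?_⟩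
  · have h1 := h0 x y
    have h2 := h0 x (J y)
    simp only [h.J_sq, map_neg] at h2
    linear_combination -2 * c * h1 + 2 * s * h2 - (B (J x) (J y) - B x y) * hcs
  · have h1 := h0 x (J y)
    simp only [h.J_sq, map_neg] at h1
    rw [h0 x y]
    linear_combination -(1 / 2) * s * h1

/-- The twist is invertible and `rForm` injective, so a vanishing component kills the `W₄` tensor
and with it its trace `τ`. -/
lemma part_W4_iff (hcs : c ^ 2 + s ^ 2 = 1) :
    (∀ x y, part g J f (twist J c s (rForm ρ f (torsion g J ρ f B s₀ τ)))
    .W4 x y = 0) ↔ ∀ x, τ x = 0 := by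
  simp only [h.part_torsion hB s₀ τ c s hH]
  refine ⟨fun h0 x => ?_, fun h0 x y => ?_⟩
  · have h1 := h.rForm_eq_zero (h.ofTrace_mem_W4 τ).1 (fun x y => by
      have h1 := h0 x y
      have h2 := h0 x (J y)
      simp only [twist_apply, h.J_sq, map_neg] at h1 h2
      linear_combination c * h1 - s * h2 - (rForm ρ f (ofTrace g J τ) x y) * hcs)
    rw [← h.tr12_ofTrace τ x, h1]
    simp [tr12]
  · have : ofTrace g J τ = 0 := by
      ext x y z
      simp [ofTrace_apply, h0]
    rw [this, rForm_zero, twist_apply]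
    simp

end Conditions

lemma part_W5 (r : V →ₗ[ℝ] V →ₗ[ℝ] ℝ) (x y : V) : part g J f r .W5 x y = 0 := by
  rw [part_apply]

lemma sum_fin_three {α : Type*} [AddCommMonoid α] (F : (Fin 3 → Fin 6) → α) :
    ∑ i, F i = ∑ a, ∑ b, ∑ c, F ![a, b, c] := by
  rw [← (Fin.consEquiv fun _ : Fin 3 => Fin 6).sum_comp, Fintype.sum_prod_type]
  refine Finset.sum_congr rfl fun a _ => ?_
  rw [← (finTwoArrowEquiv (Fin 6)).symm.sum_comp, Fintype.sum_prod_type]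
  rfl

/-- The Kähler form contracts to zero with `ρ (y, ·, ·)`, and the remaining two terms agree by
skewness. -/
lemma sum_mul_rho (h : IsSU3Basis g J ρ f) (μ : V →ₗ[ℝ] ℝ) (x y : V) :
    ∑ i, ∑ j, (μ x * g (J (f i)) (f j) - μ (f i) * g (J x) (f j) + μ (f j) * g (J x) (f i)) *
      ρ y (f i) (f j) = -(2 * ∑ i, μ (f i) * ρ y (f i) (J x)) := by
  have h1 : ∀ i, ∑ j, g (J (f i)) (f j) * ρ y (f i) (f j) = 0 := by
    intro i
    rw [h.sum_inner_mul (ρ y (f i)), ← h.rho_J', h.rot, h.rho_J_self]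
  have h2 : ∀ i, ∑ j, g (J x) (f j) * ρ y (f i) (f j) = ρ y (f i) (J x) := fun i =>
    h.sum_inner_mul (ρ y (f i)) (J x)
  have h3 : ∀ j, ∑ i, g (J x) (f i) * ρ y (f i) (f j) = -ρ y (f j) (J x) := by
    intro j
    have := h.sum_inner_mul ((ρ y).flip (f j)) (J x)
    simp only [LinearMap.flip_apply] at this
    rw [this, h.swap23]
  have e1 : ∑ i, ∑ j, μ x * g (J (f i)) (f j) * ρ y (f i) (f j) = 0 := by
    simp only [mul_assoc, ← Finset.mul_sum, h1, mul_zero, Finset.sum_const_zero]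
  have e2 : ∑ i, ∑ j, μ (f i) * g (J x) (f j) * ρ y (f i) (f j) =
      ∑ i, μ (f i) * ρ y (f i) (J x) := by
    simp only [mul_assoc, ← Finset.mul_sum, h2]
  have e3 : ∑ i, ∑ j, μ (f j) * g (J x) (f i) * ρ y (f i) (f j) =
      -∑ i, μ (f i) * ρ y (f i) (J x) := by
    rw [Finset.sum_comm]
    simp only [mul_assoc, ← Finset.mul_sum, h3, mul_neg, Finset.sum_neg_distrib]
  simp only [add_mul, sub_mul, Finset.sum_add_distrib, Finset.sum_sub_distrib, e1, e2, e3]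
  ring

/-- The `ψ₋`-component of a derivative of `ψ₊`. -/
lemma formInner_deriv (h : IsSU3Basis g J ρ f) (hf : f = onFrame 6 fun x y => g x y)
    {c s t a : ℝ} (hcs : c ^ 2 + s ^ 2 = 1) (μ : V →ₗ[ℝ] ℝ) (K : V → V)
    (hK : ∀ y z, g y (K z) = -g z (K y)) (hKJ : ∀ y z, g (J y) (K (J z)) = -g y (K z))
    {R : V → V → V → ℝ} (hR : ∀ x y z, R x y z = -(a * ρ (J x) y z) +
      (μ x * g (J y) z - μ y * g (J x) z + μ z * g (J x) y))
    {Ψ Ψ' : (Fin 3 → V) → ℝ}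
    (hΨ : ∀ x y z, Ψ ![x, y, z] = c * R x y z + s * (R (J x) y z + ρ (K x) y z)
      + t * (-(s * ρ x y z) + c * ρ (J x) y z))
    (hΨ' : ∀ x y z, Ψ' ![x, y, z] = s * ρ x y z - c * ρ (J x) y z) :
    formInner 6 (fun x y => g x y) Ψ Ψ' = 4 * (a - t) := by
  -- `Q` is the contribution of `μ`. It vanishes at `(x, x)` and `(x, Jx)`, so `μ` does not affect
  -- the pairing with `ψ₋`.
  set Q : V → V → ℝ := fun x y => -(2 * ∑ i, μ (f i) * ρ y (f i) (J x)) with hQ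
  have hR' : ∀ x y, ∑ i, ∑ j, R x (f i) (f j) * ρ y (f i) (f j) =
      -(4 * a * g (J x) y) + Q x y := by
    intro x y
    have e : ∀ i j, R x (f i) (f j) * ρ y (f i) (f j) =
        -a * (ρ (J x) (f i) (f j) * ρ y (f i) (f j)) + (μ x * g (J (f i)) (f j)
          - μ (f i) * g (J x) (f j) + μ (f j) * g (J x) (f i)) * ρ y (f i) (f j) := by
      intro i j
      rw [hR]
      ring
    simp only [e, Finset.sum_add_distrib, ← Finset.mul_sum, h.contract23, h.sum_mul_rho, hQ]
    ring
  have r1 : ∀ u v : V, ρ v u v = 0 := by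
    intro u v
    rw [h.swap23, h.rho_self, neg_zero]
  have q1 : ∀ x, Q x x = 0 := by
    intro x
    simp only [hQ, ← h.rho_J', r1, mul_zero, Finset.sum_const_zero, neg_zero]
  have q2 : ∀ x, Q x (J x) = 0 := by
    intro x
    simp only [hQ, r1, mul_zero, Finset.sum_const_zero, neg_zero]
  have key : ∀ x y, ∑ i, ∑ j, Ψ ![x, f i, f j] * ρ y (f i) (f j) =
      c * (-(4 * a * g (J x) y) + Q x y) + s * (4 * a * g x y + Q (J x) y + 4 * g (K x) y)
        + t * (-(s * (4 * g x y)) + c * (4 * g (J x) y)) := by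
    intro x y
    have e : ∀ i j, Ψ ![x, f i, f j] * ρ y (f i) (f j) =
        c * (R x (f i) (f j) * ρ y (f i) (f j)) + s * (R (J x) (f i) (f j) * ρ y (f i) (f j))
        + s * (ρ (K x) (f i) (f j) * ρ y (f i) (f j))
        + (-(t * s)) * (ρ x (f i) (f j) * ρ y (f i) (f j))
        + (t * c) * (ρ (J x) (f i) (f j) * ρ y (f i) (f j)) := by
      intro i j
      rw [hΨ]
      ring
    simp only [e, Finset.sum_add_distrib, ← Finset.mul_sum, hR', h.contract23, h.J_sq, map_neg,
      LinearMap.neg_apply]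
    ring
  -- `K` is skew and anticommutes with `J`; hence `Kx` is orthogonal to `x` and to `Jx`, and the
  -- derivative of `J` drops out too.
  have hKt : ∀ x, g (K x) x = 0 := by
    intro x
    have := hK x x
    rw [h.symm]
    linarith
  have hKt' : ∀ x, g (K x) (J x) = 0 := by
    intro x
    have h1 := hKJ (J x) x
    have h2 := hK (J x) x
    rw [h.J_sq, map_neg, LinearMap.neg_apply] at h1
    rw [h.symm]
    linarith
  have tot : ∀ x, ∑ i, ∑ j, Ψ ![x, f i, f j] * Ψ' ![x, f i, f j] = 4 * (a - t) * g x x := by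
    intro x
    have e : ∀ i j, Ψ ![x, f i, f j] * Ψ' ![x, f i, f j] =
        s * (Ψ ![x, f i, f j] * ρ x (f i) (f j)) - c * (Ψ ![x, f i, f j] * ρ (J x) (f i) (f j)) := by
      intro i j
      rw [hΨ']
      ring
    have q4 : Q (J x) x = 0 := by
      have := q2 (J x)
      rw [h.J_sq] at this
      simpa [hQ] using this
    have i1 : g (J x) x = 0 := by rw [h.symm, h.inner_J_self]
    simp only [e, Finset.sum_sub_distrib, ← Finset.mul_sum, key, q1, q2, q4, hKt, hKt', i1,
      h.inner_J_self, h.J_isometry]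
    linear_combination 4 * (a - t) * g x x * hcs
  rw [formInner, ← hf, sum_fin_three]
  have : ∀ a b c : Fin 6, (fun s => f ((![a, b, c] : Fin 3 → Fin 6) s)) = ![f a, f b, f c] := by
    intro a b c
    funext s
    fin_cases s <;> rfl
  simp only [this, tot, ← Finset.mul_sum, h.sum_inner_self]
  norm_num [Nat.factorial]
  ring

end IsSU3Basis

end SU3Algebra

end G2Hyp
end

/-! ### Gauss and Weingarten formulas in coordinates. -/

noncomputable section

set_option maxSynthPendingDepth 3

namespace G2Hyp

section ChartCalculus

open Filter Topology

variable {E F : Type*} [NormedAddCommGroup E] [NormedSpace ℝ E] [NormedAddCommGroup F]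
  [NormedSpace ℝ F]

lemma hasFDerivAt_bilin {X Y : Type*} [NormedAddCommGroup X] [NormedSpace ℝ X]
    [NormedAddCommGroup Y] [NormedSpace ℝ Y] {C : E → X →L[ℝ] Y →L[ℝ] ℝ}
    {C' : E →L[ℝ] X →L[ℝ] Y →L[ℝ] ℝ} {a : E → X} {a' : E →L[ℝ] X} {b : E → Y} {b' : E →L[ℝ] Y}
    {z : E} (hC : HasFDerivAt C C' z) (ha : HasFDerivAt a a' z) (hb : HasFDerivAt b b' z) :
    ∃ D : E →L[ℝ] ℝ, HasFDerivAt (fun z => C z (a z) (b z)) D z ∧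
      ∀ u, D u = C' u (a z) (b z) + C z (a' u) (b z) + C z (a z) (b' u) := by
  have h1 := (hC.clm_apply ha).clm_apply hb
  refine ⟨_, h1, fun u => ?_⟩
  simp
  ring

lemma hasFDerivAt_trilin {X : Type*} [NormedAddCommGroup X] [NormedSpace ℝ X]
    {C : E → X →L[ℝ] X →L[ℝ] X →L[ℝ] ℝ} {C' : E →L[ℝ] X →L[ℝ] X →L[ℝ] X →L[ℝ] ℝ}
    {a b c : E → X} {a' b' c' : E →L[ℝ] X} {z : E} (hC : HasFDerivAt C C' z)
    (ha : HasFDerivAt a a' z) (hb : HasFDerivAt b b' z) (hc : HasFDerivAt c c' z) :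
    ∃ D : E →L[ℝ] ℝ, HasFDerivAt (fun z => C z (a z) (b z) (c z)) D z ∧
      ∀ u, D u = C' u (a z) (b z) (c z) + C z (a' u) (b z) (c z) + C z (a z) (b' u) (c z)
        + C z (a z) (b z) (c' u) := by
  have h1 := ((hC.clm_apply ha).clm_apply hb).clm_apply hc
  refine ⟨_, h1, fun u => ?_⟩
  simp
  ring

/-- A linear map is a fixed combination of its values on a finite basis, so it is enough to
differentiate those values. -/
lemma differentiableAt_clm_of_apply [FiniteDimensional ℝ F] {X : Type*} [NormedAddCommGroup X]
    [NormedSpace ℝ X] {A : E → F →L[ℝ] X} {z : E}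
    (h : ∀ v, DifferentiableAt ℝ (fun z => A z v) z) : DifferentiableAt ℝ A z := by
  let b := Module.finBasis ℝ F
  have key : A = fun z => ∑ i,
      ContinuousLinearMap.smulRightL ℝ F X (LinearMap.toContinuousLinearMap (b.coord i))
        (A z (b i)) := by
    funext z
    ext v
    conv_lhs => rw [← b.sum_repr v]
    simp only [map_sum, map_smul, sum_apply]
    rfl
  rw [key]
  exact DifferentiableAt.fun_sum fun i _ =>
    (ContinuousLinearMap.differentiableAt _).comp z (h (b i))

/-- The coordinate expression of a hypersurface with unit normal field `ν`, in a space with a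
metric `G` and a three-form `T`, near `z`. -/
structure IsChartHypersurface (G : F → F →L[ℝ] F →L[ℝ] ℝ) (T : F → F →L[ℝ] F →L[ℝ] F →L[ℝ] ℝ)
    (f ν : E → F) (z : E) : Prop where
  diff : ∀ᶠ w in 𝓝 z, DifferentiableAt ℝ f w
  diff₂ : DifferentiableAt ℝ (fderiv ℝ f) z
  diffG : DifferentiableAt ℝ G (f z)
  diffT : DifferentiableAt ℝ T (f z)
  diffν : DifferentiableAt ℝ ν z
  symmG : ∀ y a b, G y a b = G y b a
  swapT12 : ∀ y a b c, T y a b c = -T y b a c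
  swapT23 : ∀ y a b c, T y a b c = -T y a c b
  unit : ∀ᶠ w in 𝓝 z, G (f w) (ν w) (ν w) = 1
  orth : ∀ᶠ w in 𝓝 z, ∀ v, G (f w) (ν w) (fderiv ℝ f w v) = 0
  nondeg : ∀ a, G (f z) (ν z) a = 0 → (∀ v, G (f z) a (fderiv ℝ f z v) = 0) → a = 0

/-- `Γ` is the Christoffel symbol at `y` of the metric `G`. -/
def IsChristoffel (G : F → F →L[ℝ] F →L[ℝ] ℝ) (y : F) (Γ : F → F → F) : Prop :=
  ∀ a b c, 2 * G y (Γ a b) c =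
    fderiv ℝ G y a b c + fderiv ℝ G y b a c - fderiv ℝ G y c a b

lemma fderiv_symm {G : F → F →L[ℝ] F →L[ℝ] ℝ} {y : F} (hG : DifferentiableAt ℝ G y)
    (hs : ∀ y a b, G y a b = G y b a) (u a b : F) : fderiv ℝ G y u a b = fderiv ℝ G y u b a := by
  obtain ⟨D, hD, hD'⟩ := hasFDerivAt_bilin hG.hasFDerivAt (hasFDerivAt_const a y)
    (hasFDerivAt_const b y)
  obtain ⟨D₂, hD₂, hD₂'⟩ := hasFDerivAt_bilin hG.hasFDerivAt (hasFDerivAt_const b y)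
    (hasFDerivAt_const a y)
  simp only [hs _ a b] at hD
  have := hD.unique hD₂
  have h1 := hD' u
  rw [this, hD₂'] at h1
  simpa using h1.symm

/-- Adding the Koszul formula for `(a, b, c)` and `(a, c, b)` leaves only the derivative along `a`.
-/
lemma IsChristoffel.compat {G : F → F →L[ℝ] F →L[ℝ] ℝ} {y : F} {Γ : F → F → F}
    (h : IsChristoffel G y Γ) (hG : DifferentiableAt ℝ G y) (hs : ∀ y a b, G y a b = G y b a)
    (a b c : F) : fderiv ℝ G y a b c = G y (Γ a b) c + G y b (Γ a c) := by
  have h1 := h a b c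
  have h2 := h a c b
  have h3 := fderiv_symm hG hs a b c
  have h4 := fderiv_symm hG hs b a c
  have h5 := fderiv_symm hG hs c a b
  rw [hs y b (Γ a c)]
  linarith

/-- The covariant derivative of a three-form. -/
def covT (T : F → F →L[ℝ] F →L[ℝ] F →L[ℝ] ℝ) (Γ : F → F → F) (y a b c d : F) : ℝ :=
  fderiv ℝ T y a b c d - T y (Γ a b) c d - T y b (Γ a c) d - T y b c (Γ a d)

/-- The induced metric. -/
def indG (G : F → F →L[ℝ] F →L[ℝ] ℝ) (f : E → F) (w : E) : E →L[ℝ] E →L[ℝ] ℝ :=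
  (G (f w)).bilinearComp (fderiv ℝ f w) (fderiv ℝ f w)

/-- The induced Kähler form. -/
def indω (T : F → F →L[ℝ] F →L[ℝ] F →L[ℝ] ℝ) (f ν : E → F) (w : E) : E →L[ℝ] E →L[ℝ] ℝ :=
  -(T (f w) (ν w)).bilinearComp (fderiv ℝ f w) (fderiv ℝ f w)

lemma indG_apply (G : F → F →L[ℝ] F →L[ℝ] ℝ) (f : E → F) (w a b : E) :
    indG G f w a b = G (f w) (fderiv ℝ f w a) (fderiv ℝ f w b) := rfl

lemma indω_apply (T : F → F →L[ℝ] F →L[ℝ] F →L[ℝ] ℝ) (f ν : E → F) (w a b : E) :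
    indω T f ν w a b = -T (f w) (ν w) (fderiv ℝ f w a) (fderiv ℝ f w b) := rfl

namespace IsChartHypersurface

variable {G : F → F →L[ℝ] F →L[ℝ] ℝ} {T : F → F →L[ℝ] F →L[ℝ] F →L[ℝ] ℝ}
    {f ν : E → F} {z : E}

lemma hasFDerivAt_push (h : IsChartHypersurface G T f ν z) (v : E) :
    HasFDerivAt (fun w => fderiv ℝ f w v) ((fderiv ℝ (fderiv ℝ f) z).flip v) z := by
  have := h.diff₂.hasFDerivAt.clm_apply (hasFDerivAt_const v z)
  convert this using 1
  ext u
  simp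

lemma hasFDerivAt_G (h : IsChartHypersurface G T f ν z) :
    HasFDerivAt (fun w => G (f w)) ((fderiv ℝ G (f z)).comp (fderiv ℝ f z)) z :=
  HasFDerivAt.comp z (g := G) h.diffG.hasFDerivAt h.diff.self_of_nhds.hasFDerivAt

lemma hasFDerivAt_T (h : IsChartHypersurface G T f ν z) :
    HasFDerivAt (fun w => T (f w)) ((fderiv ℝ T (f z)).comp (fderiv ℝ f z)) z :=
  HasFDerivAt.comp z (g := T) h.diffT.hasFDerivAt h.diff.self_of_nhds.hasFDerivAt

lemma fderiv₂_symm (h : IsChartHypersurface G T f ν z) (u v : E) :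
    fderiv ℝ (fderiv ℝ f) z u v = fderiv ℝ (fderiv ℝ f) z v u :=
  second_derivative_symmetric_of_eventually (h.diff.mono fun _ hw => hw.hasFDerivAt)
    h.diff₂.hasFDerivAt u v

lemma hasFDerivAt_indG_apply (h : IsChartHypersurface G T f ν z) (a b : E) :
    ∃ D : E →L[ℝ] ℝ, HasFDerivAt (fun w => indG G f w a b) D z ∧ ∀ u, D u =
      fderiv ℝ G (f z) (fderiv ℝ f z u) (fderiv ℝ f z a) (fderiv ℝ f z b) +
      G (f z) (fderiv ℝ (fderiv ℝ f) z u a) (fderiv ℝ f z b) +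
      G (f z) (fderiv ℝ f z a) (fderiv ℝ (fderiv ℝ f) z u b) := by
  obtain ⟨D, hD, hD'⟩ := hasFDerivAt_bilin h.hasFDerivAt_G (h.hasFDerivAt_push a)
    (h.hasFDerivAt_push b)
  exact ⟨D, hD, fun u => by rw [hD']; rfl⟩

lemma differentiableAt_indG [FiniteDimensional ℝ E] (h : IsChartHypersurface G T f ν z) :
    DifferentiableAt ℝ (indG G f) z :=
  differentiableAt_clm_of_apply fun a => differentiableAt_clm_of_apply fun b => by
    obtain ⟨D, hD, -⟩ := h.hasFDerivAt_indG_apply a b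
    exact hD.differentiableAt

lemma fderiv_clm_apply₂ {C : E → E →L[ℝ] E →L[ℝ] ℝ} {D : E →L[ℝ] ℝ} {a b : E}
    (hC : DifferentiableAt ℝ C z) (hD : HasFDerivAt (fun w => C w a b) D z) (u : E) :
    fderiv ℝ C z u a b = D u := by
  obtain ⟨D₂, hD₂, hD₂'⟩ := hasFDerivAt_bilin hC.hasFDerivAt (hasFDerivAt_const a z)
    (hasFDerivAt_const b z)
  rw [hD.unique hD₂, hD₂']
  simp

lemma fderiv_indG [FiniteDimensional ℝ E] (h : IsChartHypersurface G T f ν z) (u a b : E) :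
    fderiv ℝ (indG G f) z u a b =
      fderiv ℝ G (f z) (fderiv ℝ f z u) (fderiv ℝ f z a) (fderiv ℝ f z b) +
      G (f z) (fderiv ℝ (fderiv ℝ f) z u a) (fderiv ℝ f z b) +
      G (f z) (fderiv ℝ f z a) (fderiv ℝ (fderiv ℝ f) z u b) := by
  obtain ⟨D, hD, hD'⟩ := h.hasFDerivAt_indG_apply a b
  rw [fderiv_clm_apply₂ h.differentiableAt_indG hD, hD']

lemma indG_symm (h : IsChartHypersurface G T f ν z) (w a b : E) :
    indG G f w a b = indG G f w b a := h.symmG _ _ _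

lemma hasFDerivAt_indω_apply (h : IsChartHypersurface G T f ν z) (a b : E) :
    ∃ D : E →L[ℝ] ℝ, HasFDerivAt (fun w => indω T f ν w a b) D z ∧ ∀ u, D u =
      -(fderiv ℝ T (f z) (fderiv ℝ f z u) (ν z) (fderiv ℝ f z a) (fderiv ℝ f z b) +
      T (f z) (fderiv ℝ ν z u) (fderiv ℝ f z a) (fderiv ℝ f z b) +
      T (f z) (ν z) (fderiv ℝ (fderiv ℝ f) z u a) (fderiv ℝ f z b) +
      T (f z) (ν z) (fderiv ℝ f z a) (fderiv ℝ (fderiv ℝ f) z u b)) := by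
  obtain ⟨D, hD, hD'⟩ := hasFDerivAt_trilin h.hasFDerivAt_T h.diffν.hasFDerivAt
    (h.hasFDerivAt_push a) (h.hasFDerivAt_push b)
  exact ⟨-D, hD.neg, fun u => by rw [neg_apply, hD']; rfl⟩

lemma differentiableAt_indω [FiniteDimensional ℝ E] (h : IsChartHypersurface G T f ν z) :
    DifferentiableAt ℝ (indω T f ν) z :=
  differentiableAt_clm_of_apply fun a => differentiableAt_clm_of_apply fun b => by
    obtain ⟨D, hD, -⟩ := h.hasFDerivAt_indω_apply a b
    exact hD.differentiableAt

lemma fderiv_indω [FiniteDimensional ℝ E] (h : IsChartHypersurface G T f ν z) (u a b : E) :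
    fderiv ℝ (indω T f ν) z u a b =
      -(fderiv ℝ T (f z) (fderiv ℝ f z u) (ν z) (fderiv ℝ f z a) (fderiv ℝ f z b) +
      T (f z) (fderiv ℝ ν z u) (fderiv ℝ f z a) (fderiv ℝ f z b) +
      T (f z) (ν z) (fderiv ℝ (fderiv ℝ f) z u a) (fderiv ℝ f z b) +
      T (f z) (ν z) (fderiv ℝ f z a) (fderiv ℝ (fderiv ℝ f) z u b)) := by
  obtain ⟨D, hD, hD'⟩ := h.hasFDerivAt_indω_apply a b
  rw [fderiv_clm_apply₂ h.differentiableAt_indω hD, hD']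

variable {Γ' : F → F → F} {Γ : E → E → E}

/-- The ambient covariant derivative of a coordinate field along the hypersurface. -/
def covPush (f : E → F) (Γ' : F → F → F) (z u v : E) : F :=
  fderiv ℝ (fderiv ℝ f) z u v + Γ' (fderiv ℝ f z u) (fderiv ℝ f z v)

/-- The second fundamental form. -/
def chartB (G : F → F →L[ℝ] F →L[ℝ] ℝ) (f ν : E → F) (Γ' : F → F → F) (z u v : E) : ℝ :=
  G (f z) (covPush f Γ' z u v) (ν z)

/-- The Gauss formula. -/
lemma gauss [FiniteDimensional ℝ E] (h : IsChartHypersurface G T f ν z)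
    (hΓ' : IsChristoffel G (f z) Γ') (hΓ : IsChristoffel (indG G f) z Γ) (u v : E) :
    covPush f Γ' z u v = fderiv ℝ f z (Γ u v) + chartB G f ν Γ' z u v • ν z := by
  rw [← sub_eq_zero]
  have h0 := fun x => h.orth.self_of_nhds x
  -- The difference is tested against the normal and against tangent vectors. Tangentially the
  -- Koszul formulas of the two metrics are compared, and the second derivatives of `f` match by
  -- their symmetry.
  apply h.nondeg
  · simp only [map_sub, map_add, map_smul, h0, h.unit.self_of_nhds, smul_eq_mul, chartB]
    rw [h.symmG]
    ring
  · intro w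
    have h1 := hΓ u v w
    have h2 := hΓ' (fderiv ℝ f z u) (fderiv ℝ f z v) (fderiv ℝ f z w)
    simp only [h.fderiv_indG, indG_apply] at h1
    simp only [covPush, map_sub, map_add, map_smul, sub_apply,
      add_apply, smul_apply, h0, smul_zero]
    have s1 := h.fderiv₂_symm u v
    have s2 := h.fderiv₂_symm u w
    have s3 := h.fderiv₂_symm v w
    rw [s2, s3, ← s1] at h1
    have t1 := h.symmG (f z) (fderiv ℝ f z v) (fderiv ℝ (fderiv ℝ f) z w u)
    have t2 := h.symmG (f z) (fderiv ℝ f z u) (fderiv ℝ (fderiv ℝ f) z w v)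
    linarith

/-- The Weingarten formula. -/
lemma weingarten [FiniteDimensional ℝ E] (h : IsChartHypersurface G T f ν z)
    (hΓ' : IsChristoffel G (f z) Γ') (u : E) {a : E}
    (ha : ∀ v, indG G f z a v = chartB G f ν Γ' z u v) :
    fderiv ℝ ν z u + Γ' (fderiv ℝ f z u) (ν z) = -fderiv ℝ f z a := by
  rw [← sub_eq_zero, sub_neg_eq_add]
  have h0 := fun x => h.orth.self_of_nhds x
  have compat := hΓ'.compat h.diffG h.symmG
  apply h.nondeg
  -- The normal part comes from differentiating `⟨ν, ν⟩ = 1`; the tangential part below comes from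
  -- `⟨ν, df w⟩ = 0`.
  · obtain ⟨D, hD, hD'⟩ := hasFDerivAt_bilin h.hasFDerivAt_G h.diffν.hasFDerivAt
      h.diffν.hasFDerivAt
    have h1 := hD.unique ((hasFDerivAt_const (1 : ℝ) z).congr_of_eventuallyEq h.unit)
    have h2 := hD' u
    rw [h1, ContinuousLinearMap.comp_apply, compat] at h2
    simp only [zero_apply] at h2
    simp only [map_add, h0]
    have s1 := h.symmG (f z) (ν z) (Γ' (fderiv ℝ f z u) (ν z))
    have s2 := h.symmG (f z) (ν z) (fderiv ℝ ν z u)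
    linarith
  · intro w
    obtain ⟨D, hD, hD'⟩ := hasFDerivAt_bilin h.hasFDerivAt_G h.diffν.hasFDerivAt
      (h.hasFDerivAt_push w)
    have h1 := hD.unique ((hasFDerivAt_const (0 : ℝ) z).congr_of_eventuallyEq
      (h.orth.mono fun x hx => hx w))
    have h2 := hD' u
    rw [h1, ContinuousLinearMap.comp_apply, compat] at h2
    simp only [zero_apply, ContinuousLinearMap.flip_apply] at h2
    have h3 := ha w
    simp only [chartB, covPush, indG_apply, map_add, add_apply] at h3
    simp only [map_add, add_apply]
    rw [h.symmG _ (fderiv ℝ (fderiv ℝ f) z u w), h.symmG _ (Γ' (fderiv ℝ f z u) _)] at h3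
    linarith

/-- The covariant derivative of the induced Kähler form. -/
lemma cov_indω [FiniteDimensional ℝ E] (h : IsChartHypersurface G T f ν z)
    (hΓ' : IsChristoffel G (f z) Γ') (hΓ : IsChristoffel (indG G f) z Γ) (u v w : E) {a : E}
    (ha : ∀ v, indG G f z a v = chartB G f ν Γ' z u v) :
    fderiv ℝ (indω T f ν) z u v w - indω T f ν z (Γ u v) w - indω T f ν z v (Γ u w) =
      -covT T Γ' (f z) (fderiv ℝ f z u) (ν z) (fderiv ℝ f z v) (fderiv ℝ f z w)
        + T (f z) (fderiv ℝ f z a) (fderiv ℝ f z v) (fderiv ℝ f z w) := by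
  have hN := h.weingarten hΓ' u ha
  have hv := h.gauss hΓ' hΓ u v
  have hw := h.gauss hΓ' hΓ u w
  have e1 := congrArg (fun x => T (f z) x (fderiv ℝ f z v) (fderiv ℝ f z w)) hN
  have e2 := congrArg (fun x => T (f z) (ν z) x (fderiv ℝ f z w)) hv
  have e3 := congrArg (fun x => T (f z) (ν z) (fderiv ℝ f z v) x) hw
  -- The normal terms of the Gauss formula disappear, since `ν` already occupies a slot of `T`.
  have z1 : ∀ x, T (f z) (ν z) (ν z) x = 0 := fun x => by
    linarith [h.swapT12 (f z) (ν z) (ν z) x]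
  have z2 : ∀ x, T (f z) (ν z) x (ν z) = 0 := fun x => by
    rw [h.swapT23, z1, neg_zero]
  simp only [covPush, map_add, map_neg, map_smul, add_apply,
    neg_apply, smul_apply, z1, z2, smul_zero,
    add_zero] at e1 e2 e3
  rw [h.fderiv_indω]
  simp only [indω_apply, covT]
  linarith

/-- The induced three-form. -/
def indT (T : F → F →L[ℝ] F →L[ℝ] F →L[ℝ] ℝ) (f : E → F) (w a b c : E) : ℝ :=
  T (f w) (fderiv ℝ f w a) (fderiv ℝ f w b) (fderiv ℝ f w c)

lemma hasFDerivAt_indT (h : IsChartHypersurface G T f ν z) {a b c : E → E}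
    {a' b' c' : E →L[ℝ] E} (ha : HasFDerivAt a a' z) (hb : HasFDerivAt b b' z)
    (hc : HasFDerivAt c c' z) :
    ∃ D : E →L[ℝ] ℝ, HasFDerivAt (fun w => indT T f w (a w) (b w) (c w)) D z ∧ ∀ u, D u =
      fderiv ℝ T (f z) (fderiv ℝ f z u) (fderiv ℝ f z (a z)) (fderiv ℝ f z (b z))
        (fderiv ℝ f z (c z)) +
      T (f z) (fderiv ℝ (fderiv ℝ f) z u (a z) + fderiv ℝ f z (a' u)) (fderiv ℝ f z (b z))
        (fderiv ℝ f z (c z)) +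
      T (f z) (fderiv ℝ f z (a z)) (fderiv ℝ (fderiv ℝ f) z u (b z) + fderiv ℝ f z (b' u))
        (fderiv ℝ f z (c z)) +
      T (f z) (fderiv ℝ f z (a z)) (fderiv ℝ f z (b z))
        (fderiv ℝ (fderiv ℝ f) z u (c z) + fderiv ℝ f z (c' u)) := by
  obtain ⟨D, hD, hD'⟩ := hasFDerivAt_trilin h.hasFDerivAt_T
    (h.diff₂.hasFDerivAt.clm_apply ha) (h.diff₂.hasFDerivAt.clm_apply hb)
    (h.diff₂.hasFDerivAt.clm_apply hc)
  refine ⟨D, hD, fun u => ?_⟩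
  rw [hD']
  simp only [ContinuousLinearMap.comp_apply, add_apply,
    ContinuousLinearMap.flip_apply, map_add]
  ring

/-- The covariant derivative of the induced three-form. -/
def covIndT (G : F → F →L[ℝ] F →L[ℝ] ℝ) (T : F → F →L[ℝ] F →L[ℝ] F →L[ℝ] ℝ)
    (f ν : E → F) (Γ' : F → F → F) (z u a b c : E) : ℝ :=
  covT T Γ' (f z) (fderiv ℝ f z u) (fderiv ℝ f z a) (fderiv ℝ f z b) (fderiv ℝ f z c)
    + chartB G f ν Γ' z u a * T (f z) (ν z) (fderiv ℝ f z b) (fderiv ℝ f z c)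
    + chartB G f ν Γ' z u b * T (f z) (fderiv ℝ f z a) (ν z) (fderiv ℝ f z c)
    + chartB G f ν Γ' z u c * T (f z) (fderiv ℝ f z a) (fderiv ℝ f z b) (ν z)

lemma covIndT_eq [FiniteDimensional ℝ E] (h : IsChartHypersurface G T f ν z)
    (hΓ' : IsChristoffel G (f z) Γ') (hΓ : IsChristoffel (indG G f) z Γ) (u a b c : E) :
    covIndT G T f ν Γ' z u a b c =
      fderiv ℝ T (f z) (fderiv ℝ f z u) (fderiv ℝ f z a) (fderiv ℝ f z b) (fderiv ℝ f z c) +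
      T (f z) (fderiv ℝ (fderiv ℝ f) z u a - fderiv ℝ f z (Γ u a)) (fderiv ℝ f z b)
        (fderiv ℝ f z c) +
      T (f z) (fderiv ℝ f z a) (fderiv ℝ (fderiv ℝ f) z u b - fderiv ℝ f z (Γ u b))
        (fderiv ℝ f z c) +
      T (f z) (fderiv ℝ f z a) (fderiv ℝ f z b)
        (fderiv ℝ (fderiv ℝ f) z u c - fderiv ℝ f z (Γ u c)) := by
  have e1 := congrArg (fun x => T (f z) x (fderiv ℝ f z b) (fderiv ℝ f z c)) (h.gauss hΓ' hΓ u a)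
  have e2 := congrArg (fun x => T (f z) (fderiv ℝ f z a) x (fderiv ℝ f z c)) (h.gauss hΓ' hΓ u b)
  have e3 := congrArg (fun x => T (f z) (fderiv ℝ f z a) (fderiv ℝ f z b) x) (h.gauss hΓ' hΓ u c)
  simp only [covPush, map_add, map_smul, add_apply,
    smul_apply, smul_eq_mul] at e1 e2 e3
  simp only [covIndT, covT, map_sub, sub_apply]
  linarith

/-- The covariant derivative of the complex volume form
`cos θ T (x, y, w) + sin θ T (J x, y, w)`. -/
lemma cov_volume [FiniteDimensional ℝ E] (h : IsChartHypersurface G T f ν z)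
    (hΓ' : IsChristoffel G (f z) Γ') (hΓ : IsChristoffel (indG G f) z Γ)
    {J : E → E →L[ℝ] E} {J' : E →L[ℝ] E →L[ℝ] E} (hJ : HasFDerivAt J J' z) {θ : E → ℝ}
    {θ' : E →L[ℝ] ℝ} (hθ : HasFDerivAt θ θ' z) (u a b c : E) :
    fderiv ℝ (fun w => Real.cos (θ w) * indT T f w a b c
        + Real.sin (θ w) * indT T f w (J w a) b c) z u
      - ((Real.cos (θ z) * indT T f z (Γ u a) b c
            + Real.sin (θ z) * indT T f z (J z (Γ u a)) b c)
        + (Real.cos (θ z) * indT T f z a (Γ u b) c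
            + Real.sin (θ z) * indT T f z (J z a) (Γ u b) c)
        + (Real.cos (θ z) * indT T f z a b (Γ u c)
            + Real.sin (θ z) * indT T f z (J z a) b (Γ u c))) =
      Real.cos (θ z) * covIndT G T f ν Γ' z u a b c
        + Real.sin (θ z) * (covIndT G T f ν Γ' z u (J z a) b c
          + indT T f z (J' u a + Γ u (J z a) - J z (Γ u a)) b c)
        + θ' u * (-(Real.sin (θ z) * indT T f z a b c)
          + Real.cos (θ z) * indT T f z (J z a) b c) := by
  obtain ⟨D, hD, hD'⟩ := h.hasFDerivAt_indT (hasFDerivAt_const a z) (hasFDerivAt_const b z)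
    (hasFDerivAt_const c z)
  obtain ⟨D₂, hD₂, hD₂'⟩ := h.hasFDerivAt_indT (hJ.clm_apply (hasFDerivAt_const a z))
    (hasFDerivAt_const b z) (hasFDerivAt_const c z)
  have hF := ((hθ.cos.mul hD).add (hθ.sin.mul hD₂)).fderiv
  have hF' : fderiv ℝ (fun w => Real.cos (θ w) * indT T f w a b c
      + Real.sin (θ w) * indT T f w (J w a) b c) z = _ := hF
  rw [hF', h.covIndT_eq hΓ' hΓ, h.covIndT_eq hΓ' hΓ]
  simp only [add_apply, smul_apply, smul_eq_mul, hD',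
    hD₂', zero_apply, map_zero, add_zero, indT, map_add, map_sub,
    ContinuousLinearMap.flip_apply, zero_add,
    sub_apply, ContinuousLinearMap.comp_zero]
  ring

/-- A complex structure that is compatible with the Kähler form is differentiable, and its
covariant derivative is that of the Kähler form. -/
lemma hasFDerivAt_J [FiniteDimensional ℝ E] (h : IsChartHypersurface G T f ν z)
    (hΓ : IsChristoffel (indG G f) z Γ) {J : E → E →L[ℝ] E}
    (hJ : ∀ᶠ w in 𝓝 z, J w = (indG G f w).inverse.comp (indω T f ν w).flip)
    (hinv : (indG G f z).IsInvertible) :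
    ∃ J' : E →L[ℝ] E →L[ℝ] E, HasFDerivAt J J' z ∧ ∀ u v w,
      indG G f z v (J' u w + Γ u (J z w) - J z (Γ u w)) =
        fderiv ℝ (indω T f ν) z u v w - indω T f ν z (Γ u v) w - indω T f ν z v (Γ u w) := by
  have : CompleteSpace E := FiniteDimensional.complete ℝ E
  have h1 : DifferentiableAt ℝ (fun w => (indG G f w).inverse) z :=
    ((hinv.contDiffAt_map_inverse (n := 1)).differentiableAt (by norm_num)).comp z
      h.differentiableAt_indG
  have h2 : DifferentiableAt ℝ (fun w => (indω T f ν w).flip) z :=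
    (ContinuousLinearMap.flipₗᵢ ℝ E E ℝ).toContinuousLinearEquiv.differentiableAt.comp z
      h.differentiableAt_indω
  have h3 : DifferentiableAt ℝ J z := (h1.clm_comp h2).congr_of_eventuallyEq hJ
  refine ⟨_, h3.hasFDerivAt, fun u v w => ?_⟩
  have hinv' : ∀ᶠ w in 𝓝 z, (indG G f w).IsInvertible := by
    obtain ⟨e, he⟩ := hinv
    refine h.differentiableAt_indG.continuousAt.eventually (p := fun A => A.IsInvertible) ?_
    rw [← he]
    exact mem_of_superset (ContinuousLinearEquiv.nhds e) fun A hA => hA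
  -- Once differentiability is known, `J` enters only through `g (v, J w) = ω (v, w)`, which is
  -- differentiated as an identity.
  have hev : (fun y => indG G f y v (J y w)) =ᶠ[𝓝 z] fun y => indω T f ν y v w := by
    filter_upwards [hJ, hinv'] with y hy hy'
    rw [h.indG_symm, hy]
    obtain ⟨e, he⟩ := hy'
    rw [← he, ContinuousLinearMap.inverse_equiv]
    simp
  obtain ⟨D, hD, hD'⟩ := hasFDerivAt_bilin h.differentiableAt_indG.hasFDerivAt
    (hasFDerivAt_const v z) (h3.hasFDerivAt.clm_apply (hasFDerivAt_const w z))
  obtain ⟨D₂, hD₂, hD₂'⟩ := hasFDerivAt_bilin h.differentiableAt_indω.hasFDerivAt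
    (hasFDerivAt_const v z) (hasFDerivAt_const w z)
  have e1 := hD.unique (hD₂.congr_of_eventuallyEq hev)
  have e2 := hD' u
  rw [e1, hD₂', hΓ.compat h.differentiableAt_indG fun _ _ _ => h.indG_symm _ _ _] at e2
  simp only [zero_apply, map_zero, add_zero, add_apply,
    ContinuousLinearMap.comp_apply, ContinuousLinearMap.flip_apply, zero_add] at e2
  have hz : ∀ v w, indG G f z v (J z w) = indω T f ν z v w := by
    intro v w
    rw [h.indG_symm, hJ.self_of_nhds]
    obtain ⟨e, he⟩ := hinv
    rw [← he, ContinuousLinearMap.inverse_equiv]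
    simp
  simp only [map_add, map_sub]
  rw [hz v (Γ u w), ← hz (Γ u v) w]
  linarith

end IsChartHypersurface

end ChartCalculus

end G2Hyp
end

/-! ### Exterior derivatives and Christoffel symbols in coordinates. -/

noncomputable section

set_option maxSynthPendingDepth 3

namespace G2Hyp

section ChartTensors

open Filter Topology

variable {E : Type*} [NormedAddCommGroup E] [NormedSpace ℝ E] [FiniteDimensional ℝ E]

/-- A bilinear form on a finite-dimensional space as a continuous bilinear map. -/
def clm₂ (b : E →ₗ[ℝ] E →ₗ[ℝ] ℝ) : E →L[ℝ] E →L[ℝ] ℝ :=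
  LinearMap.toContinuousLinearMap
    { toFun := fun x => LinearMap.toContinuousLinearMap (b x)
      map_add' := fun x y => by ext; simp
      map_smul' := fun c x => by ext; simp }

lemma clm₂_apply (b : E →ₗ[ℝ] E →ₗ[ℝ] ℝ) (x y : E) : clm₂ b x y = b x y := rfl

/-- A trilinear form on a finite-dimensional space as a continuous trilinear map. -/
def clm₃ (b : E →ₗ[ℝ] E →ₗ[ℝ] E →ₗ[ℝ] ℝ) : E →L[ℝ] E →L[ℝ] E →L[ℝ] ℝ :=
  LinearMap.toContinuousLinearMap
    { toFun := fun x => clm₂ (b x)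
      map_add' := fun x y => by ext; simp [clm₂_apply]
      map_smul' := fun c x => by ext; simp [clm₂_apply] }


/-- A continuous bilinear map as a bilinear form. -/
def lin₂ (A : E →L[ℝ] E →L[ℝ] ℝ) : E →ₗ[ℝ] E →ₗ[ℝ] ℝ :=
  LinearMap.mk₂ ℝ (fun x y => A x y) (by simp) (by simp) (by simp) (by simp)

/-- A three-form as a continuous trilinear map. -/
def formClm (δ : E [⋀^Fin 3]→L[ℝ] ℝ) : E →L[ℝ] E →L[ℝ] E →L[ℝ] ℝ :=
  clm₃ (tri δ.toAlternatingMap)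

lemma formClm_swap12 (δ : E [⋀^Fin 3]→L[ℝ] ℝ) (x y z : E) :
    formClm δ x y z = -formClm δ y x z := tri_swap12 _ _ _ _

lemma formClm_swap23 (δ : E [⋀^Fin 3]→L[ℝ] ℝ) (x y z : E) :
    formClm δ x y z = -formClm δ x z y := tri_swap23 _ _ _ _

omit [FiniteDimensional ℝ E] in
lemma differentiableAt_form_apply {δ : E → E [⋀^Fin 3]→L[ℝ] ℝ} {y : E} (h : DifferentiableAt ℝ δ y)
    (v : Fin 3 → E) : DifferentiableAt ℝ (fun z => δ z v) y :=
  (ContinuousAlternatingMap.apply ℝ E ℝ v).differentiableAt.comp y h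

lemma differentiableAt_formClm {δ : E → E [⋀^Fin 3]→L[ℝ] ℝ} {y : E}
    (h : DifferentiableAt ℝ δ y) : DifferentiableAt ℝ (fun z => formClm (δ z)) y :=
  differentiableAt_clm_of_apply fun a => differentiableAt_clm_of_apply fun b =>
    differentiableAt_clm_of_apply fun c => differentiableAt_form_apply h ![a, b, c]

lemma fderiv_formClm {δ : E → E [⋀^Fin 3]→L[ℝ] ℝ} {y : E} (h : DifferentiableAt ℝ δ y)
    (u a b c : E) : fderiv ℝ (fun z => formClm (δ z)) y u a b c =
      fderiv ℝ (fun z => δ z ![a, b, c]) y u := by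
  obtain ⟨D, hD, hD'⟩ := hasFDerivAt_trilin (differentiableAt_formClm h).hasFDerivAt
    (hasFDerivAt_const a y) (hasFDerivAt_const b y) (hasFDerivAt_const c y)
  have h1 : fderiv ℝ (fun z => δ z ![a, b, c]) y = D := hD.fderiv
  rw [h1, hD']
  simp

lemma extDeriv_three {δ : E → E [⋀^Fin 3]→L[ℝ] ℝ} {y : E} (h : DifferentiableAt ℝ δ y)
    (a b c d : E) : extDeriv δ y ![a, b, c, d] =
      fderiv ℝ (fun z => formClm (δ z)) y a b c d - fderiv ℝ (fun z => formClm (δ z)) y b a c d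
      + fderiv ℝ (fun z => formClm (δ z)) y c a b d
      - fderiv ℝ (fun z => formClm (δ z)) y d a b c := by
  have e0 : (0 : Fin 4).removeNth ![a, b, c, d] = ![b, c, d] := by
    funext i; fin_cases i <;> rfl
  have e1 : (1 : Fin 4).removeNth ![a, b, c, d] = ![a, c, d] := by
    funext i; fin_cases i <;> rfl
  have e2 : (2 : Fin 4).removeNth ![a, b, c, d] = ![a, b, d] := by
    funext i; fin_cases i <;> rfl
  have e3 : (3 : Fin 4).removeNth ![a, b, c, d] = ![a, b, c] := by
    funext i; fin_cases i <;> rfl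
  rw [extDeriv_apply h, Fin.sum_univ_four]
  simp only [e0, e1, e2, e3, fderiv_formClm h]
  simp
  ring

/-- The exterior derivative is the skew-symmetrised covariant derivative of a symmetric
connection. -/
lemma extDeriv_eq_covT {δ : E → E [⋀^Fin 3]→L[ℝ] ℝ} {y : E} (h : DifferentiableAt ℝ δ y)
    {Γ : E → E → E} (hΓ : ∀ a b, Γ a b = Γ b a) (a b c d : E) :
    extDeriv δ y ![a, b, c, d] =
      covT (fun z => formClm (δ z)) Γ y a b c d - covT (fun z => formClm (δ z)) Γ y b a c d
      + covT (fun z => formClm (δ z)) Γ y c a b d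
      - covT (fun z => formClm (δ z)) Γ y d a b c := by
  rw [extDeriv_three h]
  simp only [covT]
  -- By symmetry of `Γ` the twelve connection terms cancel in pairs.
  rw [hΓ b a, hΓ c a, hΓ c b, hΓ d a, hΓ d b, hΓ d c]
  have s1 := formClm_swap12 (δ y)
  have s2 := formClm_swap23 (δ y)
  linear_combination s1 b (Γ a c) d + s2 b c (Γ a d) - s1 b (Γ a d) c - s2 a c (Γ b d)

omit [FiniteDimensional ℝ E] in
lemma IsChristoffel.symm {G : E → E →L[ℝ] E →L[ℝ] ℝ} {y : E} {Γ : E → E → E}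
    (h : IsChristoffel G y Γ) (hG : DifferentiableAt ℝ G y) (hs : ∀ y a b, G y a b = G y b a)
    {n : ℕ} {e : Fin n → E} (he : IsONBasis (lin₂ (G y)) e) (a b : E) : Γ a b = Γ b a := by
  refine he.eq_of_inner fun c => ?_
  have h1 := h a b c
  have h2 := h b a c
  have h3 := fderiv_symm hG hs c a b
  change G y _ c = G y _ c
  linarith

end ChartTensors

section Christoffel

open Filter Topology

variable {n : ℕ}

/-- The defining sum expands in an orthonormal frame at `y`. The Koszul expression is linear in its
last argument, so pairing with `c` reassembles it. -/
lemma isChristoffel_christoffel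
    {G : EuclideanSpace ℝ (Fin n) → EuclideanSpace ℝ (Fin n) → EuclideanSpace ℝ (Fin n) → ℝ}
    {A : EuclideanSpace ℝ (Fin n) → EuclideanSpace ℝ (Fin n) →L[ℝ] EuclideanSpace ℝ (Fin n) →L[ℝ] ℝ}
    {y : EuclideanSpace ℝ (Fin n)} (hG : ∀ᶠ z in 𝓝 y, ∀ a b, G z a b = A z a b)
    (hA : DifferentiableAt ℝ A y) {e : Fin n → EuclideanSpace ℝ (Fin n)}
    (he : IsONBasis (lin₂ (A y)) e) : IsChristoffel A y (christoffel G y) := by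
  have hGy : G y = fun a b => lin₂ (A y) a b := by
    funext a b
    exact hG.self_of_nhds a b
  have hd : ∀ u a b, fderiv ℝ (fun z => G z a b) y u = fderiv ℝ A y u a b := by
    intro u a b
    obtain ⟨D, hD, hD'⟩ := hasFDerivAt_bilin hA.hasFDerivAt (hasFDerivAt_const a y)
      (hasFDerivAt_const b y)
    have h1 := hD.congr_of_eventuallyEq (hG.mono fun z hz => hz a b)
    rw [h1.fderiv, hD']
    simp
  have hf := he.onFrame
  intro a b c
  rw [christoffel, hGy]
  simp only [hd, map_sum, map_smul, sum_apply, smul_apply, smul_eq_mul]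
  set f := onFrame n fun a b => lin₂ (A y) a b
  let K : EuclideanSpace ℝ (Fin n) →ₗ[ℝ] ℝ :=
    { toFun := fun c => 1 / 2 * (fderiv ℝ A y a b c + fderiv ℝ A y b a c - fderiv ℝ A y c a b)
      map_add' := fun c d => by simp; ring
      map_smul' := fun r c => by simp; ring }
  have h1 := hf.apply_eq_sum K c
  have h2 : ∀ i, lin₂ (A y) (f i) c = A y (f i) c := fun i => rfl
  simp only [h2] at h1
  have h3 : K c = 1 / 2 * (fderiv ℝ A y a b c + fderiv ℝ A y b a c - fderiv ℝ A y c a b) := rfl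
  have h4 : ∑ i, 1 / 2 * (fderiv ℝ A y a b (f i) + fderiv ℝ A y b a (f i)
      - fderiv ℝ A y (f i) a b) * A y (f i) c = K c := by
    rw [h1]
    exact Finset.sum_congr rfl fun i _ => mul_comm _ _
  rw [h4, h3]
  ring

end Christoffel

end G2Hyp
end

/-! ### Preferred charts and smoothness of the metric coefficients. -/

noncomputable section

set_option maxSynthPendingDepth 3

namespace G2Hyp

section ChartMaps

open Filter Topology

variable {n : ℕ} {X : Type*} [TopologicalSpace X] [ChartedSpace (EuclideanSpace ℝ (Fin n)) X]
  [IsManifold (𝓡 n) ∞ X]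

lemma toChart_self (x : X) (v : EuclideanSpace ℝ (Fin n)) :
    (toChart x x v : EuclideanSpace ℝ (Fin n)) = v := by
  have h := mfderiv_extChartAt_self (I := 𝓡 n) (x := x)
  exact congrArg (fun A : TangentSpace (𝓡 n) x →L[ℝ] EuclideanSpace ℝ (Fin n) => A v) h

omit [IsManifold (𝓡 n) ∞ X] in
lemma fromChart_eq_mfderivWithin (x₀ : X) (y : EuclideanSpace ℝ (Fin n)) : fromChart x₀ y =
    mfderivWithin 𝓘(ℝ, EuclideanSpace ℝ (Fin n)) (𝓡 n) (extChartAt (𝓡 n) x₀).symm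
      (Set.range (𝓡 n)) y := by
  rw [(𝓡 n).range_eq_univ, mfderivWithin_univ]
  rfl

lemma fromChart_self (x : X) (v : EuclideanSpace ℝ (Fin n)) :
    (fromChart x (extChartAt (𝓡 n) x x) v : EuclideanSpace ℝ (Fin n)) = v := by
  rw [fromChart_eq_mfderivWithin]
  have h := mfderivWithin_range_extChartAt_symm (I := 𝓡 n) (x := x)
  exact congrArg (fun A : EuclideanSpace ℝ (Fin n) →L[ℝ] EuclideanSpace ℝ (Fin n) => A v) h

lemma fromChart_toChart {x₀ x : X} (hx : x ∈ (extChartAt (𝓡 n) x₀).source)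
    (v : EuclideanSpace ℝ (Fin n)) :
    (fromChart x₀ (extChartAt (𝓡 n) x₀ x) (toChart x₀ x v) : EuclideanSpace ℝ (Fin n)) = v := by
  rw [fromChart_eq_mfderivWithin]
  have h := mfderivWithin_extChartAt_symm_comp_mfderiv_extChartAt' (I := 𝓡 n) hx
  exact congrArg (fun A : EuclideanSpace ℝ (Fin n) →L[ℝ] EuclideanSpace ℝ (Fin n) => A v) h

lemma toChart_fromChart {x₀ : X} {y : EuclideanSpace ℝ (Fin n)}
    (hy : y ∈ (extChartAt (𝓡 n) x₀).target) (v : EuclideanSpace ℝ (Fin n)) :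
    (toChart x₀ ((extChartAt (𝓡 n) x₀).symm y) (fromChart x₀ y v) :
      EuclideanSpace ℝ (Fin n)) = v := by
  rw [fromChart_eq_mfderivWithin]
  have h := mfderiv_extChartAt_comp_mfderivWithin_extChartAt_symm (I := 𝓡 n) hy
  exact congrArg (fun A : EuclideanSpace ℝ (Fin n) →L[ℝ] EuclideanSpace ℝ (Fin n) => A v) h

/-- This links chart differentials to the trivialisation of the tangent bundle, in which the
smoothness of the metric is expressed. -/
lemma fromChart_eq_symmL {x₀ x : X} (hx : x ∈ (extChartAt (𝓡 n) x₀).source)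
    (v : EuclideanSpace ℝ (Fin n)) :
    (fromChart x₀ (extChartAt (𝓡 n) x₀ x) v : EuclideanSpace ℝ (Fin n)) =
      (trivializationAt (EuclideanSpace ℝ (Fin n)) (TangentSpace (𝓡 n)) x₀).symmL ℝ x v := by
  rw [fromChart_eq_mfderivWithin, TangentBundle.symmL_trivializationAt (by simpa using hx)]
  rfl

lemma mdifferentiableAt_extChartAt_symm {x₀ : X} {y : EuclideanSpace ℝ (Fin n)}
    (hy : y ∈ (extChartAt (𝓡 n) x₀).target) :
    MDifferentiableAt 𝓘(ℝ, EuclideanSpace ℝ (Fin n)) (𝓡 n) (extChartAt (𝓡 n) x₀).symm y := by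
  have := mdifferentiableWithinAt_extChartAt_symm (I := 𝓡 n) hy
  rwa [(𝓡 n).range_eq_univ, mdifferentiableWithinAt_univ] at this

lemma contMDiffAt_extChartAt_symm {x₀ : X} {y : EuclideanSpace ℝ (Fin n)}
    (hy : y ∈ (extChartAt (𝓡 n) x₀).target) :
    ContMDiffAt 𝓘(ℝ, EuclideanSpace ℝ (Fin n)) (𝓡 n) ∞ (extChartAt (𝓡 n) x₀).symm y :=
  (contMDiffOn_extChartAt_symm x₀).contMDiffAt
    ((isOpen_extChartAt_target x₀).mem_nhds hy)

end ChartMaps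

section MetricSmooth

open Filter Topology Bundle

variable {N : Type*} [TopologicalSpace N] [ChartedSpace (EuclideanSpace ℝ (Fin 7)) N]
  [IsManifold (𝓡 7) ∞ N]

/-- A constant chart vector is a section that is constant in the trivialisation, hence smooth; the
metric is a smooth section applied to two of these. -/
lemma contDiffAt_chartMetric (G : G2Structure N) (q : N) (u v : EuclideanSpace ℝ (Fin 7)) :
    ContDiffAt ℝ ∞ (fun y => chartMetric G.g q y u v) (extChartAt (𝓡 7) q q) := by
  have hsec : ∀ u : EuclideanSpace ℝ (Fin 7), ContMDiffAt (𝓡 7) (𝓡 7).tangent ∞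
      (fun x => (⟨x, (trivializationAt (EuclideanSpace ℝ (Fin 7)) (TangentSpace (𝓡 7)) q).symmL ℝ x
        u⟩ : TangentBundle (𝓡 7) N)) q := by
    intro u
    rw [Trivialization.contMDiffAt_section_iff (trivializationAt (EuclideanSpace ℝ (Fin 7))
      (TangentSpace (𝓡 7) : N → Type _) q) (mem_baseSet_trivializationAt _ _ q)]
    refine (contMDiffAt_const (c := u)).congr_of_eventuallyEq ?_
    filter_upwards [(trivializationAt (EuclideanSpace ℝ (Fin 7)) (TangentSpace (𝓡 7) : N → Type _)
      q).open_baseSet.mem_nhds (mem_baseSet_trivializationAt _ _ q)] with x hx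
    have := (trivializationAt (EuclideanSpace ℝ (Fin 7)) (TangentSpace (𝓡 7) : N → Type _)
      q).continuousLinearMapAt_symmL (R := ℝ) hx u
    rwa [Trivialization.continuousLinearMapAt_apply_of_mem _ _ hx] at this
  have h1 : ContMDiffAt (𝓡 7) ((𝓡 7).prod 𝓘(ℝ, ℝ)) ∞
      (fun x => (TotalSpace.mk' ℝ (E := fun _ : N => ℝ) x (G.metric.inner x
        ((trivializationAt (EuclideanSpace ℝ (Fin 7)) (TangentSpace (𝓡 7)) q).symmL ℝ x u)
        ((trivializationAt (EuclideanSpace ℝ (Fin 7)) (TangentSpace (𝓡 7)) q).symmL ℝ x v)))) q :=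
    ContMDiffAt.clm_bundle_apply₂ (b := fun x : N => x) G.metric.contMDiff.contMDiffAt (hsec u)
      (hsec v)
  have h2 := ((contMDiffAt_section q).1 h1 : _)
  have hy : extChartAt (𝓡 7) q q ∈ (extChartAt (𝓡 7) q).target := mem_extChartAt_target q
  have h3 := contMDiffAt_extChartAt_symm hy
  have h2' : ContMDiffAt (𝓡 7) 𝓘(ℝ, ℝ) ∞ (fun x => G.metric.inner x
      ((trivializationAt (EuclideanSpace ℝ (Fin 7)) (TangentSpace (𝓡 7)) q).symmL ℝ x u)
      ((trivializationAt (EuclideanSpace ℝ (Fin 7)) (TangentSpace (𝓡 7)) q).symmL ℝ x v))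
      ((extChartAt (𝓡 7) q).symm (extChartAt (𝓡 7) q q)) := by
    rw [extChartAt_to_inv]
    exact h2
  refine (h2'.comp _ h3).contDiffAt.congr_of_eventuallyEq ?_
  filter_upwards [extChartAt_target_mem_nhds (I := 𝓡 7) q] with y hy
  have hs : (extChartAt (𝓡 7) q).symm y ∈ (extChartAt (𝓡 7) q).source :=
    (extChartAt (𝓡 7) q).map_target hy
  have h4 : ∀ v, (fromChart q y v : EuclideanSpace ℝ (Fin 7)) =
      (trivializationAt (EuclideanSpace ℝ (Fin 7)) (TangentSpace (𝓡 7)) q).symmL ℝ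
        ((extChartAt (𝓡 7) q).symm y) v := by
    intro v
    have h5 := fromChart_eq_symmL hs v
    rwa [(extChartAt (𝓡 7) q).right_inv hy] at h5
  simp only [chartMetric, Function.comp, G2Structure.g]
  exact congrArg₂ (fun a b : TangentSpace (𝓡 7) ((extChartAt (𝓡 7) q).symm y) =>
    G.metric.inner _ a b) (h4 u) (h4 v)

end MetricSmooth

end G2Hyp
end

/-! ### The ambient structure at a point: the vector `l` and `pd*φ`. -/

noncomputable section

set_option maxSynthPendingDepth 3

namespace G2Hyp

section ChartExpressions

variable {n : ℕ} {X : Type*} [TopologicalSpace X] [ChartedSpace (EuclideanSpace ℝ (Fin n)) X]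
  [IsManifold (𝓡 n) ∞ X]

lemma fromChart_toChart_symm {x₀ : X} {y : EuclideanSpace ℝ (Fin n)}
    (hy : y ∈ (extChartAt (𝓡 n) x₀).target)
    (v : TangentSpace (𝓡 n) ((extChartAt (𝓡 n) x₀).symm y)) :
    fromChart x₀ y (toChart x₀ ((extChartAt (𝓡 n) x₀).symm y) v) = v := by
  have h := fromChart_toChart ((extChartAt (𝓡 n) x₀).map_target hy) v
  rwa [(extChartAt (𝓡 n) x₀).right_inv hy] at h

omit [IsManifold (𝓡 n) ∞ X] in
-- The base point is a variable, so that substitution takes care of the dependence of the tangent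
-- space on it.
lemma chartMetric_eq_of_fromChart
    (g : ∀ x : X, TangentSpace (𝓡 n) x → TangentSpace (𝓡 n) x → ℝ) {x₀ x : X}
    {y : EuclideanSpace ℝ (Fin n)} (hx : (extChartAt (𝓡 n) x₀).symm y = x)
    {u v : EuclideanSpace ℝ (Fin n)} {a b : TangentSpace (𝓡 n) x}
    (hu : (fromChart x₀ y u : EuclideanSpace ℝ (Fin n)) = a)
    (hv : (fromChart x₀ y v : EuclideanSpace ℝ (Fin n)) = b) :
    chartMetric g x₀ y u v = g x a b := by
  subst hx
  exact congrArg₂ (g _) hu hv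

omit [IsManifold (𝓡 n) ∞ X] in
lemma chartTensor_eq_of_fromChart {k : ℕ} (α : ∀ x : X, (Fin k → TangentSpace (𝓡 n) x) → ℝ)
    {x₀ x : X} {y : EuclideanSpace ℝ (Fin n)} (hx : (extChartAt (𝓡 n) x₀).symm y = x)
    {v : Fin k → EuclideanSpace ℝ (Fin n)} {a : Fin k → TangentSpace (𝓡 n) x}
    (hv : ∀ i, (fromChart x₀ y (v i) : EuclideanSpace ℝ (Fin n)) = a i) :
    chartTensor α x₀ y v = α x a := by
  subst hx
  exact congrArg (α _) (funext hv)

lemma chartMetric_toChart (g : ∀ x : X, TangentSpace (𝓡 n) x → TangentSpace (𝓡 n) x → ℝ)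
    {x₀ x : X} (hx : x ∈ (extChartAt (𝓡 n) x₀).source) (u v : TangentSpace (𝓡 n) x) :
    chartMetric g x₀ (extChartAt (𝓡 n) x₀ x) (toChart x₀ x u) (toChart x₀ x v) = g x u v :=
  chartMetric_eq_of_fromChart g ((extChartAt (𝓡 n) x₀).left_inv hx) (fromChart_toChart hx u)
    (fromChart_toChart hx v)

lemma chartTensor_toChart {k : ℕ} (α : ∀ x : X, (Fin k → TangentSpace (𝓡 n) x) → ℝ)
    {x₀ x : X} (hx : x ∈ (extChartAt (𝓡 n) x₀).source) (v : Fin k → TangentSpace (𝓡 n) x) :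
    chartTensor α x₀ (extChartAt (𝓡 n) x₀ x) (fun i => toChart x₀ x (v i)) = α x v :=
  chartTensor_eq_of_fromChart α ((extChartAt (𝓡 n) x₀).left_inv hx)
    (fun i => fromChart_toChart hx (v i))

lemma chartMetric_self (g : ∀ x : X, TangentSpace (𝓡 n) x → TangentSpace (𝓡 n) x → ℝ)
    (x : X) (u v : TangentSpace (𝓡 n) x) :
    chartMetric g x (extChartAt (𝓡 n) x x) u v = g x u v :=
  chartMetric_eq_of_fromChart g (extChartAt_to_inv x) (fromChart_self x u) (fromChart_self x v)

lemma chartTensor_self {k : ℕ} (α : ∀ x : X, (Fin k → TangentSpace (𝓡 n) x) → ℝ)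
    (x : X) (v : Fin k → TangentSpace (𝓡 n) x) :
    chartTensor α x (extChartAt (𝓡 n) x x) v = α x v :=
  chartTensor_eq_of_fromChart α (extChartAt_to_inv x) (fun i => fromChart_self x (v i))

/-- The covariant derivative at the centre of the preferred chart. -/
lemma nabla_eq {k : ℕ} (g : ∀ x : X, TangentSpace (𝓡 n) x → TangentSpace (𝓡 n) x → ℝ)
    (α : ∀ x : X, (Fin k → TangentSpace (𝓡 n) x) → ℝ) (x : X)
    (u : EuclideanSpace ℝ (Fin n)) (v : Fin k → EuclideanSpace ℝ (Fin n)) :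
    nabla g α x u v = fderiv ℝ (fun z => chartTensor α x z v) (extChartAt (𝓡 n) x x) u
      - ∑ i : Fin k, chartTensor α x (extChartAt (𝓡 n) x x)
        (Function.update v i (christoffel (chartMetric g x) (extChartAt (𝓡 n) x x) u (v i))) := by
  have h : ∀ i, (toChart x x (v i) : EuclideanSpace ℝ (Fin n)) = v i :=
    fun i => toChart_self x (v i)
  have hu : (toChart x x u : EuclideanSpace ℝ (Fin n)) = u := toChart_self x u
  simp only [nabla]
  rw [hu]
  simp only [h]

end ChartExpressions

section Pointwise

variable {N : Type*} [TopologicalSpace N] [ChartedSpace (EuclideanSpace ℝ (Fin 7)) N]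
  [IsManifold (𝓡 7) ∞ N]

namespace G2Structure

variable (G : G2Structure N)

/-- The metric at a point as a bilinear form. -/
def bilinT (x : N) : TangentSpace (𝓡 7) x →ₗ[ℝ] TangentSpace (𝓡 7) x →ₗ[ℝ] ℝ :=
  LinearMap.mk₂ ℝ (G.g x) (by simp [G2Structure.g]) (by simp [G2Structure.g])
    (by simp [G2Structure.g]) (by simp [G2Structure.g])

/-- The metric at a point as a bilinear form on the model space. -/
def bilin (x : N) : EuclideanSpace ℝ (Fin 7) →ₗ[ℝ] EuclideanSpace ℝ (Fin 7) →ₗ[ℝ] ℝ :=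
  G.bilinT x

/-- The fundamental three-form at a point as an algebraic alternating form. -/
def alt (x : N) : EuclideanSpace ℝ (Fin 7) [⋀^Fin 3]→ₗ[ℝ] ℝ := (G.form x).toAlternatingMap

/-- The chosen Cayley frame at a point. -/
def frame (x : N) : Fin 7 → EuclideanSpace ℝ (Fin 7) := cayleyFrame (G.g x) (G.phi x)

lemma g_symm (x : N) (u v : TangentSpace (𝓡 7) x) : G.g x u v = G.g x v u :=
  G.metric.symm x u v

lemma isG2Basis (x : N) : IsG2Basis (G.bilin x) (G.alt x) (G.frame x) := by
  have hs : ∀ u v, G.bilin x u v = G.bilin x v u := G.g_symm x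
  refine IsG2Basis.of_cayley finrank_euclideanSpace_fin hs ?_
  exact Classical.epsilon_spec (G.cayley x)

lemma star_eq (x : N) (v : Fin 4 → EuclideanSpace ℝ (Fin 7)) :
    G.star x v = starL (G.bilin x) (crossL (G.alt x) (G.frame x)) (v 0) (v 1) (v 2) (v 3) :=
  starPhi_eq (G.isG2Basis x) v

/-- The metric in the chart around `q`. -/
def chartG (q : N) (y : EuclideanSpace ℝ (Fin 7)) :
    EuclideanSpace ℝ (Fin 7) →L[ℝ] EuclideanSpace ℝ (Fin 7) →L[ℝ] ℝ :=
  clm₂ ((G.bilinT ((extChartAt (𝓡 7) q).symm y)).compl₁₂ (fromChart q y).toLinearMap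
    (fromChart q y).toLinearMap)

/-- The fundamental three-form in the chart around `q`. -/
def chartT (q : N) (y : EuclideanSpace ℝ (Fin 7)) :
    EuclideanSpace ℝ (Fin 7) →L[ℝ] EuclideanSpace ℝ (Fin 7) →L[ℝ]
      EuclideanSpace ℝ (Fin 7) →L[ℝ] ℝ :=
  formClm (chartForm G.form q y)

lemma chartT_apply (q : N) (y u v w : EuclideanSpace ℝ (Fin 7)) :
    G.chartT q y u v w = chartTensor G.phi q y ![u, v, w] := rfl

lemma chartG_self (q : N) (u v : EuclideanSpace ℝ (Fin 7)) :
    G.chartG q (extChartAt (𝓡 7) q q) u v = G.bilin q u v := by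
  exact chartMetric_self G.g q u v

lemma chartT_self (q : N) (u v w : EuclideanSpace ℝ (Fin 7)) :
    G.chartT q (extChartAt (𝓡 7) q q) u v w = tri (G.alt q) u v w := by
  exact chartTensor_self G.phi q ![u, v, w]

lemma differentiableAt_chartForm (q : N) :
    DifferentiableAt ℝ (chartForm G.form q) (extChartAt (𝓡 7) q q) :=
  ((G.smooth q).contDiffAt (extChartAt_target_mem_nhds q)).differentiableAt (by simp)

lemma differentiableAt_chartT (q : N) :
    DifferentiableAt ℝ (G.chartT q) (extChartAt (𝓡 7) q q) :=
  differentiableAt_formClm (G.differentiableAt_chartForm q)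

lemma differentiableAt_chartG (q : N) :
    DifferentiableAt ℝ (G.chartG q) (extChartAt (𝓡 7) q q) :=
  differentiableAt_clm_of_apply fun u => differentiableAt_clm_of_apply fun v =>
    (contDiffAt_chartMetric G q u v).differentiableAt (by simp)

lemma isONBasis_chartG (q : N) :
    IsONBasis (lin₂ (G.chartG q (extChartAt (𝓡 7) q q))) (G.frame q) := by
  have h : lin₂ (G.chartG q (extChartAt (𝓡 7) q q)) = G.bilin q := by
    ext u v
    exact G.chartG_self q u v
  rw [h]
  exact (G.isG2Basis q).toIsONBasis

/-- The Levi-Civita connection in the chart around `q`, at its centre. -/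
def Gamma (q : N) (a b : EuclideanSpace ℝ (Fin 7)) : EuclideanSpace ℝ (Fin 7) :=
  christoffel (chartMetric G.g q) (extChartAt (𝓡 7) q q) a b

lemma isChristoffel_Gamma (q : N) :
    IsChristoffel (G.chartG q) (extChartAt (𝓡 7) q q) (G.Gamma q) :=
  isChristoffel_christoffel (Filter.Eventually.of_forall fun _ _ _ => rfl)
    (G.differentiableAt_chartG q) (G.isONBasis_chartG q)

lemma Gamma_symm (q : N) (a b : EuclideanSpace ℝ (Fin 7)) : G.Gamma q a b = G.Gamma q b a :=
  (G.isChristoffel_Gamma q).symm (G.differentiableAt_chartG q)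
    (fun _ _ _ => G.g_symm _ _ _) (G.isONBasis_chartG q) a b

/-- The covariant derivative of the fundamental three-form in the preferred chart. -/
lemma covT_eq_nabla (q : N) (a b c d : EuclideanSpace ℝ (Fin 7)) :
    covT (G.chartT q) (G.Gamma q) (extChartAt (𝓡 7) q q) a b c d =
      nabla G.g G.phi q a ![b, c, d] := by
  have h1 := fderiv_formClm (G.differentiableAt_chartForm q) a b c d
  refine Eq.trans ?_ (nabla_eq G.g G.phi q a ![b, c, d]).symm
  rw [Fin.sum_univ_three]
  simp only [covT]
  have e0 : Function.update ![b, c, d] 0 (G.Gamma q a b) = ![G.Gamma q a b, c, d] := by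
    funext i; fin_cases i <;> rfl
  have e1 : Function.update ![b, c, d] 1 (G.Gamma q a c) = ![b, G.Gamma q a c, d] := by
    funext i; fin_cases i <;> rfl
  have e2 : Function.update ![b, c, d] 2 (G.Gamma q a d) = ![b, c, G.Gamma q a d] := by
    funext i; fin_cases i <;> rfl
  change _ = _ - (chartTensor G.phi q _ (Function.update ![b, c, d] 0 (G.Gamma q a b))
    + chartTensor G.phi q _ (Function.update ![b, c, d] 1 (G.Gamma q a c))
    + chartTensor G.phi q _ (Function.update ![b, c, d] 2 (G.Gamma q a d)))
  rw [e0, e1, e2]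
  simp only [← chartT_apply]
  have h2 : fderiv ℝ (fun z => G.chartT q z b c d) (extChartAt (𝓡 7) q q) a =
    fderiv ℝ (G.chartT q) (extChartAt (𝓡 7) q q) a b c d := h1.symm
  rw [h2]
  ring

/-- The covariant derivative of the fundamental three-form at `q` is `a ↦ (l × a) ⌟ *φ`. -/
def IsLeeVector (q : N) (l : EuclideanSpace ℝ (Fin 7)) : Prop :=
  ∀ a b c d : EuclideanSpace ℝ (Fin 7),
    covT (G.chartT q) (G.Gamma q) (extChartAt (𝓡 7) q q) a b c d =
      starL (G.bilin q) (crossL (G.alt q) (G.frame q)) (crossL (G.alt q) (G.frame q) l a) b c d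

/-- `∑ φ (l, a, e_j) e_j` is `l × a`, so the sum defining `𝒳₄` collapses to one interior product. -/
lemma exists_isLeeVector (hG : G.IsTypeX4) (q : N) :
    ∃ l : EuclideanSpace ℝ (Fin 7), G.IsLeeVector q l := by
  obtain ⟨l, hl⟩ := hG q
  refine ⟨l, fun a b c d => ?_⟩
  refine (G.covT_eq_nabla q a b c d).trans ((hl a ![b, c, d]).trans ?_)
  have h1 : crossL (G.alt q) (G.frame q) l a =
      ∑ j, tri (G.alt q) l a (G.frame q j) • G.frame q j := rfl
  rw [h1, map_sum]
  simp only [map_smul, LinearMap.sum_apply, LinearMap.smul_apply, smul_eq_mul]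
  refine Finset.sum_congr rfl fun j _ => ?_
  exact congrArg _ (G.star_eq q ![G.frame q j, b, c, d])

/-- When `a ∧ (l ⌟ φ) - l ∧ (a ⌟ φ)` is skew-symmetrised, the terms with `⟨a, b⟩` cancel and each
term `⟨l, a⟩ φ (b, c, d)` occurs three times. So `dφ = 3 l ∧ φ`, and `starStarWedge_eq` applies. -/
lemma pdStar_eq {q : N} {l : EuclideanSpace ℝ (Fin 7)} (hl : G.IsLeeVector q l)
    (u : EuclideanSpace ℝ (Fin 7)) : G.pdStar q u = -12 * G.bilin q l u := by
  refine starStarWedge_eq (G.isG2Basis q) l (extD G.form q).toAlternatingMap (fun a b c d => ?_) u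
  have h1 : (extD G.form q).toAlternatingMap ![a, b, c, d] =
      extDeriv (chartForm G.form q) (extChartAt (𝓡 7) q q) ![a, b, c, d] := by
    refine congrArg (extDeriv (chartForm G.form q) (extChartAt (𝓡 7) q q)) (funext fun i => ?_)
    exact toChart_self q _
  have h2 := extDeriv_eq_covT (G.differentiableAt_chartForm q) (G.Gamma_symm q) a b c d
  refine h1.trans (h2.trans ?_)
  have h3 : ∀ a b c d : EuclideanSpace ℝ (Fin 7),
      covT (fun z => formClm (chartForm G.form q z)) (G.Gamma q) (extChartAt (𝓡 7) q q) a b c d =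
        starL (G.bilin q) (crossL (G.alt q) (G.frame q)) (crossL (G.alt q) (G.frame q) l a)
          b c d := hl
  rw [h3, h3, h3, h3]
  have h := G.isG2Basis q
  simp only [h.starL_cross]
  have t := tri_swap12 (G.alt q)
  have r := tri_rot (G.alt q)
  rw [h.symm b a, h.symm c a, h.symm c b, h.symm d a, h.symm d b, h.symm d c, t c b d, t b a d,
    t b a c, t c a d, r c a b, r d b c, r d a c, r d a b]
  ring

lemma g_pVec (q : N) {l : EuclideanSpace ℝ (Fin 7)}
    (hl : ∀ u, G.pdStar q u = -12 * G.bilin q l u) (u : EuclideanSpace ℝ (Fin 7)) :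
    G.g q (G.pVec q) u = G.pdStar q u := by
  have h := G.isG2Basis q
  have h1 : (G.pVec q : EuclideanSpace ℝ (Fin 7)) = (-12 : ℝ) • l := by
    refine Eq.trans (Finset.sum_congr rfl fun k _ =>
      congrArg (· • G.frame q k) (hl (G.frame q k))) ?_
    conv_rhs => rw [h.expand l]
    rw [Finset.smul_sum]
    exact Finset.sum_congr rfl fun k _ => by rw [smul_smul, h.symm l]
  refine (congrArg (fun v => G.bilin q v u) h1).trans ?_
  refine Eq.trans ?_ (hl u).symm
  simp

end G2Structure

end Pointwise

end G2Hyp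
end

/-! ### The immersion and its unit normal in preferred charts. -/

noncomputable section

set_option maxSynthPendingDepth 3

namespace G2Hyp

namespace OrientedHypersurface

open Filter Topology Bundle

variable {N : Type*} [TopologicalSpace N] [ChartedSpace (EuclideanSpace ℝ (Fin 7)) N]
  [IsManifold (𝓡 7) ∞ N] {G : G2Structure N} {M : Type*} [TopologicalSpace M]
  [ChartedSpace (EuclideanSpace ℝ (Fin 6)) M] [IsManifold (𝓡 6) ∞ M]

/-- The differential of the immersion as a linear map between the model spaces. -/
def pushL (H : OrientedHypersurface G M) (p : M) :
    EuclideanSpace ℝ (Fin 6) →ₗ[ℝ] EuclideanSpace ℝ (Fin 7) :=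
  (mfderiv (𝓡 6) (𝓡 7) H.incl p).toLinearMap

/-- The unit normal as a vector in the model space. -/
def unitNormal (H : OrientedHypersurface G M) (p : M) : EuclideanSpace ℝ (Fin 7) := H.normal p

lemma isUnitNormal (H : OrientedHypersurface G M) (p : M) :
    IsUnitNormal (G.bilin (H.incl p)) (G.alt (H.incl p)) (G.frame (H.incl p)) (H.pushL p)
      (H.unitNormal p) where
  toIsG2Basis := G.isG2Basis _
  inj := H.immersion p
  unit := H.normal_unit p
  orth := H.normal_orth p

/-- The induced almost complex structure as a linear map. -/
def cplx (H : OrientedHypersurface G M) (p : M) :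
    EuclideanSpace ℝ (Fin 6) →ₗ[ℝ] EuclideanSpace ℝ (Fin 6) :=
  Classical.choose ((H.isUnitNormal p).exists_J finrank_euclideanSpace_fin
    finrank_euclideanSpace_fin)

lemma pushL_cplx (H : OrientedHypersurface G M) (p : M) (x : EuclideanSpace ℝ (Fin 6)) :
    H.pushL p (H.cplx p x) = crossL (G.alt (H.incl p)) (G.frame (H.incl p)) (H.unitNormal p)
      (H.pushL p x) :=
  Classical.choose_spec ((H.isUnitNormal p).exists_J finrank_euclideanSpace_fin
    finrank_euclideanSpace_fin) x

lemma induced_J (H : OrientedHypersurface G M) (θ : M → ℝ) (p : M)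
    (x : EuclideanSpace ℝ (Fin 6)) : (H.induced θ).J p x = H.cplx p x := by
  have h := H.pushL_cplx p x
  refine Eq.trans ?_ (Function.leftInverse_invFun (H.immersion p) (H.cplx p x))
  exact congrArg (Function.invFun (H.pushL p)) h.symm

/-- The points of the preferred chart at `p` which the immersion maps into the preferred chart at
the image of `p`. -/
def chartDomain (H : OrientedHypersurface G M) (p : M) : Set (EuclideanSpace ℝ (Fin 6)) :=
  {z | z ∈ (extChartAt (𝓡 6) p).target ∧
    H.incl ((extChartAt (𝓡 6) p).symm z) ∈ (extChartAt (𝓡 7) (H.incl p)).source}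

lemma chartDomain_mem_nhds (H : OrientedHypersurface G M) (p : M) :
    H.chartDomain p ∈ 𝓝 (extChartAt (𝓡 6) p p) := by
  refine inter_mem (extChartAt_target_mem_nhds p) ?_
  have h1 : ContinuousAt (fun z => H.incl ((extChartAt (𝓡 6) p).symm z))
      (extChartAt (𝓡 6) p p) :=
    H.smooth.continuous.continuousAt.comp (continuousAt_extChartAt_symm p)
  refine h1.preimage_mem_nhds ?_
  rw [extChartAt_to_inv]
  exact extChartAt_source_mem_nhds _

lemma self_mem_chartDomain (H : OrientedHypersurface G M) (p : M) :
    extChartAt (𝓡 6) p p ∈ H.chartDomain p := mem_of_mem_nhds (H.chartDomain_mem_nhds p)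

lemma contDiffAt_chartIncl (H : OrientedHypersurface G M) {p : M} {z : EuclideanSpace ℝ (Fin 6)}
    (hz : z ∈ H.chartDomain p) : ContDiffAt ℝ ∞ (H.chartIncl p) z := by
  have h1 := contMDiffAt_extChartAt_symm hz.1
  have h2 : ContMDiffAt (𝓡 6) (𝓡 7) ∞ H.incl ((extChartAt (𝓡 6) p).symm z) :=
    H.smooth.contMDiffAt
  have h3 : ContMDiffAt (𝓡 7) 𝓘(ℝ, EuclideanSpace ℝ (Fin 7)) ∞ (extChartAt (𝓡 7) (H.incl p))
      (H.incl ((extChartAt (𝓡 6) p).symm z)) :=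
    contMDiffAt_extChartAt' (by simpa using hz.2)
  exact ((h3.comp _ h2).comp _ h1).contDiffAt

lemma fderiv_chartIncl (H : OrientedHypersurface G M) {p : M} {z : EuclideanSpace ℝ (Fin 6)}
    (hz : z ∈ H.chartDomain p) (u : EuclideanSpace ℝ (Fin 6)) :
    fderiv ℝ (H.chartIncl p) z u = toChart (H.incl p) (H.incl ((extChartAt (𝓡 6) p).symm z))
      (H.push ((extChartAt (𝓡 6) p).symm z) (fromChart p z u)) := by
  have h1 := mdifferentiableAt_extChartAt_symm hz.1
  have h2 : MDifferentiableAt (𝓡 6) (𝓡 7) H.incl ((extChartAt (𝓡 6) p).symm z) :=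
    H.smooth.mdifferentiableAt (by simp)
  have h3 : MDifferentiableAt (𝓡 7) 𝓘(ℝ, EuclideanSpace ℝ (Fin 7)) (extChartAt (𝓡 7) (H.incl p))
      (H.incl ((extChartAt (𝓡 6) p).symm z)) :=
    mdifferentiableAt_extChartAt (by simpa using hz.2)
  have h4 := mfderiv_comp z (h3.comp _ h2) h1
  have h5 := mfderiv_comp ((extChartAt (𝓡 6) p).symm z) h3 h2
  have h6 : mfderiv 𝓘(ℝ, EuclideanSpace ℝ (Fin 6)) 𝓘(ℝ, EuclideanSpace ℝ (Fin 7))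
      (H.chartIncl p) z = _ := h4
  rw [h5] at h6
  rw [mfderiv_eq_fderiv] at h6
  exact congrArg (fun A : EuclideanSpace ℝ (Fin 6) →L[ℝ] EuclideanSpace ℝ (Fin 7) => A u) h6

/-- The unit normal field in the preferred charts. -/
def chartNormal (H : OrientedHypersurface G M) (p : M) (z : EuclideanSpace ℝ (Fin 6)) :
    EuclideanSpace ℝ (Fin 7) :=
  toChart (H.incl p) (H.incl ((extChartAt (𝓡 6) p).symm z))
    (H.normal ((extChartAt (𝓡 6) p).symm z))

/-- The chart expression of the normal is its fibre coordinate in the trivialisation at the image of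
`p`. -/
lemma contDiffAt_chartNormal (H : OrientedHypersurface G M) (p : M) :
    ContDiffAt ℝ ∞ (H.chartNormal p) (extChartAt (𝓡 6) p p) := by
  have h1 := (contMDiffAt_totalSpace.1 (H.normal_smooth p)).2
  have h2 := contMDiffAt_extChartAt_symm (mem_extChartAt_target (I := 𝓡 6) p)
  have h1' : ContMDiffAt (𝓡 6) 𝓘(ℝ, EuclideanSpace ℝ (Fin 7)) ∞
      (fun x => (trivializationAt (EuclideanSpace ℝ (Fin 7)) (TangentSpace (𝓡 7)) (H.incl p)
        ⟨H.incl x, H.normal x⟩).2) ((extChartAt (𝓡 6) p).symm (extChartAt (𝓡 6) p p)) := by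
    rw [extChartAt_to_inv]
    exact h1
  refine (h1'.comp _ h2).contDiffAt.congr_of_eventuallyEq ?_
  filter_upwards [H.chartDomain_mem_nhds p] with z hz
  have hs : H.incl ((extChartAt (𝓡 6) p).symm z) ∈
      (chartAt (EuclideanSpace ℝ (Fin 7)) (H.incl p)).source := by
    simpa using hz.2
  have h3 := TangentBundle.continuousLinearMapAt_trivializationAt (I := 𝓡 7) hs
  have h4 := (trivializationAt (EuclideanSpace ℝ (Fin 7)) (TangentSpace (𝓡 7) : N → Type _)
    (H.incl p)).continuousLinearMapAt_apply_of_mem (R := ℝ)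
    (b := H.incl ((extChartAt (𝓡 6) p).symm z)) (by simpa using hs)
  rw [h3] at h4
  exact h4 _

lemma chartG_chartIncl (H : OrientedHypersurface G M) {p : M} {z : EuclideanSpace ℝ (Fin 6)}
    (hz : z ∈ H.chartDomain p)
    (a b : TangentSpace (𝓡 7) (H.incl ((extChartAt (𝓡 6) p).symm z))) :
    G.chartG (H.incl p) (H.chartIncl p z) (toChart (H.incl p) _ a) (toChart (H.incl p) _ b) =
      G.bilin (H.incl ((extChartAt (𝓡 6) p).symm z)) a b :=
  chartMetric_toChart G.g hz.2 a b

lemma chartT_chartIncl (H : OrientedHypersurface G M) {p : M} {z : EuclideanSpace ℝ (Fin 6)}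
    (hz : z ∈ H.chartDomain p)
    (a b c : TangentSpace (𝓡 7) (H.incl ((extChartAt (𝓡 6) p).symm z))) :
    G.chartT (H.incl p) (H.chartIncl p z) (toChart (H.incl p) _ a) (toChart (H.incl p) _ b)
      (toChart (H.incl p) _ c) =
      tri (G.alt (H.incl ((extChartAt (𝓡 6) p).symm z))) a b c := by
  refine Eq.trans (congrArg (chartTensor G.phi (H.incl p) (H.chartIncl p z)) ?_)
    (chartTensor_toChart G.phi hz.2 ![a, b, c])
  funext i
  fin_cases i <;> rfl

lemma chartIncl_self (H : OrientedHypersurface G M) (p : M) :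
    H.chartIncl p (extChartAt (𝓡 6) p p) = extChartAt (𝓡 7) (H.incl p) (H.incl p) :=
  congrArg (fun x => extChartAt (𝓡 7) (H.incl p) (H.incl x)) (extChartAt_to_inv p)

lemma chartNormal_self (H : OrientedHypersurface G M) (p : M) :
    H.chartNormal p (extChartAt (𝓡 6) p p) = H.unitNormal p := by
  have key : ∀ x, x = p → (toChart (H.incl p) (H.incl x) (H.normal x) :
      EuclideanSpace ℝ (Fin 7)) = H.normal p := by
    rintro x rfl
    exact toChart_self _ _
  exact key _ (extChartAt_to_inv p)

lemma fderiv_chartIncl_self (H : OrientedHypersurface G M) (p : M)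
    (u : EuclideanSpace ℝ (Fin 6)) :
    fderiv ℝ (H.chartIncl p) (extChartAt (𝓡 6) p p) u = H.pushL p u := by
  have key : ∀ x, x = p → ∀ v : TangentSpace (𝓡 6) x, (v : EuclideanSpace ℝ (Fin 6)) = u →
      (toChart (H.incl p) (H.incl x) (H.push x v) : EuclideanSpace ℝ (Fin 7)) = H.pushL p u := by
    rintro x rfl v rfl
    exact toChart_self _ _
  rw [H.fderiv_chartIncl (H.self_mem_chartDomain p)]
  exact key _ (extChartAt_to_inv p) _ (fromChart_self p u)

lemma isChartHypersurface (H : OrientedHypersurface G M) (p : M) :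
    IsChartHypersurface (G.chartG (H.incl p)) (G.chartT (H.incl p)) (H.chartIncl p)
      (H.chartNormal p) (extChartAt (𝓡 6) p p) where
  diff := by
    filter_upwards [H.chartDomain_mem_nhds p] with z hz
    exact (H.contDiffAt_chartIncl hz).differentiableAt (by simp)
  diff₂ := ((H.contDiffAt_chartIncl (H.self_mem_chartDomain p)).fderiv_right (m := 1)
    (by norm_cast)).differentiableAt (by simp)
  diffG := by
    rw [chartIncl_self]
    exact G.differentiableAt_chartG _
  diffT := by
    rw [chartIncl_self]
    exact G.differentiableAt_chartT _
  diffν := (H.contDiffAt_chartNormal p).differentiableAt (by simp)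
  symmG _ _ _ := G.g_symm _ _ _
  swapT12 _ := formClm_swap12 _
  swapT23 _ := formClm_swap23 _
  unit := by
    filter_upwards [H.chartDomain_mem_nhds p] with z hz
    exact (H.chartG_chartIncl hz _ _).trans (H.normal_unit _)
  orth := by
    filter_upwards [H.chartDomain_mem_nhds p] with z hz v
    rw [H.fderiv_chartIncl hz]
    exact (H.chartG_chartIncl hz _ _).trans (H.normal_orth _ _)
  nondeg a ha hv := by
    have h := H.isUnitNormal p
    rw [chartIncl_self] at ha hv
    simp only [G.chartG_self, H.chartNormal_self, H.fderiv_chartIncl_self] at ha hv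
    -- A vector orthogonal to the normal is tangent, and is then orthogonal to itself.
    obtain ⟨w, rfl⟩ := h.exists_tangent finrank_euclideanSpace_fin finrank_euclideanSpace_fin ha
    exact h.eq_zero_of_self (hv w)

end OrientedHypersurface

end G2Hyp
end

/-! ### The induced `SU(3)`-structure in preferred charts. -/

noncomputable section

set_option maxSynthPendingDepth 3

namespace G2Hyp

lemma isInvertible_of_injective {E : Type*} [NormedAddCommGroup E] [NormedSpace ℝ E]
    [FiniteDimensional ℝ E] {A : E →L[ℝ] E →L[ℝ] ℝ} (hA : Function.Injective A) :
    A.IsInvertible := by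
  have hd : Module.finrank ℝ E = Module.finrank ℝ (E →L[ℝ] ℝ) := by
    rw [← (LinearMap.toContinuousLinearMap (𝕜 := ℝ) (E := E) (F' := ℝ)).finrank_eq]
    exact (Subspace.dual_finrank_eq (K := ℝ) (V := E)).symm
  exact ⟨(LinearEquiv.ofInjectiveOfFinrankEq A.toLinearMap hA hd).toContinuousLinearEquiv, rfl⟩

namespace OrientedHypersurface

open Filter Topology Bundle IsChartHypersurface

variable {N : Type*} [TopologicalSpace N] [ChartedSpace (EuclideanSpace ℝ (Fin 7)) N]
  [IsManifold (𝓡 7) ∞ N] {G : G2Structure N} {M : Type*} [TopologicalSpace M]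
  [ChartedSpace (EuclideanSpace ℝ (Fin 6)) M] [IsManifold (𝓡 6) ∞ M]

/-- The induced metric in the preferred chart. -/
def chartInd (H : OrientedHypersurface G M) (p : M) :
    EuclideanSpace ℝ (Fin 6) →
      EuclideanSpace ℝ (Fin 6) →L[ℝ] EuclideanSpace ℝ (Fin 6) →L[ℝ] ℝ :=
  indG (G.chartG (H.incl p)) (H.chartIncl p)

/-- The induced Kähler form in the preferred chart. -/
def chartKahler (H : OrientedHypersurface G M) (p : M) :
    EuclideanSpace ℝ (Fin 6) →
      EuclideanSpace ℝ (Fin 6) →L[ℝ] EuclideanSpace ℝ (Fin 6) →L[ℝ] ℝ :=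
  indω (G.chartT (H.incl p)) (H.chartIncl p) (H.chartNormal p)

lemma chartInd_apply (H : OrientedHypersurface G M) {p : M} {z : EuclideanSpace ℝ (Fin 6)}
    (hz : z ∈ H.chartDomain p) (a b : EuclideanSpace ℝ (Fin 6)) :
    H.chartInd p z a b = G.bilin (H.incl ((extChartAt (𝓡 6) p).symm z))
      (H.pushL ((extChartAt (𝓡 6) p).symm z) (fromChart p z a))
      (H.pushL ((extChartAt (𝓡 6) p).symm z) (fromChart p z b)) := by
  rw [chartInd, indG_apply, H.fderiv_chartIncl hz, H.fderiv_chartIncl hz]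
  exact H.chartG_chartIncl hz _ _

lemma chartKahler_apply (H : OrientedHypersurface G M) {p : M} {z : EuclideanSpace ℝ (Fin 6)}
    (hz : z ∈ H.chartDomain p) (a b : EuclideanSpace ℝ (Fin 6)) :
    H.chartKahler p z a b = -tri (G.alt (H.incl ((extChartAt (𝓡 6) p).symm z)))
      (H.unitNormal ((extChartAt (𝓡 6) p).symm z))
      (H.pushL ((extChartAt (𝓡 6) p).symm z) (fromChart p z a))
      (H.pushL ((extChartAt (𝓡 6) p).symm z) (fromChart p z b)) := by
  rw [chartKahler, indω_apply, H.fderiv_chartIncl hz, H.fderiv_chartIncl hz]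
  exact congrArg Neg.neg (H.chartT_chartIncl hz _ _ _)

lemma indT_chartIncl (H : OrientedHypersurface G M) {p : M} {z : EuclideanSpace ℝ (Fin 6)}
    (hz : z ∈ H.chartDomain p) (a b c : EuclideanSpace ℝ (Fin 6)) :
    indT (G.chartT (H.incl p)) (H.chartIncl p) z a b c =
      pullTri (G.alt (H.incl ((extChartAt (𝓡 6) p).symm z)))
        (H.pushL ((extChartAt (𝓡 6) p).symm z)) (fromChart p z a) (fromChart p z b)
        (fromChart p z c) := by
  rw [indT, H.fderiv_chartIncl hz, H.fderiv_chartIncl hz, H.fderiv_chartIncl hz]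
  exact H.chartT_chartIncl hz _ _ _

lemma chartMetric_gM (H : OrientedHypersurface G M) {p : M} {z : EuclideanSpace ℝ (Fin 6)}
    (hz : z ∈ H.chartDomain p) (a b : EuclideanSpace ℝ (Fin 6)) :
    chartMetric H.gM p z a b = H.chartInd p z a b := (H.chartInd_apply hz a b).symm

lemma fromChart_injective {p : M} {z : EuclideanSpace ℝ (Fin 6)}
    (hz : z ∈ (extChartAt (𝓡 6) p).target) {a : EuclideanSpace ℝ (Fin 6)}
    (ha : (fromChart p z a : EuclideanSpace ℝ (Fin 6)) = 0) : a = 0 := by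
  have h := toChart_fromChart hz a
  rw [← h]
  exact (congrArg (toChart p ((extChartAt (𝓡 6) p).symm z)) ha).trans (map_zero _)

lemma isInvertible_chartInd (H : OrientedHypersurface G M) {p : M}
    {z : EuclideanSpace ℝ (Fin 6)} (hz : z ∈ H.chartDomain p) :
    (H.chartInd p z).IsInvertible := by
  refine isInvertible_of_injective ((injective_iff_map_eq_zero _).2 fun a ha => ?_)
  have h := H.isUnitNormal ((extChartAt (𝓡 6) p).symm z)
  have h1 := H.chartInd_apply hz a a
  rw [ha] at h1
  have h2 := h.eq_zero_of_self h1.symm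
  exact fromChart_injective hz.1 ((map_eq_zero_iff _ h.inj).1 h2)

/-- The induced almost complex structure in the preferred chart. -/
def chartCplx (H : OrientedHypersurface G M) (p : M) (z : EuclideanSpace ℝ (Fin 6)) :
    EuclideanSpace ℝ (Fin 6) →L[ℝ] EuclideanSpace ℝ (Fin 6) :=
  (H.chartInd p z).inverse.comp (H.chartKahler p z).flip

/-- In the chart `J` is defined as `g⁻¹ ω`, which makes its differentiability accessible. It agrees
with the geometric one because both satisfy `g (J a, v) = ω (v, a)`. -/
lemma fromChart_chartCplx (H : OrientedHypersurface G M) {p : M} {z : EuclideanSpace ℝ (Fin 6)}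
    (hz : z ∈ H.chartDomain p) (a : EuclideanSpace ℝ (Fin 6)) :
    (fromChart p z (H.chartCplx p z a) : EuclideanSpace ℝ (Fin 6)) =
      H.cplx ((extChartAt (𝓡 6) p).symm z) (fromChart p z a) := by
  set x := (extChartAt (𝓡 6) p).symm z with hx
  have h := H.isUnitNormal x
  let b : EuclideanSpace ℝ (Fin 6) := toChart p x (H.cplx x (fromChart p z a))
  have hb : (fromChart p z b : EuclideanSpace ℝ (Fin 6)) = H.cplx x (fromChart p z a) :=
    fromChart_toChart_symm hz.1 _
  have h1 : H.chartInd p z b = (H.chartKahler p z).flip a := by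
    ext v
    refine (H.chartInd_apply hz b v).trans (Eq.trans ?_ (H.chartKahler_apply hz v a).symm)
    refine (congrArg (fun c => G.bilin (H.incl x) (H.pushL x c)
      (H.pushL x (fromChart p z v))) hb).trans ?_
    refine (h.tri_normal (H.pushL_cplx x) _ _).symm.trans ?_
    exact tri_swap23 _ _ _ _
  have h2 : H.chartCplx p z a = b := by
    obtain ⟨e, he⟩ := H.isInvertible_chartInd hz
    rw [chartCplx, ContinuousLinearMap.comp_apply, ← h1, ← he, ContinuousLinearMap.inverse_equiv]
    simp
  rw [h2]
  exact hb

lemma chartTensor_omega (H : OrientedHypersurface G M) (θ : M → ℝ) {p : M}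
    {z : EuclideanSpace ℝ (Fin 6)} (hz : z ∈ H.chartDomain p) (a b : EuclideanSpace ℝ (Fin 6)) :
    chartTensor (H.induced θ).omega p z ![a, b] = H.chartKahler p z a b := by
  set x := (extChartAt (𝓡 6) p).symm z with hx
  have h := H.isUnitNormal x
  refine Eq.trans ?_ (H.chartKahler_apply hz a b).symm
  refine (congrArg (fun c => G.bilin (H.incl x) (H.pushL x (fromChart p z a)) (H.pushL x c))
    (H.induced_J θ x (fromChart p z b))).trans ?_
  refine (h.symm _ _).trans ?_
  refine (h.tri_normal (H.pushL_cplx x) _ _).symm.trans ?_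
  exact tri_swap23 _ _ _ _

/-- The real part of the complex volume form at a point. -/
lemma induced_psiP (H : OrientedHypersurface G M) (θ : M → ℝ) (x : M)
    (v : Fin 3 → EuclideanSpace ℝ (Fin 6)) :
    (H.induced θ).psiP x v =
      Real.cos (θ x) * pullTri (G.alt (H.incl x)) (H.pushL x) (v 0) (v 1) (v 2)
        + Real.sin (θ x) * pullTri (G.alt (H.incl x)) (H.pushL x) (H.cplx x (v 0)) (v 1) (v 2) := by
  have h := H.isUnitNormal x
  have h1 : G.phi (H.incl x) (fun i => H.push x (v i)) =
      pullTri (G.alt (H.incl x)) (H.pushL x) (v 0) (v 1) (v 2) := by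
    refine congrArg (G.phi (H.incl x)) (funext fun i => ?_)
    fin_cases i <;> rfl
  have h2 : interior (H.normal x) (G.star (H.incl x)) (fun i => H.push x (v i)) =
      -pullTri (G.alt (H.incl x)) (H.pushL x) (H.cplx x (v 0)) (v 1) (v 2) :=
    (G.star_eq (H.incl x) _).trans (h.starL_normal (H.pushL_cplx x) _ _ _)
  change Real.cos (θ x) * _ - Real.sin (θ x) * _ = _
  rw [h1, h2]
  ring

/-- The imaginary part of the complex volume form at a point. -/
lemma induced_psiM (H : OrientedHypersurface G M) (θ : M → ℝ) (x : M)
    (v : Fin 3 → EuclideanSpace ℝ (Fin 6)) :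
    (H.induced θ).psiM x v =
      Real.sin (θ x) * pullTri (G.alt (H.incl x)) (H.pushL x) (v 0) (v 1) (v 2)
        - Real.cos (θ x) * pullTri (G.alt (H.incl x)) (H.pushL x) (H.cplx x (v 0)) (v 1) (v 2) := by
  have h := H.isUnitNormal x
  have h1 : G.phi (H.incl x) (fun i => H.push x (v i)) =
      pullTri (G.alt (H.incl x)) (H.pushL x) (v 0) (v 1) (v 2) := by
    refine congrArg (G.phi (H.incl x)) (funext fun i => ?_)
    fin_cases i <;> rfl
  have h2 : interior (H.normal x) (G.star (H.incl x)) (fun i => H.push x (v i)) =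
      -pullTri (G.alt (H.incl x)) (H.pushL x) (H.cplx x (v 0)) (v 1) (v 2) :=
    (G.star_eq (H.incl x) _).trans (h.starL_normal (H.pushL_cplx x) _ _ _)
  change Real.sin (θ x) * _ + Real.cos (θ x) * _ = _
  rw [h1, h2]
  ring

lemma chartTensor_psiP (H : OrientedHypersurface G M) (θ : M → ℝ) {p : M}
    {z : EuclideanSpace ℝ (Fin 6)} (hz : z ∈ H.chartDomain p)
    (a b c : EuclideanSpace ℝ (Fin 6)) :
    chartTensor (H.induced θ).psiP p z ![a, b, c] =
      Real.cos (θ ((extChartAt (𝓡 6) p).symm z)) *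
          indT (G.chartT (H.incl p)) (H.chartIncl p) z a b c
        + Real.sin (θ ((extChartAt (𝓡 6) p).symm z)) *
          indT (G.chartT (H.incl p)) (H.chartIncl p) z (H.chartCplx p z a) b c := by
  rw [H.indT_chartIncl hz, H.indT_chartIncl hz, H.fromChart_chartCplx hz]
  exact H.induced_psiP θ _ _

/-- The Levi-Civita connection of the induced metric, at the centre of the preferred chart. -/
def Gamma (H : OrientedHypersurface G M) (p : M) (a b : EuclideanSpace ℝ (Fin 6)) :
    EuclideanSpace ℝ (Fin 6) :=
  christoffel (chartMetric H.gM p) (extChartAt (𝓡 6) p p) a b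

lemma chartInd_self (H : OrientedHypersurface G M) (p : M) (a b : EuclideanSpace ℝ (Fin 6)) :
    H.chartInd p (extChartAt (𝓡 6) p p) a b =
      (G.bilin (H.incl p)).compl₁₂ (H.pushL p) (H.pushL p) a b := by
  rw [chartInd, indG_apply, H.fderiv_chartIncl_self, H.fderiv_chartIncl_self, H.chartIncl_self,
    G.chartG_self]
  rfl

lemma isChristoffel_Gamma (H : OrientedHypersurface G M) (p : M) :
    IsChristoffel (H.chartInd p) (extChartAt (𝓡 6) p p) (H.Gamma p) := by
  obtain ⟨f, hf⟩ := (H.isUnitNormal p).exists_isSU3Basis finrank_euclideanSpace_fin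
    finrank_euclideanSpace_fin (H.pushL_cplx p)
  have h : lin₂ (H.chartInd p (extChartAt (𝓡 6) p p)) =
      (G.bilin (H.incl p)).compl₁₂ (H.pushL p) (H.pushL p) := by
    ext u v
    exact H.chartInd_self p u v
  refine isChristoffel_christoffel ?_ (H.isChartHypersurface p).differentiableAt_indG
    (e := f) ?_
  · filter_upwards [H.chartDomain_mem_nhds p] with z hz a b
    exact H.chartMetric_gM hz a b
  · rw [h]
    exact hf.toIsONBasis

end OrientedHypersurface

end G2Hyp
end

/-! ### The second fundamental form and the formula for `∇ω`. -/

noncomputable section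

set_option maxSynthPendingDepth 3

namespace G2Hyp

namespace IsChartHypersurface

variable {E F : Type*} [NormedAddCommGroup E] [NormedSpace ℝ E] [NormedAddCommGroup F]
  [NormedSpace ℝ F] [FiniteDimensional ℝ E] {G : F → F →L[ℝ] F →L[ℝ] ℝ}
  {T : F → F →L[ℝ] F →L[ℝ] F →L[ℝ] ℝ} {f ν : E → F} {z : E} {Γ' : F → F → F}

omit [FiniteDimensional ℝ E] in
-- `Γ'` is known only through Koszul's identity, with no linearity assumed; in this form the
-- bilinearity and symmetry of `B` can be read off.
lemma chartB_eq (hΓ' : IsChristoffel G (f z) Γ') (u v : E) :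
    chartB G f ν Γ' z u v = G (f z) (fderiv ℝ (fderiv ℝ f) z u v) (ν z)
      + (1 / 2) * (fderiv ℝ G (f z) (fderiv ℝ f z u) (fderiv ℝ f z v) (ν z)
        + fderiv ℝ G (f z) (fderiv ℝ f z v) (fderiv ℝ f z u) (ν z)
        - fderiv ℝ G (f z) (ν z) (fderiv ℝ f z u) (fderiv ℝ f z v)) := by
  have h := hΓ' (fderiv ℝ f z u) (fderiv ℝ f z v) (ν z)
  rw [chartB, covPush, map_add, add_apply]
  linarith

omit [FiniteDimensional ℝ E] in
lemma chartB_symm (h : IsChartHypersurface G T f ν z) (hΓ' : IsChristoffel G (f z) Γ')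
    (u v : E) : chartB G f ν Γ' z u v = chartB G f ν Γ' z v u := by
  rw [chartB_eq hΓ', chartB_eq hΓ', h.fderiv₂_symm u v,
    fderiv_symm h.diffG h.symmG (ν z) (fderiv ℝ f z u)]
  ring

end IsChartHypersurface

namespace OrientedHypersurface

open Filter Topology Bundle IsChartHypersurface

variable {N : Type*} [TopologicalSpace N] [ChartedSpace (EuclideanSpace ℝ (Fin 7)) N]
  [IsManifold (𝓡 7) ∞ N] {G : G2Structure N} {M : Type*} [TopologicalSpace M]
  [ChartedSpace (EuclideanSpace ℝ (Fin 6)) M] [IsManifold (𝓡 6) ∞ M]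

lemma isChristoffel_ambient (H : OrientedHypersurface G M) (p : M) :
    IsChristoffel (G.chartG (H.incl p)) (H.chartIncl p (extChartAt (𝓡 6) p p))
      (G.Gamma (H.incl p)) := by
  rw [chartIncl_self]
  exact G.isChristoffel_Gamma _

/-- The second fundamental form at a point as a bilinear form. -/
def sff (H : OrientedHypersurface G M) (p : M) :
    EuclideanSpace ℝ (Fin 6) →ₗ[ℝ] EuclideanSpace ℝ (Fin 6) →ₗ[ℝ] ℝ :=
  LinearMap.mk₂ ℝ (chartB (G.chartG (H.incl p)) (H.chartIncl p) (H.chartNormal p)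
      (G.Gamma (H.incl p)) (extChartAt (𝓡 6) p p))
    (fun a b c => by
      simp only [chartB_eq (H.isChristoffel_ambient p), map_add, add_apply]
      ring)
    (fun r b c => by
      simp only [chartB_eq (H.isChristoffel_ambient p), map_smul, smul_apply, smul_eq_mul]
      ring)
    (fun a b c => by
      simp only [chartB_eq (H.isChristoffel_ambient p), map_add, add_apply]
      ring)
    (fun r b c => by
      simp only [chartB_eq (H.isChristoffel_ambient p), map_smul, smul_apply, smul_eq_mul]
      ring)

lemma sff_symm (H : OrientedHypersurface G M) (p : M) (x y : EuclideanSpace ℝ (Fin 6)) :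
    H.sff p x y = H.sff p y x :=
  (H.isChartHypersurface p).chartB_symm (H.isChristoffel_ambient p) x y

lemma secondFund_eq (H : OrientedHypersurface G M) (p : M) (x y : EuclideanSpace ℝ (Fin 6)) :
    H.secondFund p x y = H.sff p x y := by
  have h1 : ∀ v : EuclideanSpace ℝ (Fin 6), (toChart p p v : EuclideanSpace ℝ (Fin 6)) = v :=
    toChart_self p
  have h2 : ∀ v : EuclideanSpace ℝ (Fin 6),
      (toChart (H.incl p) (H.incl p) (H.push p v) : EuclideanSpace ℝ (Fin 7)) =
        fderiv ℝ (H.chartIncl p) (extChartAt (𝓡 6) p p) v :=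
    fun v => (toChart_self _ _).trans (H.fderiv_chartIncl_self p v).symm
  have h3 : (toChart (H.incl p) (H.incl p) (H.normal p) : EuclideanSpace ℝ (Fin 7)) =
      H.chartNormal p (extChartAt (𝓡 6) p p) :=
    (toChart_self _ _).trans (H.chartNormal_self p).symm
  have h4 : fderiv ℝ (fun z => fderiv ℝ (H.chartIncl p) z y) (extChartAt (𝓡 6) p p) x =
      fderiv ℝ (fderiv ℝ (H.chartIncl p)) (extChartAt (𝓡 6) p p) x y := by
    rw [((H.isChartHypersurface p).hasFDerivAt_push y).fderiv]
    rfl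
  have h5 : H.secondFund p x y = chartMetric G.g (H.incl p)
      (extChartAt (𝓡 7) (H.incl p) (H.incl p))
      (fderiv ℝ (fun z => fderiv ℝ (H.chartIncl p) z y) (extChartAt (𝓡 6) p p) x
        + G.Gamma (H.incl p) (fderiv ℝ (H.chartIncl p) (extChartAt (𝓡 6) p p) x)
          (fderiv ℝ (H.chartIncl p) (extChartAt (𝓡 6) p p) y))
      (H.chartNormal p (extChartAt (𝓡 6) p p)) := by
    rw [← h2, ← h2, ← h3]
    have := h1 x
    have h1y := h1 y
    simp only [secondFund]
    rw [this, h1y]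
    rfl
  rw [h5, h4, ← H.chartIncl_self]
  rfl

/-- The induced metric at a point as a bilinear form. -/
def indBilin (H : OrientedHypersurface G M) (p : M) :
    EuclideanSpace ℝ (Fin 6) →ₗ[ℝ] EuclideanSpace ℝ (Fin 6) →ₗ[ℝ] ℝ :=
  (G.bilin (H.incl p)).compl₁₂ (H.pushL p) (H.pushL p)

/-- The pull-back of the fundamental three-form at a point. -/
def indTri (H : OrientedHypersurface G M) (p : M) :
    EuclideanSpace ℝ (Fin 6) →ₗ[ℝ] EuclideanSpace ℝ (Fin 6) →ₗ[ℝ]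
      EuclideanSpace ℝ (Fin 6) →ₗ[ℝ] ℝ :=
  pullTri (G.alt (H.incl p)) (H.pushL p)

/-- The chosen orthonormal basis of a tangent space of the hypersurface. -/
def tframe (H : OrientedHypersurface G M) (p : M) : Fin 6 → EuclideanSpace ℝ (Fin 6) :=
  onFrame 6 fun x y => H.indBilin p x y

lemma isSU3Basis (H : OrientedHypersurface G M) (p : M) :
    IsSU3Basis (H.indBilin p) (H.cplx p) (H.indTri p) (H.tframe p) := by
  obtain ⟨f, hf⟩ := (H.isUnitNormal p).exists_isSU3Basis finrank_euclideanSpace_fin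
    finrank_euclideanSpace_fin (H.pushL_cplx p)
  exact hf.of_basis hf.toIsONBasis.onFrame

/-- The covariant derivative of the Kähler form for a Lee vector `l` of the ambient structure. -/
def torsionTensor (H : OrientedHypersurface G M) (p : M) (l : EuclideanSpace ℝ (Fin 7)) :
    EuclideanSpace ℝ (Fin 6) →ₗ[ℝ] EuclideanSpace ℝ (Fin 6) →ₗ[ℝ]
      EuclideanSpace ℝ (Fin 6) →ₗ[ℝ] ℝ :=
  IsSU3Basis.torsion (H.indBilin p) (H.cplx p) (H.indTri p) (H.tframe p) (H.sff p)
    (G.bilin (H.incl p) l (H.unitNormal p))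
    ((4 : ℝ) • (tri (G.alt (H.incl p)) l (H.unitNormal p) ∘ₗ H.pushL p))

/-- The shape operator sends `u` to `∑ B (u, f_d) f_d`, which contracts `B` with `ρ`. The ambient
derivative with `n` inserted gives `⟨l, n⟩ ρ` and the `W₄` term, by `starL_cross_normal`. -/
lemma cov_chartKahler (H : OrientedHypersurface G M) {p : M} {l : EuclideanSpace ℝ (Fin 7)}
    (hl : G.IsLeeVector (H.incl p) l) (u v w : EuclideanSpace ℝ (Fin 6)) :
    fderiv ℝ (H.chartKahler p) (extChartAt (𝓡 6) p p) u v w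
      - H.chartKahler p (extChartAt (𝓡 6) p p) (H.Gamma p u v) w
      - H.chartKahler p (extChartAt (𝓡 6) p p) v (H.Gamma p u w) = H.torsionTensor p l u v w := by
  have hb := H.isSU3Basis p
  have h := H.isUnitNormal p
  have ha : ∀ v, indG (G.chartG (H.incl p)) (H.chartIncl p) (extChartAt (𝓡 6) p p)
      (∑ d, H.sff p u (H.tframe p d) • H.tframe p d) v =
      chartB (G.chartG (H.incl p)) (H.chartIncl p) (H.chartNormal p) (G.Gamma (H.incl p))
        (extChartAt (𝓡 6) p p) u v := by
    intro v
    refine (H.chartInd_self p _ v).trans ?_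
    change H.indBilin p _ v = H.sff p u v
    rw [hb.apply_eq_sum (H.sff p u) v]
    simp only [map_sum, map_smul, LinearMap.sum_apply, LinearMap.smul_apply, smul_eq_mul]
    exact Finset.sum_congr rfl fun _ _ => mul_comm _ _
  refine ((H.isChartHypersurface p).cov_indω (H.isChristoffel_ambient p)
    (H.isChristoffel_Gamma p) u v w ha).trans ?_
  simp only [H.chartIncl_self, H.fderiv_chartIncl_self, H.chartNormal_self]
  rw [hl, h.starL_cross_normal (H.pushL_cplx p), G.chartT_self, torsionTensor, hb.torsion_apply]
  have e1 : tri (G.alt (H.incl p)) (H.pushL p (∑ d, H.sff p u (H.tframe p d) • H.tframe p d))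
      (H.pushL p v) (H.pushL p w) = ∑ d, H.sff p u (H.tframe p d) *
        H.indTri p (H.tframe p d) v w := by
    simp only [map_sum, map_smul, LinearMap.sum_apply, LinearMap.smul_apply, smul_eq_mul]
    rfl
  rw [e1, add_comm]
  rfl

lemma nablaOmega_eq (H : OrientedHypersurface G M) (θ : M → ℝ) {p : M}
    {l : EuclideanSpace ℝ (Fin 7)} (hl : G.IsLeeVector (H.incl p) l)
    (u v w : EuclideanSpace ℝ (Fin 6)) :
    (H.induced θ).nablaOmega p u v w = H.torsionTensor p l u v w := by
  refine (nabla_eq (H.induced θ).g (H.induced θ).omega p u ![v, w]).trans ?_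
  rw [← H.cov_chartKahler hl, Fin.sum_univ_two]
  have e0 : Function.update ![v, w] 0 (H.Gamma p u v) = ![H.Gamma p u v, w] := by
    funext i; fin_cases i <;> rfl
  have e1 : Function.update ![v, w] 1 (H.Gamma p u w) = ![v, H.Gamma p u w] := by
    funext i; fin_cases i <;> rfl
  change _ - (chartTensor (H.induced θ).omega p _ (Function.update ![v, w] 0 (H.Gamma p u v))
    + chartTensor (H.induced θ).omega p _ (Function.update ![v, w] 1 (H.Gamma p u w))) = _
  have hz := H.self_mem_chartDomain p
  rw [e0, e1, H.chartTensor_omega θ hz, H.chartTensor_omega θ hz]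
  obtain ⟨D, hD, hD'⟩ := (H.isChartHypersurface p).hasFDerivAt_indω_apply v w
  have h1 : fderiv ℝ (fun z => chartTensor (H.induced θ).omega p z ![v, w])
      (extChartAt (𝓡 6) p p) = D := by
    refine (hD.congr_of_eventuallyEq ?_).fderiv
    filter_upwards [H.chartDomain_mem_nhds p] with z hz
    exact H.chartTensor_omega θ hz v w
  have h2 := fderiv_clm_apply₂ (H.isChartHypersurface p).differentiableAt_indω hD u
  rw [h1]
  change D u - _ = fderiv ℝ (indω _ _ _) _ u v w - _ - _
  rw [h2]
  ring

end OrientedHypersurface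

end G2Hyp
end

/-! ### The covariant derivative of `ψ₊` and the one-form `η`. -/

noncomputable section

set_option maxSynthPendingDepth 3

namespace G2Hyp

namespace OrientedHypersurface

open Filter Topology Bundle IsChartHypersurface

variable {N : Type*} [TopologicalSpace N] [ChartedSpace (EuclideanSpace ℝ (Fin 7)) N]
  [IsManifold (𝓡 7) ∞ N] {G : G2Structure N} {M : Type*} [TopologicalSpace M]
  [ChartedSpace (EuclideanSpace ℝ (Fin 6)) M] [IsManifold (𝓡 6) ∞ M]

/-- The differential of a function as a linear form on the model space. -/
def dL (θ : M → ℝ) (p : M) : EuclideanSpace ℝ (Fin 6) →L[ℝ] ℝ :=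
  mfderiv (𝓡 6) 𝓘(ℝ, ℝ) θ p

lemma hasFDerivAt_chart {θ : M → ℝ} (hθ : ContMDiff (𝓡 6) 𝓘(ℝ, ℝ) ∞ θ) (p : M) :
    HasFDerivAt (fun z => θ ((extChartAt (𝓡 6) p).symm z)) (dL θ p) (extChartAt (𝓡 6) p p) := by
  have h1 := mdifferentiableAt_extChartAt_symm (mem_extChartAt_target (I := 𝓡 6) p)
  have h2 : MDifferentiableAt (𝓡 6) 𝓘(ℝ, ℝ) θ
      ((extChartAt (𝓡 6) p).symm (extChartAt (𝓡 6) p p)) := hθ.mdifferentiableAt (by simp)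
  have h3 := (h2.comp _ h1).differentiableAt.hasFDerivAt
  have h4 := mfderiv_comp (extChartAt (𝓡 6) p p) h2 h1
  rw [mfderiv_eq_fderiv] at h4
  have h5 : fderiv ℝ (θ ∘ (extChartAt (𝓡 6) p).symm) (extChartAt (𝓡 6) p p) = dL θ p := by
    rw [h4]
    ext u
    have key : ∀ x, x = p → ∀ v : TangentSpace (𝓡 6) x, (v : EuclideanSpace ℝ (Fin 6)) = u →
        (mfderiv (𝓡 6) 𝓘(ℝ, ℝ) θ x v : ℝ) = dL θ p u := by
      rintro x rfl v rfl
      rfl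
    exact key _ (extChartAt_to_inv p) _ (fromChart_self p u)
  rw [h5] at h3
  exact h3

/-- `K` is `∇_u J`, the metric dual of `∇_u ω`, and `R` is the derivative of `ι^*φ` after the Gauss
formula. Quantifying over `R` lets a simplified expression be supplied for it. -/
lemma exists_nabla_psiP (H : OrientedHypersurface G M) {θ : M → ℝ}
    (hθ : ContMDiff (𝓡 6) 𝓘(ℝ, ℝ) ∞ θ) {p : M} {l : EuclideanSpace ℝ (Fin 7)}
    (hl : G.IsLeeVector (H.incl p) l) (u : EuclideanSpace ℝ (Fin 6)) :
    ∃ K : EuclideanSpace ℝ (Fin 6) → EuclideanSpace ℝ (Fin 6),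
      (∀ v w, H.indBilin p v (K w) = H.torsionTensor p l u v w) ∧
      ∀ R : EuclideanSpace ℝ (Fin 6) → EuclideanSpace ℝ (Fin 6) → EuclideanSpace ℝ (Fin 6) → ℝ,
      (∀ a b c, R a b c = starL (G.bilin (H.incl p)) (crossL (G.alt (H.incl p))
          (G.frame (H.incl p))) (crossL (G.alt (H.incl p)) (G.frame (H.incl p)) l (H.pushL p u))
          (H.pushL p a) (H.pushL p b) (H.pushL p c)
        + (H.sff p u a * H.indBilin p (H.cplx p b) c - H.sff p u b * H.indBilin p (H.cplx p a) c
          + H.sff p u c * H.indBilin p (H.cplx p a) b)) →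
      ∀ a b c : EuclideanSpace ℝ (Fin 6), nabla (H.induced θ).g (H.induced θ).psiP p u ![a, b, c] =
        Real.cos (θ p) * R a b c
          + Real.sin (θ p) * (R (H.cplx p a) b c + H.indTri p (K a) b c)
          + dL θ p u * (-(Real.sin (θ p) * H.indTri p a b c)
            + Real.cos (θ p) * H.indTri p (H.cplx p a) b c) := by
  have hz := H.self_mem_chartDomain p
  have hc := H.isChartHypersurface p
  have h := H.isUnitNormal p
  obtain ⟨J', hJ, hJ'⟩ := hc.hasFDerivAt_J (H.isChristoffel_Gamma p) (J := H.chartCplx p)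
    (Eventually.of_forall fun _ => rfl) (H.isInvertible_chartInd hz)
  have hJp : ∀ a, H.chartCplx p (extChartAt (𝓡 6) p p) a = H.cplx p a := by
    intro a
    have key : ∀ x, x = p → ∀ v : TangentSpace (𝓡 6) x, (v : EuclideanSpace ℝ (Fin 6)) = a →
        H.cplx x v = H.cplx p a := by
      rintro x rfl v rfl
      rfl
    refine (fromChart_self p _).symm.trans ((H.fromChart_chartCplx hz a).trans ?_)
    exact key _ (extChartAt_to_inv p) _ (fromChart_self p a)
  have hT : ∀ a b c, indT (G.chartT (H.incl p)) (H.chartIncl p) (extChartAt (𝓡 6) p p) a b c =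
      H.indTri p a b c := by
    intro a b c
    rw [indT, H.fderiv_chartIncl_self, H.fderiv_chartIncl_self, H.fderiv_chartIncl_self,
      H.chartIncl_self, G.chartT_self]
    rfl
  have hθp : θ ((extChartAt (𝓡 6) p).symm (extChartAt (𝓡 6) p p)) = θ p := by
    rw [extChartAt_to_inv]
  refine ⟨fun w => J' u w + H.Gamma p u (H.chartCplx p (extChartAt (𝓡 6) p p) w)
    - H.chartCplx p (extChartAt (𝓡 6) p p) (H.Gamma p u w), fun v w => ?_, fun R hR a b c => ?_⟩
  · refine (H.chartInd_self p _ _).symm.trans ?_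
    exact (hJ' u v w).trans (H.cov_chartKahler hl u v w)
  · have hV := hc.cov_volume (H.isChristoffel_ambient p) (H.isChristoffel_Gamma p) hJ
      (hasFDerivAt_chart hθ p) u a b c
    have hcov : ∀ a b c, covIndT (G.chartG (H.incl p)) (G.chartT (H.incl p)) (H.chartIncl p)
        (H.chartNormal p) (G.Gamma (H.incl p)) (extChartAt (𝓡 6) p p) u a b c = R a b c := by
      intro a b c
      rw [hR, covIndT]
      simp only [H.chartIncl_self, H.fderiv_chartIncl_self, H.chartNormal_self, G.chartT_self]
      rw [hl]
      have hn : ∀ x y, tri (G.alt (H.incl p)) (H.unitNormal p) (H.pushL p x) (H.pushL p y) =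
        H.indBilin p (H.cplx p x) y := fun x y => h.tri_normal (H.pushL_cplx p) x _
      rw [tri_swap12 _ (H.pushL p a) (H.unitNormal p), ← tri_rot _ (H.unitNormal p) (H.pushL p a),
        hn, hn, hn]
      change _ + H.sff p u a * _ + H.sff p u b * _ + H.sff p u c * _ = _
      ring
    simp only [hcov, hT, hJp, hθp] at hV
    refine Eq.trans ?_ (hV.trans ?_)
    · refine (nabla_eq (H.induced θ).g (H.induced θ).psiP p u ![a, b, c]).trans ?_
      rw [Fin.sum_univ_three]
      have e0 : Function.update ![a, b, c] 0 (H.Gamma p u a) = ![H.Gamma p u a, b, c] := by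
        funext i; fin_cases i <;> rfl
      have e1 : Function.update ![a, b, c] 1 (H.Gamma p u b) = ![a, H.Gamma p u b, c] := by
        funext i; fin_cases i <;> rfl
      have e2 : Function.update ![a, b, c] 2 (H.Gamma p u c) = ![a, b, H.Gamma p u c] := by
        funext i; fin_cases i <;> rfl
      change _ - (chartTensor (H.induced θ).psiP p _ (Function.update ![a, b, c] 0 (H.Gamma p u a))
        + chartTensor (H.induced θ).psiP p _ (Function.update ![a, b, c] 1 (H.Gamma p u b))
        + chartTensor (H.induced θ).psiP p _
          (Function.update ![a, b, c] 2 (H.Gamma p u c))) = _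
      rw [e0, e1, e2, H.chartTensor_psiP θ hz, H.chartTensor_psiP θ hz, H.chartTensor_psiP θ hz]
      simp only [hT, hJp, hθp]
      congr 1
      refine congrArg (fun D : EuclideanSpace ℝ (Fin 6) →L[ℝ] ℝ => D u)
        (Filter.EventuallyEq.fderiv_eq ?_)
      filter_upwards [H.chartDomain_mem_nhds p] with z hz
      exact H.chartTensor_psiP θ hz a b c
    · simp only [hJp]

/-- The second fundamental form only changes the one-form in the part of the derivative orthogonal
to `ψ₋`. What remains is `⟨n, l × Ix⟩ = ⟨l, x⟩` and `dθ (Ix)`. -/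
lemma eta_eq (H : OrientedHypersurface G M) {θ : M → ℝ}
    (hθ : ContMDiff (𝓡 6) 𝓘(ℝ, ℝ) ∞ θ) {p : M} {l : EuclideanSpace ℝ (Fin 7)}
    (hl : G.IsLeeVector (H.incl p) l) (x : EuclideanSpace ℝ (Fin 6)) :
    (H.induced θ).eta p x =
      -(1 / 3) * (G.bilin (H.incl p) l (H.pushL p x) - dL θ p (H.cplx p x)) := by
  have h := H.isUnitNormal p
  have hb := H.isSU3Basis p
  set u := H.cplx p x with hu
  obtain ⟨K, hK, hK'⟩ := H.exists_nabla_psiP hθ hl u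
  obtain ⟨μ, hμ⟩ := h.starL_cross_tangent (H.pushL_cplx p)
    (crossL (G.alt (H.incl p)) (G.frame (H.incl p)) l (H.pushL p u))
  have hm := hb.torsion_mem (H.sff p) (G.bilin (H.incl p) l (H.unitNormal p))
    ((4 : ℝ) • (tri (G.alt (H.incl p)) l (H.unitNormal p) ∘ₗ H.pushL p))
  have hm1 : ∀ x y z, H.torsionTensor p l x y z = -H.torsionTensor p l x z y := hm.1
  have hm2 : ∀ x y z, H.torsionTensor p l x (H.cplx p y) (H.cplx p z) =
    -H.torsionTensor p l x y z := hm.2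
  set w := crossL (G.alt (H.incl p)) (G.frame (H.incl p)) l (H.pushL p u) with hw
  have hΨ := hK' (fun a b c => -(G.bilin (H.incl p) (H.unitNormal p) w *
      H.indTri p (H.cplx p a) b c) + ((μ + H.sff p u) a * H.indBilin p (H.cplx p b) c
        - (μ + H.sff p u) b * H.indBilin p (H.cplx p a) c
        + (μ + H.sff p u) c * H.indBilin p (H.cplx p a) b)) fun a b c => by
    rw [hμ]
    simp only [LinearMap.add_apply, indBilin, indTri, LinearMap.compl₁₂_apply]
    ring
  have h1 := hb.formInner_deriv rfl (Real.cos_sq_add_sin_sq (θ p)) (μ + H.sff p u) K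
    (fun y z => by rw [hK, hK, hm1]) (fun y z => by rw [hK, hK, hm2])
    (fun _ _ _ => rfl) hΨ (fun x y z => H.induced_psiM θ p ![x, y, z])
  have h2 : G.bilin (H.incl p) (H.unitNormal p) w = G.bilin (H.incl p) l (H.pushL p x) := by
    rw [h.symm, hw, h.cross_inner, tri_rot, tri_rot, tri_swap23,
      h.tri_normal (H.pushL_cplx p), hu, h.J_J (H.pushL_cplx p), map_neg, map_neg,
      LinearMap.neg_apply, neg_neg, h.symm]
  have h3 : (H.induced θ).eta p x = -(1 / 12) * formInner 6 (fun x y => H.indBilin p x y)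
      (nabla (H.induced θ).g (H.induced θ).psiP p u) ((H.induced θ).psiM p) :=
    congrArg (fun v => -(1 / 12) * formInner 6 ((H.induced θ).g p)
      (nabla (H.induced θ).g (H.induced θ).psiP p v) ((H.induced θ).psiM p)) (H.induced_J θ p x)
  rw [h3]
  refine (congrArg _ h1).trans ?_
  rw [h2]
  ring

end OrientedHypersurface

end G2Hyp
end

/-! ### From vanishing components to geometric conditions. -/

noncomputable section

set_option maxSynthPendingDepth 3

namespace G2Hyp

lemma TorsionClass.forall_iff {P : TorsionClass → Prop} :
    (∀ j, P j) ↔ P .W1p ∧ P .W1m ∧ P .W2p ∧ P .W2m ∧ P .W3 ∧ P .W4 ∧ P .W5 :=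
  ⟨fun h => ⟨h _, h _, h _, h _, h _, h _, h _⟩, fun ⟨h1, h2, h3, h4, h5, h6, h7⟩ j => by
    cases j <;> assumption⟩

/-- A tensor lies in a sum of torsion modules if and only if the other components of its image
under `r` vanish. -/
lemma IsSU3Basis.exists_mem_iff {V : Type*} [AddCommGroup V] [Module ℝ V]
    {g : V →ₗ[ℝ] V →ₗ[ℝ] ℝ} {J : V →ₗ[ℝ] V} {ρ : V →ₗ[ℝ] V →ₗ[ℝ] V →ₗ[ℝ] ℝ} {f : Fin 6 → V}
    (h : IsSU3Basis g J ρ f) (hf : f = onFrame 6 fun x y => g x y) {c s : ℝ}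
    (hcs : c ^ 2 + s ^ 2 = 1) {ψ : (Fin 3 → V) → ℝ}
    (hψ : ∀ v, ψ v = c * ρ (v 0) (v 1) (v 2) + s * ρ (J (v 0)) (v 1) (v 2))
    (A : Set TorsionClass) {J' : V → V} (hJ : J' = J) {t : V →ₗ[ℝ] V →ₗ[ℝ] V →ₗ[ℝ] ℝ}
    (ht : t ∈ hermTensors J) {t' : V → V → V → ℝ} (htt : ∀ x y z, t' x y z = t x y z) :
    (∃ α ∈ ⨆ i ∈ A, torsionModule (fun x y => g x y) J' ψ i, ∀ x y z, t' x y z = α x y z) ↔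
      ∀ j ∉ A, ∀ x y, part g J f (twist J c s (rForm ρ f t)) j x y = 0 := by
  subst hJ
  rw [← h.mem_iSup_iff hf hcs (ψ := ψ) (fun v => by simp [hψ]) A ht]
  constructor
  · rintro ⟨α, hα, ha⟩
    have : t = α := by
      ext x y z
      rw [← htt, ha]
    rwa [this]
  · exact fun ha => ⟨t, ha, htt⟩

namespace OrientedHypersurface

variable {N : Type*} [TopologicalSpace N] [ChartedSpace (EuclideanSpace ℝ (Fin 7)) N]
  [IsManifold (𝓡 7) ∞ N] {G : G2Structure N} {M : Type*} [TopologicalSpace M]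
  [ChartedSpace (EuclideanSpace ℝ (Fin 6)) M] [IsManifold (𝓡 6) ∞ M]

lemma trace_cplx (H : OrientedHypersurface G M) (p : M) (l : EuclideanSpace ℝ (Fin 7))
    (x : EuclideanSpace ℝ (Fin 6)) :
    ((4 : ℝ) • (tri (G.alt (H.incl p)) l (H.unitNormal p) ∘ₗ H.pushL p)) (H.cplx p x) =
      -4 * G.bilin (H.incl p) l (H.pushL p x) := by
  have h := H.isUnitNormal p
  rw [LinearMap.smul_apply, LinearMap.comp_apply, tri_rot, h.tri_normal (H.pushL_cplx p),
    h.J_J (H.pushL_cplx p), map_neg, map_neg, LinearMap.neg_apply, h.symm, smul_eq_mul]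
  ring

/-- Only `τ` contributes to the trace: the rest contracts a symmetric form with a skew one. -/
lemma codiffOmega_eq (H : OrientedHypersurface G M) (θ : M → ℝ) {p : M}
    {l : EuclideanSpace ℝ (Fin 7)} (hl : G.IsLeeVector (H.incl p) l)
    (x : EuclideanSpace ℝ (Fin 6)) : (H.induced θ).codiffOmega p x =
      -((4 : ℝ) • (tri (G.alt (H.incl p)) l (H.unitNormal p) ∘ₗ H.pushL p)) x := by
  rw [← (H.isSU3Basis p).tr12_torsion (H.sff_symm p) (G.bilin (H.incl p) l (H.unitNormal p))]
  exact congrArg Neg.neg (Finset.sum_congr rfl fun i _ => H.nablaOmega_eq θ hl _ _ _)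

lemma meanCurv_eq (H : OrientedHypersurface G M) (p : M) :
    H.meanCurv p = (1 / 6) * ∑ i, H.sff p (H.tframe p i) (H.tframe p i) := by
  have h1 : H.meanCurv p = (1 / 6) * ∑ i, H.secondFund p (H.tframe p i) (H.tframe p i) := rfl
  have h2 : ∀ i, H.secondFund p (H.tframe p i) (H.tframe p i) =
    H.sff p (H.tframe p i) (H.tframe p i) := fun i => H.secondFund_eq p _ _
  exact h1.trans (congrArg (fun t => 1 / 6 * t) (Finset.sum_congr rfl fun i _ => h2 i))

/-- Each absent label contributes exactly one geometric condition, so all ten characterisations are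
instances of this one equivalence. -/
lemma isOfType_iff (H : OrientedHypersurface G M) {θ : M → ℝ} (hG : G.IsTypeX4)
    (A : Set TorsionClass) : (H.induced θ).IsOfType A ↔ ∀ p,
      (.W1p ∉ A → Real.cos (θ p) * (G.pdStar (H.incl p) (H.normal p) - 12 * H.meanCurv p) = 0) ∧
      (.W1m ∉ A → Real.sin (θ p) * (G.pdStar (H.incl p) (H.normal p) - 12 * H.meanCurv p) = 0) ∧
      (.W2p ∉ A → ∀ x y, Real.cos (θ p) * (2 * H.meanCurv p * (H.induced θ).g p x y) =
        Real.cos (θ p) * (H.secondFund p x y +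
          H.secondFund p ((H.induced θ).J p x) ((H.induced θ).J p y))) ∧
      (.W2m ∉ A → ∀ x y, Real.sin (θ p) * (2 * H.meanCurv p * (H.induced θ).g p x y) =
        Real.sin (θ p) * (H.secondFund p x y +
          H.secondFund p ((H.induced θ).J p x) ((H.induced θ).J p y))) ∧
      (.W3 ∉ A → ∀ x y, H.secondFund p ((H.induced θ).J p x) ((H.induced θ).J p y) =
        H.secondFund p x y) ∧
      (.W4 ∉ A → ∀ x, G.g (H.incl p) (G.pVec (H.incl p)) (H.push p x) = 0) ∧
      (.W5 ∉ A → ∀ x, (H.induced θ).eta p x = 0) := by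
  refine forall_congr' fun p => ?_
  obtain ⟨l, hl⟩ := G.exists_isLeeVector hG (H.incl p)
  have hb := H.isSU3Basis p
  have hpd := G.pdStar_eq hl
  have hcs := Real.cos_sq_add_sin_sq (θ p)
  have hn : G.pdStar (H.incl p) (H.normal p) =
      -12 * G.bilin (H.incl p) l (H.unitNormal p) := hpd _
  have hJ : ∀ x, (H.induced θ).J p x = H.cplx p x := H.induced_J θ p
  have hB : ∀ x y, H.secondFund p ((H.induced θ).J p x) ((H.induced θ).J p y) =
      H.sff p (H.cplx p x) (H.cplx p y) := fun x y =>
    (H.secondFund_eq p _ _).trans (congrArg₂ (fun a b => H.sff p a b) (hJ x) (hJ y))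
  have hm := H.meanCurv_eq p
  have hs := H.sff_symm p
  refine (and_congr ((hb.exists_mem_iff rfl hcs (H.induced_psiP θ p) A (funext hJ)
    (hb.torsion_mem _ _ _) (H.nablaOmega_eq θ hl)).trans TorsionClass.forall_iff) Iff.rfl).trans ?_
  simp only [and_assoc]
  refine and_congr (imp_congr_right fun _ => (hb.part_W1p_iff hs _ _ hm).trans ?_)
    (and_congr (imp_congr_right fun _ => (hb.part_W1m_iff hs _ _ hm).trans ?_)
    (and_congr (imp_congr_right fun _ => (hb.part_W2p_iff hs _ _ hm).trans ?_)
    (and_congr (imp_congr_right fun _ => (hb.part_W2m_iff hs _ _ hm).trans ?_)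
    (and_congr (imp_congr_right fun _ => (hb.part_W3_iff hs _ _ hm hcs).trans ?_)
    (and_congr (imp_congr_right fun _ => (hb.part_W4_iff hs _ _ hm hcs).trans ?_) ?_)))))
  -- By `pd*φ (n) = -12 ⟨l, n⟩` the bracket is `-12 (h + ⟨l, n⟩)`.
  · rw [hn]
    constructor <;> intro h0 <;> linarith
  · rw [hn]
    constructor <;> intro h0 <;> linarith
  · exact forall₂_congr fun x y => iff_of_eq (congrArg₂ (fun a b =>
      Real.cos (θ p) * (2 * H.meanCurv p * H.indBilin p x y) = Real.cos (θ p) * (a + b))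
      (H.secondFund_eq p x y).symm (hB x y).symm)
  · exact forall₂_congr fun x y => iff_of_eq (congrArg₂ (fun a b =>
      Real.sin (θ p) * (2 * H.meanCurv p * H.indBilin p x y) = Real.sin (θ p) * (a + b))
      (H.secondFund_eq p x y).symm (hB x y).symm)
  · exact forall₂_congr fun x y => iff_of_eq (congrArg₂ (fun a b => b = a)
      (H.secondFund_eq p x y).symm (hB x y).symm)
  · have hv : ∀ x : EuclideanSpace ℝ (Fin 6), G.g (H.incl p) (G.pVec (H.incl p)) (H.push p x) =
        -12 * G.bilin (H.incl p) l (H.pushL p x) := fun x =>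
      (G.g_pVec (H.incl p) hpd _).trans (hpd _)
    -- `τ (Jx)` is a multiple of `⟨l, x⟩` and `J` is invertible, so `τ = 0` means that `l` is
    -- normal.
    constructor
    · intro h0 x
      have h1 := (h0 _).symm.trans (H.trace_cplx p l x)
      exact (hv x).trans (by linarith)
    · intro h0 x
      have h1 := H.trace_cplx p l (H.cplx p x)
      have h2 := (hv (H.cplx p x)).symm.trans (h0 (H.cplx p x))
      rw [hb.J_sq, map_neg] at h1
      linarith
  · exact and_iff_right fun _ => IsSU3Basis.part_W5 _

lemma actJ_codiffOmega (H : OrientedHypersurface G M) (hG : G.IsTypeX4) (θ : M → ℝ) {p : M}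
    (x : TangentSpace (𝓡 6) p) : 3 * (H.induced θ).actJ p ((H.induced θ).codiffOmega p) x =
      G.pdStar (H.incl p) (H.push p x) := by
  obtain ⟨l, hl⟩ := G.exists_isLeeVector hG (H.incl p)
  have h1 : (H.induced θ).codiffOmega p ((H.induced θ).J p x) = _ :=
    (congrArg ((H.induced θ).codiffOmega p) (H.induced_J θ p x)).trans (H.codiffOmega_eq θ hl _)
  rw [SU3Tensors.actJ, h1]
  refine Eq.trans ?_ (G.pdStar_eq hl (H.pushL p x)).symm
  have h2 := H.trace_cplx p l x
  linarith

lemma pdStar_push (H : OrientedHypersurface G M) (hG : G.IsTypeX4) {θ : M → ℝ}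
    (hθ : ContMDiff (𝓡 6) 𝓘(ℝ, ℝ) ∞ θ) {p : M} (x : TangentSpace (𝓡 6) p) :
    G.pdStar (H.incl p) (H.push p x) =
      12 * (H.induced θ).actJ p (fun y => mfderiv (𝓡 6) 𝓘(ℝ, ℝ) θ p y) x
        + 36 * (H.induced θ).eta p x := by
  obtain ⟨l, hl⟩ := G.exists_isLeeVector hG (H.incl p)
  have h1 : (H.induced θ).actJ p (fun y => mfderiv (𝓡 6) 𝓘(ℝ, ℝ) θ p y) x =
      -dL θ p (H.cplx p x) := congrArg (fun v => -dL θ p v) (H.induced_J θ p x)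
  refine (G.pdStar_eq hl (H.pushL p x)).trans ?_
  rw [h1]
  refine Eq.trans ?_ (congrArg (fun t => 12 * -dL θ p (H.cplx p x) + 36 * t)
    (H.eta_eq hθ hl x).symm)
  ring

lemma gM_J_J (H : OrientedHypersurface G M) (θ : M → ℝ) (p : M) (x y : TangentSpace (𝓡 6) p) :
    H.gM p ((H.induced θ).J p x) ((H.induced θ).J p y) = H.gM p x y := by
  refine (congrArg₂ (H.gM p) (H.induced_J θ p x) (H.induced_J θ p y)).trans ?_
  exact (H.isSU3Basis p).J_isometry x y

end OrientedHypersurface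

end G2Hyp
end

theorem theorem4p11
    {N : Type*} [TopologicalSpace N] [ChartedSpace (EuclideanSpace ℝ (Fin 7)) N]
    [IsManifold (𝓡 7) ∞ N]
    {M : Type*} [TopologicalSpace M] [ChartedSpace (EuclideanSpace ℝ (Fin 6)) M]
    [IsManifold (𝓡 6) ∞ M]
    (G : G2Hyp.G2Structure N) (hG : G.IsTypeX4)
    (H : G2Hyp.OrientedHypersurface G M)
    (θ : M → ℝ) (hθ : ContMDiff (𝓡 6) 𝓘(ℝ, ℝ) ∞ θ)
    (S : G2Hyp.SU3Tensors M) (hS : S = H.induced θ) :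
    -- `3 I d*ω = ι^* pd*φ = 12 I dθ + 36 η`
    (∀ p x, 3 * S.actJ p (S.codiffOmega p) x = G.pdStar (H.incl p) (H.push p x)) ∧
    (∀ p x, G.pdStar (H.incl p) (H.push p x) =
      12 * S.actJ p (fun y => mfderiv (𝓡 6) 𝓘(ℝ, ℝ) θ p y) x + 36 * S.eta p x) ∧
    -- the ten characterisations of types
    (S.IsOfType {.W1p, .W1m, .W2p, .W2m, .W3, .W4} ↔
      ∀ p x, G.pdStar (H.incl p) (H.push p x) =
        12 * S.actJ p (fun y => mfderiv (𝓡 6) 𝓘(ℝ, ℝ) θ p y) x) ∧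
    (S.IsOfType {.W1p, .W1m, .W2p, .W2m, .W3, .W5} ↔
      ∀ p x, G.g (H.incl p) (G.pVec (H.incl p)) (H.push p x) = 0) ∧
    (S.IsOfType {.W1p, .W1m, .W2p, .W2m, .W4, .W5} ↔
      ∀ p x y, H.secondFund p (S.J p x) (S.J p y) = H.secondFund p x y) ∧
    (S.IsOfType {.W1p, .W1m, .W2p, .W3, .W4, .W5} ↔
      ∀ p x y, Real.sin (θ p) * (2 * H.meanCurv p * S.g p x y) =
        Real.sin (θ p) * (H.secondFund p x y + H.secondFund p (S.J p x) (S.J p y))) ∧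
    (S.IsOfType {.W1p, .W1m, .W2m, .W3, .W4, .W5} ↔
      ∀ p x y, Real.cos (θ p) * (2 * H.meanCurv p * S.g p x y) =
        Real.cos (θ p) * (H.secondFund p x y + H.secondFund p (S.J p x) (S.J p y))) ∧
    (S.IsOfType {.W1p, .W2p, .W2m, .W3, .W4, .W5} ↔
      ∀ p, Real.sin (θ p) * (G.pdStar (H.incl p) (H.normal p) - 12 * H.meanCurv p) = 0) ∧
    (S.IsOfType {.W1m, .W2p, .W2m, .W3, .W4, .W5} ↔
      ∀ p, Real.cos (θ p) * (G.pdStar (H.incl p) (H.normal p) - 12 * H.meanCurv p) = 0) ∧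
    (S.IsOfType {.W1p, .W1m, .W3, .W4, .W5} ↔
      ∀ p x y, H.secondFund p x y + H.secondFund p (S.J p x) (S.J p y) =
        2 * H.meanCurv p * S.g p x y) ∧
    (S.IsOfType {.W2p, .W2m, .W3, .W4, .W5} ↔
      ∀ p, G.pdStar (H.incl p) (H.normal p) = 12 * H.meanCurv p) ∧
    (S.IsOfType {.W1p, .W1m, .W4, .W5} ↔ H.IsTotallyUmbilic) := by
  subst hS
  have h1 : ∀ p x, 3 * (H.induced θ).actJ p ((H.induced θ).codiffOmega p) x =
      G.pdStar (H.incl p) (H.push p x) := fun p x => H.actJ_codiffOmega hG θ x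
  have h2 : ∀ p x, G.pdStar (H.incl p) (H.push p x) =
      12 * (H.induced θ).actJ p (fun y => mfderiv (𝓡 6) 𝓘(ℝ, ℝ) θ p y) x
        + 36 * (H.induced θ).eta p x := fun p x => H.pdStar_push hG hθ x
  refine ⟨h1, h2, ?_⟩
  -- Evaluating memberships settles the types that omit just one of the labels other than `W5`.
  -- There remain the type without `W5` and the three that omit at least two labels.
  simp only [H.isOfType_iff hG, Set.mem_insert_iff, Set.mem_singleton_iff, reduceCtorEq, or_false,
    or_true, not_true_eq_false, not_false_eq_true, false_imp_iff, true_imp_iff, true_and, and_true]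
  refine ⟨?_, ?_, ?_, ?_⟩
  · refine forall₂_congr fun p x => ?_
    rw [h2]
    constructor <;> intro h0 <;> linarith
  · refine forall_congr' fun p => ?_
    have hcs := Real.cos_sq_add_sin_sq (θ p)
    constructor
    · rintro ⟨hc, hs⟩ x y
      -- Weighting the two conditions with `cos θ` and `sin θ` removes the angle.
      linear_combination -Real.cos (θ p) * hc x y - Real.sin (θ p) * hs x y + (2 * H.meanCurv p *
        (H.induced θ).g p x y - (H.secondFund p x y +
          H.secondFund p ((H.induced θ).J p x) ((H.induced θ).J p y))) * hcs
    · intro h0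
      exact ⟨fun x y => by rw [h0], fun x y => by rw [h0]⟩
  · refine forall_congr' fun p => ?_
    have hcs := Real.cos_sq_add_sin_sq (θ p)
    constructor
    · rintro ⟨hc, hs⟩
      linear_combination Real.cos (θ p) * hc + Real.sin (θ p) * hs
        - (G.pdStar (H.incl p) (H.normal p) - 12 * H.meanCurv p) * hcs
    · intro h0
      rw [h0]
      simp
  · refine forall_congr' fun p => ?_
    have hcs := Real.cos_sq_add_sin_sq (θ p)
    constructor
    · rintro ⟨hc, hs, h3⟩ x y
      have hc' := hc x y
      have hs' := hs x y
      -- `IB = B` reduces `(1 + I) B = 2h g` to `B = h g`.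
      rw [h3] at hc' hs'
      change _ = _ * (H.induced θ).g p x y
      linear_combination -(1 / 2) * Real.cos (θ p) * hc' - (1 / 2) * Real.sin (θ p) * hs'
        + (H.meanCurv p * (H.induced θ).g p x y - H.secondFund p x y) * hcs
    · intro h0
      have h3 : ∀ x y, H.secondFund p ((H.induced θ).J p x) ((H.induced θ).J p y) =
          H.secondFund p x y := fun x y => by
        rw [h0, h0, H.gM_J_J]
      refine ⟨fun x y => ?_, fun x y => ?_, h3⟩ <;>
      · rw [h3, h0]
        change _ * (_ * H.gM p x y) = _
        ring
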